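/- Consider the one-dimensional cubic Gabitov--Turitsyn equation $$i u_t+\gamma\,\partial_x^2u+\int_0^1 e^{-i\sigma\partial_x^2}\Big[\big|e^{i\sigma\partial_x^2}u\big|^2\,e^{i\sigma\partial_x^2}u\Big]\,d\sigma=0,\qquad u(0,x)=u_0(x),\tag{GT}$$ for $u:(-T,T)\times\mathbb R\to\mathbb C$, where $\gamma\in\mathbb R$, $\gamma\neq0$, is a constant. A solution on $(-T,T)$ is a function $u\in C((-T,T);L^2(\mathbb R))$ that satisfies the Duhamel formula $$u(t)=e^{i\gamma t\partial_x^2}u_0+i\int_0^t e^{i\gamma(t-\tau)\partial_x^2}\int_0^1e^{-i\sigma\partial_x^2}\Big[\big|e^{i\sigma\partial_x^2}u(\tau)\big|^2e^{i\sigma\partial_x^2}u(\tau)\Big]\,d\sigma\,d\tau ,\qquad |t|<T,$$ with integrals in $L^2(\mathbb R)$. Let $\|f\|_{H^s}^2=\int_{\mathbb R}(1+\xi^2)^s|\widehat f(\xi)|^2\,d\xi$ with $\widehat f(\xi)=\frac1{\sqrt{2\pi}}\int e^{-i\xi x}f(x)\,dx$. Let $\gamma\ne0$ and $s<-\frac32$.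 Then: 1. (Norm inflation in $H^s$.) For every $\epsilon>0$ there are Schwartz (in particular smooth) initial data $u_0$, a corresponding solution $u$ of (GT) on some interval $(-T_0,T_0)$, and a time $t\in(-T_0,T_0)$ with $$\|u_0\|_{H^s}<\epsilon,\qquad |t|<\epsilon,\qquad \|u(t)\|_{H^s}>\epsilon^{-1}.$$ 2. For every $T>0$, every $u_0\in L^2(\mathbb R)$ has exactly one solution of (GT) on $(-T,T)$, and the data-to-solution map $u_0\mapsto u$, even when restricted to Schwartz data, fails to be continuous at $u_0=0$ from the $H^s$ norm to the norm $\sup_{|t|<T}\|u(t)\|_{H^s}$ of $C_tH^s_x((-T,T))$. -/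

import Mathlib

open MeasureTheory Set
open scoped FourierTransform ENNReal SchwartzMap

noncomputable section

namespace GT

/-- The Hilbert space `L²(ℝ; ℂ)`. -/
abbrev L2 : Type := Lp ℂ 2 (volume : Measure ℝ)

/-- The symbol of `e^{itΔ}`. The transform `𝓕` has kernel `e^{-2πixζ}`, so that the angular
frequency is `ξ = 2πζ` and the symbol is `e^{-itξ²}`. -/
def schrodingerSymbol (t ζ : ℝ) : ℂ :=
  Complex.exp (-(Complex.I * ((t * (2 * Real.pi * ζ) ^ 2 : ℝ) : ℂ)))

theorem memLp_schrodingerSymbol_mul (t : ℝ) (g : L2) :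
    MemLp (fun ζ : ℝ => schrodingerSymbol t ζ * g ζ) 2 volume := by
  have hc : Continuous (schrodingerSymbol t) := by
    unfold schrodingerSymbol
    fun_prop
  refine (Lp.memLp g).of_le (hc.aestronglyMeasurable.mul (Lp.aestronglyMeasurable g)) ?_
  refine Filter.Eventually.of_forall fun ζ => ?_
  have h : ‖schrodingerSymbol t ζ‖ = 1 := by
    have h' : -(Complex.I * ((t * (2 * Real.pi * ζ) ^ 2 : ℝ) : ℂ)) =
        ((-(t * (2 * Real.pi * ζ) ^ 2) : ℝ) : ℂ) * Complex.I := by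
      push_cast
      ring
    rw [schrodingerSymbol, h', Complex.norm_exp_ofReal_mul_I]
  rw [norm_mul, h, one_mul]

/-- The free Schrödinger propagator `e^{itΔ}` on `L²(ℝ)`, as a Fourier multiplier. -/
def schrodinger (t : ℝ) (f : L2) : L2 :=
  𝓕⁻ ((memLp_schrodingerSymbol_mul t (𝓕 f)).toLp
    (fun ζ : ℝ => schrodingerSymbol t ζ * (𝓕 f : L2) ζ))

/-- `f` has a cube `|f|² f` in `L²(ℝ)` (that is, `f ∈ L⁶`). -/
def HasCube (f : L2) : Prop :=
  MemLp (fun x : ℝ => ((‖f x‖ ^ 2 : ℝ) : ℂ) * f x) 2 volume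

open Classical in
/-- The cubic expression `|f|² f` as an element of `L²(ℝ)`; it is only meaningful under
`HasCube f`. -/
def cube (f : L2) : L2 :=
  if h : HasCube f then MemLp.toLp (fun x : ℝ => ((‖f x‖ ^ 2 : ℝ) : ℂ) * f x) h else 0

/-- The integrand `e^{-iσΔ} [ |e^{iσΔ} f|² e^{iσΔ} f ]` of the nonlinearity. -/
def nonlinearityIntegrand (f : L2) (σ : ℝ) : L2 :=
  schrodinger (-σ) (cube (schrodinger σ f))

/-- The nonlinearity `∫₀¹ e^{-iσΔ} [ |e^{iσΔ} f|² e^{iσΔ} f ] dσ`, an integral in `L²(ℝ)`. -/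
def nonlinearity (f : L2) : L2 :=
  ∫ σ in (0 : ℝ)..1, nonlinearityIntegrand f σ

/-- `u ∈ C((-T,T); L²(ℝ))` is a strong solution on `(-T,T)` of
`i u_t + γ Δu + ∫₀¹ e^{-iσΔ} [ |e^{iσΔ} u|² e^{iσΔ} u ] dσ = 0`, `u(0) = u₀`, that is, it satisfies
the Duhamel formula. The fields `hasCube`, `integrable_nonlinearity` and `integrable_duhamel` say
that every expression in that formula is meaningful. -/
structure IsSolution (γ T : ℝ) (u₀ : L2) (u : ℝ → L2) : Prop where
  continuousOn : ContinuousOn u (Ioo (-T) T)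
  hasCube : ∀ t ∈ Ioo (-T) T, ∀ᵐ σ ∂(volume.restrict (Icc (0 : ℝ) 1)),
    HasCube (schrodinger σ (u t))
  integrable_nonlinearity : ∀ t ∈ Ioo (-T) T,
    IntervalIntegrable (nonlinearityIntegrand (u t)) volume 0 1
  integrable_duhamel : ∀ t ∈ Ioo (-T) T,
    IntervalIntegrable (fun τ => schrodinger (γ * (t - τ)) (nonlinearity (u τ))) volume 0 t
  duhamel : ∀ t ∈ Ioo (-T) T,
    u t = schrodinger (γ * t) u₀ +
      Complex.I • ∫ τ in (0 : ℝ)..t, schrodinger (γ * (t - τ)) (nonlinearity (u τ))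

/-- The inhomogeneous Sobolev norm `(∫ (1 + ξ²)^s |f̂(ξ)|² dξ)^{1/2}`, with values in `[0,∞]`. Here
`f̂` is the unitary transform `f̂(ξ) = (2π)^{-1/2} ∫ e^{-iξx} f(x) dx`; the substitution `ξ = 2πζ`
turns the integral into the one below. -/
def sobolevNorm (s : ℝ) (f : L2) : ℝ≥0∞ :=
  (∫⁻ ζ : ℝ, ENNReal.ofReal ((1 + (2 * Real.pi * ζ) ^ 2) ^ s) *
    ENNReal.ofReal (‖(𝓕 f : L2) ζ‖ ^ 2)) ^ (1 / 2 : ℝ)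

/-- Norm inflation in `H^s`: arbitrarily small Schwartz data with a solution whose `H^s` norm is
arbitrarily large at an arbitrarily small time. -/
def NormInflation (γ s : ℝ) : Prop :=
  ∀ ε : ℝ, 0 < ε → ∃ (φ : 𝓢(ℝ, ℂ)) (T : ℝ) (u : ℝ → L2) (t : ℝ),
    IsSolution γ T (φ.toLp 2) u ∧ t ∈ Ioo (-T) T ∧ |t| < ε ∧
    sobolevNorm s (φ.toLp 2) < ENNReal.ofReal ε ∧
    ENNReal.ofReal ε⁻¹ < sobolevNorm s (u t)

/-- `S` is the data-to-solution map on `(-T,T)`: for each `u₀ ∈ L²`, `S u₀` is a solution with data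
`u₀`, and it is the only one (functions of time are compared on `(-T,T)`). -/
def IsDataToSolutionMap (γ T : ℝ) (S : L2 → ℝ → L2) : Prop :=
  ∀ u₀ : L2, IsSolution γ T u₀ (S u₀) ∧
    ∀ u : ℝ → L2, IsSolution γ T u₀ u → EqOn u (S u₀) (Ioo (-T) T)

/-- The map `S`, restricted to Schwartz data, is continuous at `0` from the `H^s` norm to the norm
`sup_{|t| < T} ‖·‖_{H^s}` of `C((-T,T); H^s)`. -/
def ContinuousAtZero (s T : ℝ) (S : L2 → ℝ → L2) : Prop :=
  ∀ ε : ℝ, 0 < ε → ∃ δ : ℝ, 0 < δ ∧ ∀ φ : 𝓢(ℝ, ℂ),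
    sobolevNorm s (φ.toLp 2) < ENNReal.ofReal δ →
      (⨆ t ∈ Ioo (-T) T, sobolevNorm s (S (φ.toLp 2) t - S 0 t)) < ENNReal.ofReal ε

end GT

end

/-!
In the interaction picture `w t = S (-γt) (u t)`, with `S` the free evolution, the equation is the
ordinary differential equation `w' = i F(t, w)` in `L²`, where `F(t, w) = S (-γt) 𝒩 (S (γt) w)`. The
`L⁶` Strichartz estimate makes `F(t, ·)` locally Lipschitz, uniformly in `t`, and `⟨w, F(t, w)⟩` is
real, so norms are conserved and solutions are global. The Strichartz estimate is obtained by
testing against a Gaussian weight in time, which turns the sixth power of the free evolution into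
an explicit positive kernel on the frequency side.

For the inflation, take a datum `φ` with Fourier transform of height `l` on `|ξ| ~ N`, and a
test function `ψ` supported near frequency `0`. The data have no component along `ψ`, but the
resonant form `Im ⟨ψ, 𝒩 φ⟩` is an integral of `(1 - cos θ) / θ` over frequencies with a phase `θ` of
constant sign, and it is bounded below by a multiple of `l³`. Over a time `t` this moves `⟨ψ, u t⟩`
by `t l³` up to errors which the dispersive decay of `S σ φ` makes small, and for `s < -3/2` the
parameters can be chosen so that `φ` is small in `H^s` while `t l³` is large.
-/

noncomputable section

namespace GabitovTuritsyn

open GT Filter Topology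

section Lp

variable {α E : Type*} [MeasurableSpace α] {μ : Measure α} [NormedAddCommGroup E]

theorem enorm_sq_eq_lintegral (f : Lp E 2 μ) : ‖f‖ₑ ^ 2 = ∫⁻ x, ‖f x‖ₑ ^ 2 ∂μ := by
  rw [Lp.enorm_def]
  simpa using eLpNorm_nnreal_pow_eq_lintegral (f := f) (μ := μ) (p := 2) two_ne_zero

theorem tendsto_eLpNorm_of_dominated {p : ℝ≥0∞} (hp₀ : p ≠ 0) (hp : p ≠ ∞) {ι : Type*}
    {l : Filter ι} [l.IsCountablyGenerated] {G : ι → α → E} {g : α → ℝ}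
    (hG : ∀ᶠ i in l, AEStronglyMeasurable (G i) μ) (hg : MemLp g p μ)
    (bound : ∀ᶠ i in l, ∀ᵐ x ∂μ, ‖G i x‖ ≤ g x)
    (hlim : ∀ᵐ x ∂μ, Tendsto (fun i => G i x) l (𝓝 0)) :
    Tendsto (fun i => eLpNorm (G i) p μ) l (𝓝 0) := by
  have hp_pos : 0 < p.toReal := ENNReal.toReal_pos hp₀ hp
  simp_rw [eLpNorm_eq_lintegral_rpow_enorm_toReal hp₀ hp]
  suffices Tendsto (fun i => ∫⁻ x, ‖G i x‖ₑ ^ p.toReal ∂μ) l (𝓝 0) by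
    simpa [hp_pos] using this.ennrpow_const (1 / p.toReal)
  rw [← lintegral_zero (μ := μ)]
  refine tendsto_lintegral_filter_of_dominated_convergence' (fun x => ‖g x‖ₑ ^ p.toReal) ?_ ?_
    (lintegral_rpow_enorm_lt_top_of_eLpNorm_lt_top hp₀ hp hg.eLpNorm_lt_top).ne ?_
  · filter_upwards [hG] with i hi using hi.enorm.pow_const _
  · filter_upwards [bound] with i hi
    filter_upwards [hi] with x hx
    gcongr
    exact enorm_le_iff_norm_le.2 (hx.trans (Real.le_norm_self _))
  · filter_upwards [hlim] with x hx
    simpa [hp_pos] using hx.enorm.ennrpow_const p.toReal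

theorem tendsto_Lp_of_dominated {p : ℝ≥0∞} [Fact (1 ≤ p)] (hp : p ≠ ∞) {ι : Type*}
    {l : Filter ι} [l.IsCountablyGenerated] {F : ι → Lp E p μ} {f : Lp E p μ} {G : ι → α → E}
    {g : α → ℝ} (hFG : ∀ i, F i =ᵐ[μ] G i) (hg : MemLp g p μ)
    (bound : ∀ i, ∀ᵐ x ∂μ, ‖G i x‖ ≤ g x)
    (hlim : ∀ᵐ x ∂μ, Tendsto (fun i => G i x) l (𝓝 (f x))) : Tendsto F l (𝓝 f) := by
  have hsub (i : ι) : ⇑(F i) - ⇑f =ᵐ[μ] fun x => G i x - f x := by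
    filter_upwards [hFG i] with x hx
    rw [Pi.sub_apply, hx]
  rw [Lp.tendsto_Lp_iff_tendsto_eLpNorm']
  simp_rw [fun i => eLpNorm_congr_ae (p := p) (hsub i)]
  refine tendsto_eLpNorm_of_dominated (zero_lt_one.trans_le Fact.out).ne' hp
    (g := fun x => g x + ‖f x‖) ?_ (hg.add (Lp.memLp f).norm) ?_ ?_
  · exact .of_forall fun i =>
      ((Lp.aestronglyMeasurable (F i)).sub (Lp.aestronglyMeasurable f)).congr (hsub i)
  · refine .of_forall fun i => ?_
    filter_upwards [bound i] with x hx
    exact (norm_sub_le _ _).trans (by gcongr)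
  · filter_upwards [hlim] with x hx
    simpa using hx.sub_const (f x)

theorem lowerSemicontinuous_lintegral_enorm_pow {p : ℝ≥0∞} [Fact (1 ≤ p)] (n : ℕ) :
    LowerSemicontinuous fun f : Lp E p μ => ∫⁻ x, ‖f x‖ₑ ^ n ∂μ := by
  refine lowerSemicontinuous_iff_isClosed_preimage.2 fun c => ?_
  refine IsSeqClosed.isClosed fun F f hF hlim => ?_
  obtain ⟨k, -, hk⟩ := (tendstoInMeasure_of_tendsto_Lp hlim).exists_seq_tendsto_ae
  have hmeas (j : ℕ) : AEMeasurable (fun x => ‖F (k j) x‖ₑ ^ n) μ :=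
    (Lp.aestronglyMeasurable _).enorm.pow_const n
  calc ∫⁻ x, ‖f x‖ₑ ^ n ∂μ
      = ∫⁻ x, liminf (fun j => ‖F (k j) x‖ₑ ^ n) atTop ∂μ := by
        refine lintegral_congr_ae ?_
        filter_upwards [hk] with x hx
        exact (((ENNReal.continuous_pow n).tendsto _).comp hx.enorm).liminf_eq.symm
    _ ≤ liminf (fun j => ∫⁻ x, ‖F (k j) x‖ₑ ^ n ∂μ) atTop := lintegral_liminf_le' hmeas
    _ ≤ c := liminf_le_of_le (h := fun b hb => by
        obtain ⟨j, hj⟩ := hb.exists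
        exact hj.trans (hF _))

end Lp

section RadialRetraction

variable {E : Type*} [NormedAddCommGroup E] [NormedSpace ℝ E] {R : ℝ}

/-- The retraction of a normed space onto its closed ball of radius `R > 0` along rays; it is
used to truncate nonlinearities that are only locally Lipschitz. -/
def radialRetraction (R : ℝ) (w : E) : E := (R / max R ‖w‖) • w

theorem norm_radialRetraction_le (hR : 0 < R) (w : E) : ‖radialRetraction R w‖ ≤ R := by
  have hmax : 0 < max R ‖w‖ := hR.trans_le (le_max_left _ _)
  rw [radialRetraction, norm_smul, Real.norm_of_nonneg (by positivity), div_mul_eq_mul_div,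
    div_le_iff₀ hmax]
  gcongr
  exact le_max_right _ _

theorem radialRetraction_eq_self (hR : 0 < R) {w : E} (hw : ‖w‖ ≤ R) :
    radialRetraction R w = w := by
  rw [radialRetraction, max_eq_left hw, div_self hR.ne', one_smul]

theorem norm_radialRetraction_le_norm (hR : 0 < R) (w : E) : ‖radialRetraction R w‖ ≤ ‖w‖ := by
  have hmax : 0 < max R ‖w‖ := hR.trans_le (le_max_left _ _)
  rw [radialRetraction, norm_smul, Real.norm_of_nonneg (by positivity)]
  exact mul_le_of_le_one_left (norm_nonneg _) ((div_le_one hmax).2 (le_max_left _ _))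

theorem norm_radialRetraction_sub_le (hR : 0 < R) (v w : E) :
    ‖radialRetraction R v - radialRetraction R w‖ ≤ 2 * ‖v - w‖ := by
  set a := max R ‖v‖
  set b := max R ‖w‖
  have ha : 0 < a := hR.trans_le (le_max_left _ _)
  have hb : 0 < b := hR.trans_le (le_max_left _ _)
  have hab : |b - a| ≤ ‖v - w‖ :=
    (abs_max_sub_max_le_max R ‖w‖ R ‖v‖).trans
      (by simpa [abs_sub_comm ‖w‖] using abs_norm_sub_norm_le v w)
  have hcoef : R / a - R / b = R / a * (b - a) / b := by field_simp
  have hRa : R / a ≤ 1 := (div_le_one ha).2 (le_max_left _ _)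
  calc ‖radialRetraction R v - radialRetraction R w‖
      = ‖(R / a) • (v - w) + (R / a - R / b) • w‖ := by
        rw [radialRetraction, radialRetraction, smul_sub, sub_smul]
        congr 1
        abel
    _ ≤ R / a * ‖v - w‖ + R / a * |b - a| * (‖w‖ / b) := by
        refine (norm_add_le _ _).trans (add_le_add ?_ ?_)
        · rw [norm_smul, Real.norm_of_nonneg (by positivity)]
        · rw [norm_smul, hcoef, Real.norm_eq_abs, abs_div, abs_mul, abs_of_pos hb,
            abs_of_nonneg (by positivity : 0 ≤ R / a), mul_div_assoc', div_mul_eq_mul_div]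
    _ ≤ 1 * ‖v - w‖ + 1 * ‖v - w‖ * 1 := by
        gcongr
        exact (div_le_one hb).2 (le_max_right _ _)
    _ = 2 * ‖v - w‖ := by ring

theorem lipschitzWith_radialRetraction (hR : 0 < R) :
    LipschitzWith 2 (radialRetraction R : E → E) :=
  LipschitzWith.of_dist_le_mul fun v w => by
    simpa only [dist_eq_norm, NNReal.coe_ofNat] using norm_radialRetraction_sub_le hR v w

end RadialRetraction

section ConservativeField

variable {𝕜 E : Type*} [RCLike 𝕜] [NormedAddCommGroup E] [InnerProductSpace 𝕜 E]
  [NormedSpace ℝ E]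

theorem norm_eq_norm_of_hasDerivAt {s : Set ℝ} (hs : IsOpen s) (hs' : IsPreconnected s)
    {w v : ℝ → E} (hw : ∀ t ∈ s, HasDerivAt w (v t) t)
    (hv : ∀ t ∈ s, RCLike.re (inner 𝕜 (w t) (v t)) = 0) {a b : ℝ} (ha : a ∈ s) (hb : b ∈ s) :
    ‖w a‖ = ‖w b‖ := by
  have hderiv (t : ℝ) (ht : t ∈ s) : HasDerivAt (fun t => inner 𝕜 (w t) (w t)) 0 t := by
    have hsum : inner 𝕜 (w t) (v t) + inner 𝕜 (v t) (w t) = 0 := by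
      rw [← inner_conj_symm (v t) (w t), RCLike.add_conj, hv t ht, RCLike.ofReal_zero, mul_zero]
    simpa only [hsum] using (hw t ht).inner 𝕜 (hw t ht)
  have hconst := hs.is_const_of_deriv_eq_zero hs'
    (fun t ht => (hderiv t ht).differentiableAt.differentiableWithinAt)
    (fun t ht => (hderiv t ht).deriv) ha hb
  simp only [inner_self_eq_norm_sq_to_K] at hconst
  exact (pow_left_inj₀ (norm_nonneg _) (norm_nonneg _) two_ne_zero).1 (by exact_mod_cast hconst)

theorem zero_mem_Ioo_neg_self {T t : ℝ} (ht : t ∈ Ioo (-T) T) : (0 : ℝ) ∈ Ioo (-T) T := by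
  constructor <;> linarith [ht.1, ht.2]

variable (𝕜) in
/-- A time-dependent vector field that is Lipschitz on bounded sets, uniformly in time, and
orthogonal to the position for the real part of the inner product, so that its flow preserves the
norm. -/
structure IsConservativeField (V : ℝ → E → E) : Prop where
  continuous_apply : ∀ w, Continuous fun t => V t w
  exists_lipschitzOnWith : ∀ R : ℝ, 0 < R → ∃ K, ∀ t, LipschitzOnWith K (V t)
    (Metric.closedBall 0 R)
  re_inner_eq_zero : ∀ t w, RCLike.re (inner 𝕜 w (V t w)) = 0

namespace IsConservativeField

variable {V : ℝ → E → E} {T : ℝ}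

theorem norm_eq (hV : IsConservativeField 𝕜 V) {w : ℝ → E}
    (hw : ∀ t ∈ Ioo (-T) T, HasDerivAt w (V t (w t)) t) {t : ℝ} (ht : t ∈ Ioo (-T) T) :
    ‖w t‖ = ‖w 0‖ :=
  norm_eq_norm_of_hasDerivAt (𝕜 := 𝕜) isOpen_Ioo isPreconnected_Ioo hw
    (fun t _ => hV.re_inner_eq_zero t _) ht (zero_mem_Ioo_neg_self ht)

theorem eqOn (hV : IsConservativeField 𝕜 V) {v w : ℝ → E}
    (hv : ∀ t ∈ Ioo (-T) T, HasDerivAt v (V t (v t)) t)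
    (hw : ∀ t ∈ Ioo (-T) T, HasDerivAt w (V t (w t)) t) (h₀ : v 0 = w 0) :
    EqOn v w (Ioo (-T) T) := by
  intro t ht
  obtain ⟨K, hK⟩ := hV.exists_lipschitzOnWith (‖w 0‖ + 1) (by positivity)
  refine ODE_solution_unique_of_mem_Ioo (s := fun _ => Metric.closedBall 0 (‖w 0‖ + 1))
    (fun τ _ => hK τ) (zero_mem_Ioo_neg_self ht) (fun τ hτ => ⟨hv τ hτ, ?_⟩)
    (fun τ hτ => ⟨hw τ hτ, ?_⟩) h₀ ht
  · rw [mem_closedBall_zero_iff, hV.norm_eq hv hτ, h₀]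
    linarith
  · rw [mem_closedBall_zero_iff, hV.norm_eq hw hτ]
    linarith

section Existence

variable {R : ℝ}

theorem exists_lipschitzWith_truncated (hV : IsConservativeField 𝕜 V) (hR : 0 < R) :
    ∃ K, ∀ t, LipschitzWith K fun w => V t (radialRetraction R w) := by
  obtain ⟨K, hK⟩ := hV.exists_lipschitzOnWith R hR
  refine ⟨K * 2, fun t => lipschitzOnWith_univ.1 ?_⟩
  exact (hK t).comp (lipschitzWith_radialRetraction hR).lipschitzOnWith
    fun w _ => mem_closedBall_zero_iff.2 (norm_radialRetraction_le hR w)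

theorem exists_isPicardLindelof_truncated (hV : IsConservativeField 𝕜 V) (hT : 0 ≤ T)
    (hR : 0 < R) (w₀ : E) : ∃ a L K, IsPicardLindelof (fun t w => V t (radialRetraction R w))
      (tmin := -T) (tmax := T) ⟨0, neg_nonpos.2 hT, hT⟩ w₀ a 0 L K := by
  obtain ⟨K, hK⟩ := hV.exists_lipschitzWith_truncated hR
  obtain ⟨C, hC⟩ := (isCompact_Icc (a := -T) (b := T)).exists_bound_of_continuousOn
    (hV.continuous_apply 0).continuousOn
  have hC₀ : 0 ≤ C := (norm_nonneg _).trans (hC 0 ⟨neg_nonpos.2 hT, hT⟩)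
  obtain ⟨K', hK'⟩ := hV.exists_lipschitzOnWith R hR
  refine ⟨(C.toNNReal + K' * R.toNNReal) * T.toNNReal, C.toNNReal + K' * R.toNNReal, K,
    fun t _ => (hK t).lipschitzOnWith, fun w _ => (hV.continuous_apply _).continuousOn,
    fun t ht w _ => ?_, ?_⟩
  · have hle := norm_radialRetraction_le hR w
    have hsub := (hK' t).dist_le_mul _ (mem_closedBall_zero_iff.2 hle) 0
      (Metric.mem_closedBall_self hR.le)
    rw [dist_eq_norm, dist_zero_right] at hsub
    calc ‖V t (radialRetraction R w)‖
        ≤ ‖V t 0‖ + ‖V t (radialRetraction R w) - V t 0‖ := norm_le_insert' _ _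
      _ ≤ C + K' * R := add_le_add (hC t ht) (hsub.trans (by gcongr))
      _ = _ := by simp [hC₀, hR.le]
  · simp [hT]

theorem exists_forall_hasDerivAt [IsScalarTower ℝ 𝕜 E] [CompleteSpace E]
    (hV : IsConservativeField 𝕜 V) (hT : 0 ≤ T) (w₀ : E) :
    ∃ w : ℝ → E, w 0 = w₀ ∧ ∀ t ∈ Ioo (-T) T, HasDerivAt w (V t (w t)) t := by
  have hR : 0 < ‖w₀‖ + 1 := by positivity
  obtain ⟨a, L, K, hPL⟩ := hV.exists_isPicardLindelof_truncated hT hR w₀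
  obtain ⟨w, hw₀, hw⟩ := hPL.exists_eq_forall_mem_Icc_hasDerivWithinAt₀
  replace hw (t : ℝ) (ht : t ∈ Ioo (-T) T) :
      HasDerivAt w (V t (radialRetraction (‖w₀‖ + 1) (w t))) t :=
    (hw t (Ioo_subset_Icc_self ht)).hasDerivAt (Icc_mem_nhds ht.1 ht.2)
  have horth (t : ℝ) :
      RCLike.re (inner 𝕜 (w t) (V t (radialRetraction (‖w₀‖ + 1) (w t)))) = 0 := by
    have hpos : 0 < (‖w₀‖ + 1) / max (‖w₀‖ + 1) ‖w t‖ :=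
      div_pos hR (hR.trans_le (le_max_left _ _))
    have h := hV.re_inner_eq_zero t (radialRetraction (‖w₀‖ + 1) (w t))
    nth_rewrite 1 [radialRetraction] at h
    rw [inner_smul_left_eq_smul, RCLike.smul_re] at h
    exact (mul_eq_zero.1 h).resolve_left hpos.ne'
  have hnorm (t : ℝ) (ht : t ∈ Ioo (-T) T) : ‖w t‖ = ‖w₀‖ :=
    (norm_eq_norm_of_hasDerivAt (𝕜 := 𝕜) isOpen_Ioo isPreconnected_Ioo hw
      (fun t _ => horth t) ht (zero_mem_Ioo_neg_self ht)).trans (congrArg norm hw₀)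
  refine ⟨w, hw₀, fun t ht => ?_⟩
  simpa only [radialRetraction_eq_self hR ((hnorm t ht).trans_le (le_add_of_nonneg_right
    zero_le_one))] using hw t ht

end Existence

end IsConservativeField

end ConservativeField

theorem schrodingerSymbol_eq_exp_mul_I (t ζ : ℝ) :
    schrodingerSymbol t ζ = Complex.exp (((-(t * (2 * Real.pi * ζ) ^ 2) : ℝ) : ℂ) * Complex.I) := by
  rw [schrodingerSymbol]
  congr 1
  push_cast
  ring

@[simp]
theorem norm_schrodingerSymbol (t ζ : ℝ) : ‖schrodingerSymbol t ζ‖ = 1 := by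
  rw [schrodingerSymbol_eq_exp_mul_I, Complex.norm_exp_ofReal_mul_I]

theorem schrodingerSymbol_add (s t ζ : ℝ) :
    schrodingerSymbol (s + t) ζ = schrodingerSymbol s ζ * schrodingerSymbol t ζ := by
  simp only [schrodingerSymbol, ← Complex.exp_add]
  congr 1
  push_cast
  ring

@[simp]
theorem schrodingerSymbol_zero (ζ : ℝ) : schrodingerSymbol 0 ζ = 1 := by
  simp [schrodingerSymbol]

theorem continuous_schrodingerSymbol :
    Continuous fun p : ℝ × ℝ => schrodingerSymbol p.1 p.2 := by
  unfold schrodingerSymbol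
  fun_prop

theorem iteratedDeriv_cexp_ofReal_mul_I (n : ℕ) :
    iteratedDeriv n (fun x : ℝ => Complex.exp (x * Complex.I)) =
      fun x : ℝ => Complex.I ^ n * Complex.exp (x * Complex.I) := by
  induction n with
  | zero => simp
  | succ n ih =>
    rw [iteratedDeriv_succ, ih]
    funext x
    have hlin : HasDerivAt (fun x : ℝ => (x : ℂ) * Complex.I) Complex.I x := by
      simpa using (Complex.ofRealCLM.hasDerivAt (x := x)).mul_const Complex.I
    rw [(hlin.cexp.const_mul (Complex.I ^ n)).deriv]
    ring

theorem hasTemperateGrowth_cexp_ofReal_mul_I :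
    (fun x : ℝ => Complex.exp (x * Complex.I)).HasTemperateGrowth := by
  refine ⟨(Complex.ofRealCLM.contDiff.mul contDiff_const).cexp, fun n => ⟨0, 1, fun x => ?_⟩⟩
  rw [norm_iteratedFDeriv_eq_norm_iteratedDeriv, iteratedDeriv_cexp_ofReal_mul_I]
  simp [Complex.norm_exp_ofReal_mul_I]

theorem hasTemperateGrowth_schrodingerSymbol (t : ℝ) :
    (schrodingerSymbol t).HasTemperateGrowth := by
  have hphase : (fun ζ : ℝ => -(t * (2 * Real.pi) ^ 2) * ‖ζ‖ ^ 2).HasTemperateGrowth :=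
    (Function.HasTemperateGrowth.const _).mul (Function.hasTemperateGrowth_norm_sq ℝ)
  convert hasTemperateGrowth_cexp_ofReal_mul_I.comp hphase using 1
  funext ζ
  rw [schrodingerSymbol_eq_exp_mul_I, Function.comp_apply, Real.norm_eq_abs, sq_abs]
  ring_nf

theorem fourier_schrodinger (t : ℝ) (f : L2) :
    (𝓕 (schrodinger t f) : L2) =ᵐ[volume] fun ζ => schrodingerSymbol t ζ * (𝓕 f : L2) ζ := by
  rw [schrodinger, FourierTransform.fourier_fourierInv_eq]
  exact MemLp.coeFn_toLp _

theorem eq_of_fourier_ae_eq {f g : L2} (h : (𝓕 f : L2) =ᵐ[volume] (𝓕 g : L2)) : f = g :=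
  (Lp.fourierTransformₗᵢ ℝ ℂ).injective (Lp.ext h)

theorem schrodinger_add (t : ℝ) (f g : L2) :
    schrodinger t (f + g) = schrodinger t f + schrodinger t g := by
  apply eq_of_fourier_ae_eq
  have hsum := fourier_schrodinger t (f + g)
  rw [FourierTransform.fourier_add] at hsum ⊢
  filter_upwards [hsum, fourier_schrodinger t f, fourier_schrodinger t g,
    Lp.coeFn_add (𝓕 f : L2) (𝓕 g), Lp.coeFn_add (𝓕 (schrodinger t f) : L2) (𝓕 (schrodinger t g))]
    with ζ hsum hf hg hadd hadd'
  rw [hsum, hadd', hadd, Pi.add_apply, Pi.add_apply, hf, hg, mul_add]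

theorem schrodinger_smul (t : ℝ) (c : ℂ) (f : L2) :
    schrodinger t (c • f) = c • schrodinger t f := by
  apply eq_of_fourier_ae_eq
  have hsmul := fourier_schrodinger t (c • f)
  rw [FourierTransform.fourier_smul] at hsmul ⊢
  filter_upwards [hsmul, fourier_schrodinger t f, Lp.coeFn_smul c (𝓕 f : L2),
    Lp.coeFn_smul c (𝓕 (schrodinger t f) : L2)] with ζ hsmul hf hc hc'
  rw [hsmul, hc', hc, Pi.smul_apply, Pi.smul_apply, hf, mul_smul_comm]

theorem norm_schrodinger (t : ℝ) (f : L2) : ‖schrodinger t f‖ = ‖f‖ := by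
  rw [← Lp.norm_fourier_eq (schrodinger t f), ← Lp.norm_fourier_eq f]
  refine le_antisymm (Lp.norm_le_norm_of_ae_le ?_) (Lp.norm_le_norm_of_ae_le ?_) <;>
  · filter_upwards [fourier_schrodinger t f] with ζ hζ
    rw [hζ, norm_mul, norm_schrodingerSymbol, one_mul]

theorem schrodinger_schrodinger (s t : ℝ) (f : L2) :
    schrodinger s (schrodinger t f) = schrodinger (s + t) f := by
  apply eq_of_fourier_ae_eq
  filter_upwards [fourier_schrodinger s (schrodinger t f), fourier_schrodinger t f,
    fourier_schrodinger (s + t) f] with ζ hst ht hadd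
  rw [hst, ht, hadd, schrodingerSymbol_add, mul_assoc]

@[simp]
theorem schrodinger_zero_left (f : L2) : schrodinger 0 f = f := by
  apply eq_of_fourier_ae_eq
  filter_upwards [fourier_schrodinger 0 f] with ζ hζ
  rw [hζ, schrodingerSymbol_zero, one_mul]

/-- The free propagator `e^{itΔ}` on `L²` as a linear isometry. -/
def propagator (t : ℝ) : L2 →ₗᵢ[ℂ] L2 where
  toFun := schrodinger t
  map_add' := schrodinger_add t
  map_smul' := schrodinger_smul t
  norm_map' := norm_schrodinger t

@[simp]
theorem schrodinger_zero_right (t : ℝ) : schrodinger t 0 = 0 := (propagator t).map_zero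

theorem schrodinger_sub (t : ℝ) (f g : L2) :
    schrodinger t (f - g) = schrodinger t f - schrodinger t g := (propagator t).map_sub f g

theorem inner_schrodinger (t : ℝ) (f g : L2) :
    inner ℂ (schrodinger t f) (schrodinger t g) = inner ℂ f g :=
  (propagator t).inner_map_map f g

theorem inner_schrodinger_right (t : ℝ) (f g : L2) :
    inner ℂ f (schrodinger t g) = inner ℂ (schrodinger (-t) f) g := by
  rw [← inner_schrodinger (-t) f, schrodinger_schrodinger, neg_add_cancel, schrodinger_zero_left]

theorem schrodinger_intervalIntegral (t : ℝ) {f : ℝ → L2} {a b : ℝ}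
    (hf : IntervalIntegrable f volume a b) :
    schrodinger t (∫ τ in a..b, f τ) = ∫ τ in a..b, schrodinger t (f τ) :=
  ((propagator t).toContinuousLinearMap.intervalIntegral_comp_comm hf).symm

theorem continuous_schrodinger_left (f : L2) : Continuous fun t => schrodinger t f := by
  suffices Continuous fun t => (𝓕 (schrodinger t f) : L2) from
    (Lp.fourierTransformₗᵢ ℝ ℂ).comp_continuous_iff.1 this
  refine continuous_iff_continuousAt.2 fun t₀ => ?_
  refine tendsto_Lp_of_dominated ENNReal.ofNat_ne_top (fun t => fourier_schrodinger t f)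
    (Lp.memLp (𝓕 f : L2)).norm (fun t => .of_forall fun ζ => ?_) ?_
  · rw [norm_mul, norm_schrodingerSymbol, one_mul]
  · filter_upwards [fourier_schrodinger t₀ f] with ζ hζ
    rw [hζ]
    have hcont : Continuous fun t => schrodingerSymbol t ζ * (𝓕 f : L2) ζ :=
      (continuous_schrodingerSymbol.comp (.prodMk_left ζ)).mul_const _
    exact hcont.tendsto t₀

theorem continuous_schrodinger : Continuous fun p : ℝ × L2 => schrodinger p.1 p.2 :=
  continuous_prod_of_continuous_lipschitzWith' _ 1
    (fun t => (propagator t).isometry.lipschitz) continuous_schrodinger_left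

theorem continuousOn_schrodinger {X : Type*} [TopologicalSpace X] {a : X → ℝ} {f : X → L2}
    {s : Set X} (ha : ContinuousOn a s) (hf : ContinuousOn f s) :
    ContinuousOn (fun x => schrodinger (a x) (f x)) s :=
  (continuous_schrodinger.comp_continuousOn (ha.prodMk hf) :)

/-- The free propagator `e^{itΔ}` on Schwartz functions. -/
def freeEvolution (t : ℝ) (φ : 𝓢(ℝ, ℂ)) : 𝓢(ℝ, ℂ) :=
  SchwartzMap.fourierMultiplierCLM ℂ (schrodingerSymbol t) φ

theorem fourier_freeEvolution (t : ℝ) (φ : 𝓢(ℝ, ℂ)) (ζ : ℝ) :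
    (𝓕 (freeEvolution t φ) : 𝓢(ℝ, ℂ)) ζ = schrodingerSymbol t ζ * (𝓕 φ : 𝓢(ℝ, ℂ)) ζ := by
  rw [freeEvolution, SchwartzMap.fourierMultiplierCLM_apply,
    FourierTransform.fourier_fourierInv_eq,
    SchwartzMap.smulLeftCLM_apply_apply (hasTemperateGrowth_schrodingerSymbol t), smul_eq_mul]

theorem schrodinger_toLp (t : ℝ) (φ : 𝓢(ℝ, ℂ)) :
    schrodinger t (φ.toLp 2) = (freeEvolution t φ).toLp 2 := by
  apply eq_of_fourier_ae_eq
  have hfourier := fourier_schrodinger t (φ.toLp 2)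
  rw [SchwartzMap.toLp_fourier_eq] at hfourier ⊢
  filter_upwards [hfourier, SchwartzMap.coeFn_toLp (𝓕 φ) 2 volume,
    SchwartzMap.coeFn_toLp (𝓕 (freeEvolution t φ)) 2 volume] with ζ hfourier hφ hfree
  rw [hfourier, hφ, hfree, fourier_freeEvolution]

/-- The cubic nonlinearity `z ↦ |z|² z` on `ℂ`. -/
def cubeFun (z : ℂ) : ℂ := ((‖z‖ ^ 2 : ℝ) : ℂ) * z

theorem norm_cubeFun (z : ℂ) : ‖cubeFun z‖ = ‖z‖ ^ 3 := by
  rw [cubeFun, norm_mul, Complex.norm_real, Real.norm_of_nonneg (by positivity), ← pow_succ]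

theorem enorm_cubeFun (z : ℂ) : ‖cubeFun z‖ₑ = ‖z‖ₑ ^ 3 := by
  rw [← ofReal_norm, norm_cubeFun, ENNReal.ofReal_pow (norm_nonneg z), ofReal_norm]

theorem continuous_cubeFun : Continuous cubeFun := by
  unfold cubeFun
  fun_prop

theorem norm_cubeFun_sub_le (z w : ℂ) :
    ‖cubeFun z - cubeFun w‖ ≤ 3 / 2 * (‖z‖ ^ 2 + ‖w‖ ^ 2) * ‖z - w‖ := by
  have hsplit : cubeFun z - cubeFun w =
      ((‖z‖ ^ 2 : ℝ) : ℂ) * (z - w) + (((‖z‖ - ‖w‖) * (‖z‖ + ‖w‖) : ℝ) : ℂ) * w := by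
    simp only [cubeFun]
    push_cast
    ring
  calc ‖cubeFun z - cubeFun w‖
      ≤ ‖z‖ ^ 2 * ‖z - w‖ + |‖z‖ - ‖w‖| * (‖z‖ + ‖w‖) * ‖w‖ := by
        rw [hsplit]
        refine (norm_add_le _ _).trans_eq ?_
        rw [norm_mul, norm_mul, Complex.norm_real, Complex.norm_real, norm_mul, norm_pow,
          norm_norm, Real.norm_eq_abs, Real.norm_of_nonneg (by positivity : 0 ≤ ‖z‖ + ‖w‖)]
    _ ≤ ‖z‖ ^ 2 * ‖z - w‖ + ‖z - w‖ * (‖z‖ + ‖w‖) * ‖w‖ := by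
        gcongr
        exact abs_norm_sub_norm_le z w
    _ = (‖z‖ ^ 2 + ‖z‖ * ‖w‖ + ‖w‖ ^ 2) * ‖z - w‖ := by ring
    _ ≤ _ := by
        gcongr
        nlinarith [sq_nonneg (‖z‖ - ‖w‖)]

theorem pow_four_mul_sq_le {x y : ℝ} (hx : 0 ≤ x) (hy : 0 ≤ y) :
    x ^ 4 * y ^ 2 ≤ x ^ 6 + y ^ 6 := by
  rcases le_total x y with h | h
  · calc x ^ 4 * y ^ 2 ≤ y ^ 4 * y ^ 2 := by gcongr
      _ = y ^ 6 := by ring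
      _ ≤ x ^ 6 + y ^ 6 := le_add_of_nonneg_left (by positivity)
  · calc x ^ 4 * y ^ 2 ≤ x ^ 4 * x ^ 2 := by gcongr
      _ = x ^ 6 := by ring
      _ ≤ x ^ 6 + y ^ 6 := le_add_of_nonneg_right (by positivity)

theorem sq_add_sq_sq_mul_sq_le {x y z : ℝ} (hx : 0 ≤ x) (hy : 0 ≤ y) (hz : 0 ≤ z) :
    (x ^ 2 + y ^ 2) ^ 2 * z ^ 2 ≤ 4 * (x ^ 6 + y ^ 6 + z ^ 6) :=
  calc (x ^ 2 + y ^ 2) ^ 2 * z ^ 2 ≤ 2 * (x ^ 4 * z ^ 2 + y ^ 4 * z ^ 2) := by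
        nlinarith [mul_nonneg (sq_nonneg (x ^ 2 - y ^ 2)) (sq_nonneg z)]
    _ ≤ 2 * ((x ^ 6 + z ^ 6) + (y ^ 6 + z ^ 6)) := by
        gcongr <;> exact pow_four_mul_sq_le ‹_› ‹_›
    _ ≤ 4 * (x ^ 6 + y ^ 6 + z ^ 6) := by
        linarith [pow_nonneg hx 6, pow_nonneg hy 6]

theorem norm_cubeFun_sub_sq_le (z w : ℂ) {R d : ℝ} (hR : 0 < R) (hd : 0 < d) :
    ‖cubeFun z - cubeFun w‖ ^ 2 ≤
      9 * R ^ 4 * d ^ 2 * (‖z‖ ^ 6 * R⁻¹ ^ 6 + ‖w‖ ^ 6 * R⁻¹ ^ 6 + ‖z - w‖ ^ 6 * d⁻¹ ^ 6) :=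
  calc ‖cubeFun z - cubeFun w‖ ^ 2
      ≤ (3 / 2 * (‖z‖ ^ 2 + ‖w‖ ^ 2) * ‖z - w‖) ^ 2 := by
        gcongr
        exact norm_cubeFun_sub_le z w
    _ = 9 / 4 * R ^ 4 * d ^ 2 *
          (((‖z‖ * R⁻¹) ^ 2 + (‖w‖ * R⁻¹) ^ 2) ^ 2 * (‖z - w‖ * d⁻¹) ^ 2) := by
        field_simp
        ring
    _ ≤ 9 / 4 * R ^ 4 * d ^ 2 *
          (4 * ((‖z‖ * R⁻¹) ^ 6 + (‖w‖ * R⁻¹) ^ 6 + (‖z - w‖ * d⁻¹) ^ 6)) := by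
        refine mul_le_mul_of_nonneg_left ?_ (by positivity)
        exact sq_add_sq_sq_mul_sq_le (by positivity) (by positivity) (by positivity)
    _ = _ := by ring

/-- The integral `∫ |f|⁶`, which is finite exactly when `f` has a cube in `L²`. -/
def sixthPower (f : L2) : ℝ≥0∞ := ∫⁻ x, ‖f x‖ₑ ^ 6

theorem sixthPower_congr_ae {f : L2} {g : ℝ → ℂ} (h : f =ᵐ[volume] g) :
    sixthPower f = ∫⁻ x, ‖g x‖ₑ ^ 6 :=
  lintegral_congr_ae (h.mono fun x hx => by simp only [hx])

theorem measurable_sixthPower_schrodinger (f : L2) :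
    Measurable fun σ => sixthPower (schrodinger σ f) :=
  ((lowerSemicontinuous_lintegral_enorm_pow 6).comp (continuous_schrodinger_left f)).measurable

theorem hasCube_iff_sixthPower_lt_top (f : L2) : HasCube f ↔ sixthPower f < ∞ := by
  have hmeas : AEStronglyMeasurable (fun x => cubeFun (f x)) volume :=
    continuous_cubeFun.comp_aestronglyMeasurable (Lp.aestronglyMeasurable f)
  calc HasCube f ↔ eLpNorm (fun x => cubeFun (f x)) 2 volume < ∞ := and_iff_right hmeas
    _ ↔ ∫⁻ x, (‖f x‖ₑ ^ 3) ^ 2 < ∞ := by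
      rw [eLpNorm_lt_top_iff_lintegral_rpow_enorm_lt_top two_ne_zero ENNReal.ofNat_ne_top]
      simp only [ENNReal.toReal_ofNat, ENNReal.rpow_ofNat, enorm_cubeFun]
    _ ↔ sixthPower f < ∞ := by simp only [sixthPower, ← pow_mul, Nat.reduceMul]

theorem coeFn_cube {f : L2} (h : HasCube f) : cube f =ᵐ[volume] fun x => cubeFun (f x) := by
  rw [cube, dif_pos h]
  exact MemLp.coeFn_toLp _

-- With `R ≥ ‖f‖, ‖g‖` and `d = ‖f - g‖`, all three terms are scale invariant.
theorem enorm_cube_sub_cube_sq_le {f g : L2} (hf : HasCube f) (hg : HasCube g) {R d : ℝ}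
    (hR : 0 < R) (hd : 0 < d) :
    ‖cube f - cube g‖ₑ ^ 2 ≤ ENNReal.ofReal (9 * R ^ 4 * d ^ 2) *
      (sixthPower f * ENNReal.ofReal (R⁻¹ ^ 6) + sixthPower g * ENNReal.ofReal (R⁻¹ ^ 6) +
        sixthPower (f - g) * ENNReal.ofReal (d⁻¹ ^ 6)) := by
  have hmeas (k : L2) : AEMeasurable (fun x => ‖k x‖ₑ ^ 6) volume :=
    (Lp.aestronglyMeasurable k).enorm.pow_const 6
  rw [enorm_sq_eq_lintegral]
  unfold sixthPower
  rw [← lintegral_mul_const'' _ (hmeas f), ← lintegral_mul_const'' _ (hmeas g),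
    ← lintegral_mul_const'' _ (hmeas (f - g)), ← lintegral_add_left' ((hmeas f).mul_const _),
    ← lintegral_add_right' _ ((hmeas (f - g)).mul_const _),
    ← lintegral_const_mul' _ _ ENNReal.ofReal_ne_top]
  refine lintegral_mono_ae ?_
  filter_upwards [coeFn_cube hf, coeFn_cube hg, Lp.coeFn_sub (cube f) (cube g),
    Lp.coeFn_sub f g] with x hf hg hcube hsub
  rw [hcube, hsub, Pi.sub_apply, Pi.sub_apply, hf, hg]
  simp only [← ofReal_norm]
  rw [← ENNReal.ofReal_pow (by positivity), ← ENNReal.ofReal_pow (by positivity),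
    ← ENNReal.ofReal_pow (by positivity), ← ENNReal.ofReal_pow (by positivity),
    ← ENNReal.ofReal_mul (by positivity), ← ENNReal.ofReal_mul (by positivity),
    ← ENNReal.ofReal_mul (by positivity), ← ENNReal.ofReal_add (by positivity) (by positivity),
    ← ENNReal.ofReal_add (by positivity) (by positivity), ← ENNReal.ofReal_mul (by positivity)]
  exact ENNReal.ofReal_le_ofReal (norm_cubeFun_sub_sq_le _ _ hR hd)

/-- The cubic nonlinearity precomposed with the retraction onto a disc of radius `n + 1`, a
Lipschitz approximation of `cubeFun`. -/
def truncCubeFun (n : ℕ) (z : ℂ) : ℂ := cubeFun (radialRetraction (n + 1) z)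

theorem norm_truncCubeFun_le (n : ℕ) (z : ℂ) : ‖truncCubeFun n z‖ ≤ ‖cubeFun z‖ := by
  rw [truncCubeFun, norm_cubeFun, norm_cubeFun]
  gcongr
  exact norm_radialRetraction_le_norm n.cast_add_one_pos z

theorem truncCubeFun_zero (n : ℕ) : truncCubeFun n 0 = 0 := by
  simp [truncCubeFun, cubeFun, radialRetraction]

theorem norm_cubeFun_sub_le_of_norm_le {z w : ℂ} {R : ℝ} (hz : ‖z‖ ≤ R) (hw : ‖w‖ ≤ R) :
    ‖cubeFun z - cubeFun w‖ ≤ 3 * R ^ 2 * ‖z - w‖ :=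
  calc ‖cubeFun z - cubeFun w‖ ≤ 3 / 2 * (‖z‖ ^ 2 + ‖w‖ ^ 2) * ‖z - w‖ := norm_cubeFun_sub_le z w
    _ ≤ 3 / 2 * (R ^ 2 + R ^ 2) * ‖z - w‖ := by gcongr
    _ = 3 * R ^ 2 * ‖z - w‖ := by ring

theorem lipschitzWith_truncCubeFun (n : ℕ) :
    LipschitzWith (3 * (n + 1 : NNReal) ^ 2 * 2) (truncCubeFun n) := by
  have hn : (0 : ℝ) < n + 1 := n.cast_add_one_pos
  refine LipschitzWith.of_dist_le_mul fun z w => ?_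
  rw [dist_eq_norm, dist_eq_norm, truncCubeFun, truncCubeFun]
  calc _ ≤ 3 * (n + 1 : ℝ) ^ 2 * ‖radialRetraction (n + 1) z - radialRetraction (n + 1) w‖ :=
        norm_cubeFun_sub_le_of_norm_le (norm_radialRetraction_le hn z)
          (norm_radialRetraction_le hn w)
    _ ≤ 3 * (n + 1 : ℝ) ^ 2 * (2 * ‖z - w‖) := by
        gcongr
        exact norm_radialRetraction_sub_le hn z w
    _ = _ := by
        push_cast
        ring

theorem tendsto_truncCubeFun (z : ℂ) :
    Tendsto (fun n : ℕ => truncCubeFun n z) atTop (𝓝 (cubeFun z)) := by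
  refine tendsto_const_nhds.congr' ?_
  filter_upwards [eventually_ge_atTop ⌈‖z‖⌉₊] with n hn
  have hle : ‖z‖ ≤ n + 1 := (Nat.le_ceil _).trans (by exact_mod_cast hn.trans n.le_succ)
  rw [truncCubeFun, radialRetraction_eq_self n.cast_add_one_pos hle]

/-- The map `f ↦ truncCubeFun n ∘ f` on `L²`, a continuous approximation of `cube`. -/
def truncCube (n : ℕ) (f : L2) : L2 :=
  (lipschitzWith_truncCubeFun n).compLp (truncCubeFun_zero n) f

theorem coeFn_truncCube (n : ℕ) (f : L2) :
    truncCube n f =ᵐ[volume] fun x => truncCubeFun n (f x) :=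
  LipschitzWith.coeFn_compLp _ _ _

theorem continuous_truncCube (n : ℕ) : Continuous (truncCube n) :=
  (lipschitzWith_truncCubeFun n).continuous_compLp (truncCubeFun_zero n)

theorem tendsto_truncCube {f : L2} (hf : HasCube f) :
    Tendsto (fun n => truncCube n f) atTop (𝓝 (cube f)) := by
  refine tendsto_Lp_of_dominated ENNReal.ofNat_ne_top (fun n => coeFn_truncCube n f)
    (g := fun x => ‖cubeFun (f x)‖) (MemLp.norm hf)
    (fun n => .of_forall fun x => norm_truncCubeFun_le n _) ?_
  filter_upwards [coeFn_cube hf] with x hx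
  rw [hx]
  exact tendsto_truncCubeFun _

/-- The Gaussian `e^{-πx²}`, normalised so that it is its own Fourier transform; it serves as a
smooth time cutoff. -/
def gaussian (x : ℝ) : ℝ := Real.exp (-Real.pi * x ^ 2)

theorem gaussian_nonneg (x : ℝ) : 0 ≤ gaussian x := Real.exp_nonneg _

theorem gaussian_neg (x : ℝ) : gaussian (-x) = gaussian x := by
  rw [gaussian, gaussian, neg_sq]

theorem continuous_gaussian : Continuous gaussian := by
  unfold gaussian
  fun_prop

theorem integrable_gaussian : Integrable gaussian := integrable_exp_neg_mul_sq Real.pi_pos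

theorem integral_gaussian_eq_one : ∫ x, gaussian x = 1 := by
  simp only [gaussian, integral_gaussian, div_self Real.pi_ne_zero, Real.sqrt_one]

theorem integral_gaussian_mul_fourierChar (c : ℝ) :
    ∫ σ : ℝ, (gaussian σ : ℂ) * (𝐞 (-(σ * c)) : ℂ) = gaussian c := by
  have hfourier := congrFun (fourier_gaussian_pi (b := 1) (by simp)) c
  rw [Real.fourier_real_eq] at hfourier
  simpa [gaussian, Circle.smul_def, mul_comm] using hfourier

theorem enorm_ofReal_gaussian (x : ℝ) : ‖(gaussian x : ℂ)‖ₑ = ENNReal.ofReal (gaussian x) := by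
  rw [← ofReal_norm, Complex.norm_real, Real.norm_of_nonneg (gaussian_nonneg x)]

section OscillatoryIntegral

variable {P : Type*} [MeasurableSpace P] {ν : Measure P} {Q : P → ℝ} {F : P → ℂ}

/-- The oscillatory integral `∫ F(p) e^{-2πiσQ(p)} dν(p)` with amplitude `F` and phase `Q`, as a
function of the frequency parameter `σ`. -/
def oscillatoryIntegral (ν : Measure P) (Q : P → ℝ) (F : P → ℂ) (σ : ℝ) : ℂ :=
  ∫ p, F p * (𝐞 (-(σ * Q p)) : ℂ) ∂ν

theorem integrable_gaussian_mul_fourierChar (hQ : Measurable Q) (hF : Integrable F ν) :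
    Integrable (fun y : ℝ × P × P => (gaussian y.1 : ℂ) * (F y.2.1 * (starRingEnd ℂ) (F y.2.2) *
      (𝐞 (-(y.1 * (Q y.2.1 - Q y.2.2))) : ℂ))) (volume.prod (ν.prod ν)) := by
  have hFF : Integrable (fun z : P × P => F z.1 * (starRingEnd ℂ) (F z.2)) (ν.prod ν) :=
    hF.mul_prod (Complex.conjCLE.toContinuousLinearMap.integrable_comp hF)
  have hamp := integrable_gaussian.ofReal (𝕜 := ℂ).mul_prod hFF
  have hphase : Measurable fun y : ℝ × P × P => (𝐞 (-(y.1 * (Q y.2.1 - Q y.2.2))) : ℂ) :=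
    (continuous_subtype_val.comp Real.continuous_fourierChar).measurable.comp (by fun_prop)
  refine (hamp.mul_bdd (c := 1) hphase.aestronglyMeasurable (.of_forall fun y => ?_)).congr
    (.of_forall fun y => mul_assoc _ _ _)
  rw [Circle.norm_coe]

variable [SFinite ν]

theorem lintegral_mul_mul_le_of_schur {a : P → ℝ≥0∞} (ha : AEMeasurable a ν) {G : P × P → ℝ≥0∞}
    (hG : Measurable G) {K : ℝ≥0∞} (hfst : ∀ p, ∫⁻ q, G (p, q) ∂ν ≤ K)
    (hsnd : ∀ q, ∫⁻ p, G (p, q) ∂ν ≤ K) :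
    ∫⁻ z, a z.1 * a z.2 * G z ∂(ν.prod ν) ≤ 2 * K * ∫⁻ p, a p ^ 2 ∂ν := by
  have ha2 : AEMeasurable (fun p => a p ^ 2) ν := ha.pow_const 2
  have hmeas₁ : AEMeasurable (fun z : P × P => a z.1 ^ 2 * G z) (ν.prod ν) :=
    ha2.comp_fst.mul hG.aemeasurable
  have hmeas₂ : AEMeasurable (fun z : P × P => a z.2 ^ 2 * G z) (ν.prod ν) :=
    ha2.comp_snd.mul hG.aemeasurable
  have mul_le_sq_add_sq (x y : ℝ≥0∞) : x * y ≤ x ^ 2 + y ^ 2 := by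
    rcases le_total x y with h | h
    · exact (mul_le_mul_left h y).trans (by rw [← sq]; exact le_add_self)
    · exact (mul_le_mul_right h x).trans (by rw [← sq]; exact le_self_add)
  calc ∫⁻ z, a z.1 * a z.2 * G z ∂(ν.prod ν)
      ≤ ∫⁻ z, (a z.1 ^ 2 * G z + a z.2 ^ 2 * G z) ∂(ν.prod ν) := by
        refine lintegral_mono fun z => ?_
        rw [← add_mul]
        gcongr
        exact mul_le_sq_add_sq _ _
    _ = (∫⁻ p, a p ^ 2 * ∫⁻ q, G (p, q) ∂ν ∂ν) + ∫⁻ q, a q ^ 2 * ∫⁻ p, G (p, q) ∂ν ∂ν := by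
        rw [lintegral_add_left' hmeas₁, lintegral_prod _ hmeas₁, lintegral_prod_symm _ hmeas₂]
        congr 1 <;> refine lintegral_congr fun p => ?_
        · exact lintegral_const_mul (a p ^ 2) (f := fun q => G (p, q)) (by fun_prop)
        · exact lintegral_const_mul (a p ^ 2) (f := fun q => G (q, p)) (by fun_prop)
    _ ≤ (∫⁻ p, a p ^ 2 * K ∂ν) + ∫⁻ q, a q ^ 2 * K ∂ν := by
        gcongr with p q
        · exact hfst p
        · exact hsnd q
    _ = 2 * K * ∫⁻ p, a p ^ 2 ∂ν := by
        rw [lintegral_mul_const'' _ ha2]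
        ring

theorem integral_mul_conj_prod (f : P → ℂ) :
    ∫ z, f z.1 * (starRingEnd ℂ) (f z.2) ∂(ν.prod ν) = ((‖∫ p, f p ∂ν‖ ^ 2 : ℝ) : ℂ) := by
  rw [integral_prod_mul f fun p => (starRingEnd ℂ) (f p), integral_conj, Complex.mul_conj,
    Complex.normSq_eq_norm_sq]

theorem norm_oscillatoryIntegral_sq (σ : ℝ) :
    ((‖oscillatoryIntegral ν Q F σ‖ ^ 2 : ℝ) : ℂ) =
      ∫ z, F z.1 * (starRingEnd ℂ) (F z.2) * (𝐞 (-(σ * (Q z.1 - Q z.2))) : ℂ) ∂(ν.prod ν) := by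
  rw [oscillatoryIntegral, ← integral_mul_conj_prod]
  congr 1
  funext z
  have hphase : (𝐞 (-(σ * (Q z.1 - Q z.2))) : ℂ) =
      (𝐞 (-(σ * Q z.1)) : ℂ) * (starRingEnd ℂ) (𝐞 (-(σ * Q z.2)) : ℂ) := by
    rw [← Circle.coe_inv_eq_conj, ← AddChar.map_neg_eq_inv, ← Circle.coe_mul,
      ← AddChar.map_add_eq_mul]
    ring_nf
  rw [hphase, map_mul]
  ring

/-- The `TT*` identity: averaging over `σ` replaces the phases by a kernel concentrated on
`Q p = Q q`. -/
theorem integral_gaussian_mul_norm_oscillatoryIntegral_sq (hQ : Measurable Q)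
    (hF : Integrable F ν) :
    ((∫ σ, gaussian σ * ‖oscillatoryIntegral ν Q F σ‖ ^ 2 : ℝ) : ℂ) =
      ∫ z, F z.1 * (starRingEnd ℂ) (F z.2) * (gaussian (Q z.1 - Q z.2) : ℂ) ∂(ν.prod ν) := by
  rw [← integral_complex_ofReal]
  simp_rw [Complex.ofReal_mul, norm_oscillatoryIntegral_sq, ← integral_const_mul]
  rw [integral_integral_swap (integrable_gaussian_mul_fourierChar hQ hF)]
  congr 1
  funext z
  rw [← integral_gaussian_mul_fourierChar, ← integral_const_mul]
  congr 1
  funext σ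
  ring

theorem integrable_gaussian_mul_norm_oscillatoryIntegral_sq (hQ : Measurable Q)
    (hF : Integrable F ν) :
    Integrable fun σ => gaussian σ * ‖oscillatoryIntegral ν Q F σ‖ ^ 2 := by
  have hint := (integrable_gaussian_mul_fourierChar hQ hF).integral_prod_left
  simp_rw [integral_const_mul, ← norm_oscillatoryIntegral_sq, ← Complex.ofReal_mul] at hint
  exact hint.re

theorem lintegral_gaussian_mul_enorm_oscillatoryIntegral_sq_le (hQ : Measurable Q)
    (hF : Integrable F ν) {K : ℝ≥0∞}
    (hK : ∀ c : ℝ, ∫⁻ p, ENNReal.ofReal (gaussian (c - Q p)) ∂ν ≤ K) :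
    ∫⁻ σ : ℝ, ENNReal.ofReal (gaussian σ) * ‖oscillatoryIntegral ν Q F σ‖ₑ ^ 2 ≤
      2 * K * ∫⁻ p, ‖F p‖ₑ ^ 2 ∂ν := by
  have hnonneg (σ : ℝ) : 0 ≤ gaussian σ * ‖oscillatoryIntegral ν Q F σ‖ ^ 2 :=
    mul_nonneg (gaussian_nonneg σ) (sq_nonneg _)
  have hkernel : Measurable fun z : P × P => ENNReal.ofReal (gaussian (Q z.1 - Q z.2)) :=
    (continuous_gaussian.measurable.comp (by fun_prop)).ennreal_ofReal
  calc ∫⁻ σ : ℝ, ENNReal.ofReal (gaussian σ) * ‖oscillatoryIntegral ν Q F σ‖ₑ ^ 2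
      = ENNReal.ofReal (∫ σ, gaussian σ * ‖oscillatoryIntegral ν Q F σ‖ ^ 2) := by
        rw [ofReal_integral_eq_lintegral_ofReal
          (integrable_gaussian_mul_norm_oscillatoryIntegral_sq hQ hF) (.of_forall hnonneg)]
        refine lintegral_congr fun σ => ?_
        rw [ENNReal.ofReal_mul (gaussian_nonneg σ), ENNReal.ofReal_pow (norm_nonneg _), ofReal_norm]
    _ = ‖∫ z, F z.1 * (starRingEnd ℂ) (F z.2) * (gaussian (Q z.1 - Q z.2) : ℂ) ∂(ν.prod ν)‖ₑ := by
        rw [← integral_gaussian_mul_norm_oscillatoryIntegral_sq hQ hF, ← ofReal_norm,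
          Complex.norm_real, Real.norm_of_nonneg (integral_nonneg hnonneg)]
    _ ≤ ∫⁻ z, ‖F z.1‖ₑ * ‖F z.2‖ₑ * ENNReal.ofReal (gaussian (Q z.1 - Q z.2)) ∂(ν.prod ν) := by
        refine (enorm_integral_le_lintegral_enorm _).trans_eq (lintegral_congr fun z => ?_)
        rw [enorm_mul, enorm_mul, RCLike.enorm_conj, enorm_ofReal_gaussian]
    _ ≤ 2 * K * ∫⁻ p, ‖F p‖ₑ ^ 2 ∂ν := by
        refine lintegral_mul_mul_le_of_schur hF.aestronglyMeasurable.enorm hkernel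
          (fun p => hK (Q p)) fun q => ?_
        simp_rw [← gaussian_neg (Q _ - Q q), neg_sub]
        exact hK (Q q)

end OscillatoryIntegral

theorem lintegral_gaussian_sub (c : ℝ) : ∫⁻ v : ℝ, ENNReal.ofReal (gaussian (c - v)) = 1 := by
  rw [lintegral_sub_left_eq_self (fun v => ENNReal.ofReal (gaussian v)),
    ← ofReal_integral_eq_lintegral_ofReal integrable_gaussian (.of_forall gaussian_nonneg),
    integral_gaussian_eq_one, ENNReal.ofReal_one]

theorem lintegral_radial_gaussian_le (c : ℝ) {m : ℝ} (hm : 1 ≤ m) :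
    ∫⁻ r in Ioi (0 : ℝ), ENNReal.ofReal r * ENNReal.ofReal (gaussian (c - m * r ^ 2)) ≤ 1 := by
  have hderiv (r : ℝ) : HasDerivAt (fun r => m * r ^ 2) (m * (2 * r)) r := by
    simpa using (hasDerivAt_pow 2 r).const_mul m
  have hinj : InjOn (fun r : ℝ => m * r ^ 2) (Ioi 0) := fun x hx y hy hxy =>
    (pow_left_inj₀ (le_of_lt hx) (le_of_lt hy) two_ne_zero).1
      (mul_left_cancel₀ (zero_lt_one.trans_le hm).ne' hxy)
  calc _ ≤ ∫⁻ r in Ioi (0 : ℝ), ENNReal.ofReal |m * (2 * r)| *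
        ENNReal.ofReal (gaussian (c - m * r ^ 2)) := by
        refine setLIntegral_mono' measurableSet_Ioi fun r (hr : 0 < r) => ?_
        gcongr
        rw [abs_of_nonneg (by positivity)]
        nlinarith
    _ = ∫⁻ v in (fun r : ℝ => m * r ^ 2) '' Ioi 0, ENNReal.ofReal (gaussian (c - v)) :=
        (lintegral_image_eq_lintegral_abs_deriv_mul measurableSet_Ioi
          (fun r _ => (hderiv r).hasDerivWithinAt) hinj
          fun v => ENNReal.ofReal (gaussian (c - v))).symm
    _ ≤ 1 := (setLIntegral_le_lintegral _ _).trans_eq (lintegral_gaussian_sub c)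

theorem lintegral_gaussian_quadratic_le (c : ℝ) {A B : ℝ} (hA : 1 ≤ A) (hB : 1 ≤ B) :
    ∫⁻ p : ℝ × ℝ, ENNReal.ofReal (gaussian (c - (A * p.1 ^ 2 + B * p.2 ^ 2))) ≤
      ENNReal.ofReal (2 * Real.pi) := by
  rw [← lintegral_comp_polarCoord_symm, polarCoord_target, Measure.volume_eq_prod,
    ← Measure.prod_restrict, lintegral_prod_symm]
  · calc _ ≤ ∫⁻ _ in Ioo (-Real.pi) Real.pi, 1 := by
          refine lintegral_mono fun θ => ?_
          have hm : 1 ≤ A * Real.cos θ ^ 2 + B * Real.sin θ ^ 2 := by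
            nlinarith [Real.sin_sq_add_cos_sq θ, sq_nonneg (Real.cos θ), sq_nonneg (Real.sin θ)]
          refine (lintegral_congr fun r => ?_).trans_le (lintegral_radial_gaussian_le c hm)
          simp only [polarCoord_symm_apply, smul_eq_mul]
          ring_nf
      _ = ENNReal.ofReal (2 * Real.pi) := by
          rw [setLIntegral_one, Real.volume_Ioo]
          ring_nf
  · simp only [polarCoord_symm_apply, smul_eq_mul]
    have := continuous_gaussian.measurable
    fun_prop

/-- The phase `2π(ζ₁² + ζ₂² + ζ₃²)` of `û³(η)` for a free solution `u`, on the plane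
`ζ₁ + ζ₂ + ζ₃ = η` with coordinates `p = (ζ₁, ζ₂)`. -/
def triplePhase (η : ℝ) (p : ℝ × ℝ) : ℝ :=
  2 * Real.pi * (p.1 ^ 2 + p.2 ^ 2 + (η - p.1 - p.2) ^ 2)

theorem lintegral_gaussian_triplePhase_le (c η : ℝ) :
    ∫⁻ p : ℝ × ℝ, ENNReal.ofReal (gaussian (c - triplePhase η p)) ≤
      ENNReal.ofReal (2 * Real.pi) := by
  have hA : 1 ≤ 4 * Real.pi := by linarith [Real.pi_gt_three]
  have hB : 1 ≤ 3 * Real.pi := by linarith [Real.pi_gt_three]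
  have := continuous_gaussian.measurable
  -- Translating to `ζ₁ = x + η/3 - y/2`, `ζ₂ = y + η/3` diagonalises the phase.
  refine (Eq.le ?_).trans
    (lintegral_gaussian_quadratic_le (c - 2 * Real.pi * (η ^ 2 / 3)) hA hB)
  simp only [triplePhase]
  rw [Measure.volume_eq_prod, lintegral_prod_symm _ (by fun_prop),
    lintegral_prod_symm _ (by fun_prop), ← lintegral_add_right_eq_self _ (η / 3)]
  refine lintegral_congr fun y => ?_
  rw [← lintegral_add_right_eq_self _ (η / 3 - y / 2)]
  refine lintegral_congr fun x => ?_
  ring_nf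

section SchwartzProduct

variable {E : Type*} [NormedAddCommGroup E] [InnerProductSpace ℝ E]

/-- The pointwise product of two Schwartz functions. -/
def schwartzMul (A B : 𝓢(E, ℂ)) : 𝓢(E, ℂ) :=
  SchwartzMap.pairing (ContinuousLinearMap.mul ℂ ℂ) A B

theorem schwartzMul_apply (A B : 𝓢(E, ℂ)) (x : E) : schwartzMul A B x = A x * B x := rfl

variable [FiniteDimensional ℝ E] [MeasurableSpace E] [BorelSpace E]

theorem fourier_schwartzMul (A B : 𝓢(E, ℂ)) (η : E) :
    (𝓕 (schwartzMul A B) : 𝓢(E, ℂ)) η = ∫ ζ, (𝓕 A : 𝓢(E, ℂ)) ζ * (𝓕 B : 𝓢(E, ℂ)) (η - ζ) := by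
  have fourierInv_apply (C : 𝓢(E, ℂ)) (x : E) : (𝓕⁻ C : 𝓢(E, ℂ)) x = (𝓕 C : 𝓢(E, ℂ)) (-x) := by
    rw [SchwartzMap.fourierInv_coe, SchwartzMap.fourier_coe, Real.fourierInv_eq_fourier_neg]
  set D := SchwartzMap.convolution (ContinuousLinearMap.mul ℂ ℂ) (𝓕 A) (𝓕 B) with hD
  have hinv : schwartzMul A B = 𝓕⁻ D := by
    ext x
    rw [fourierInv_apply, hD, SchwartzMap.fourier_convolution, SchwartzMap.pairing_apply_apply,
      ← fourierInv_apply, ← fourierInv_apply, FourierTransform.fourierInv_fourier_eq,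
      FourierTransform.fourierInv_fourier_eq, schwartzMul_apply, ContinuousLinearMap.mul_apply']
  rw [hinv, FourierTransform.fourier_fourierInv_eq, hD, SchwartzMap.convolution_apply]
  rfl

theorem enorm_toLp_sq (A : 𝓢(E, ℂ)) : ‖A.toLp 2‖ₑ ^ 2 = ∫⁻ x, ‖A x‖ₑ ^ 2 := by
  rw [enorm_sq_eq_lintegral]
  exact lintegral_congr_ae ((SchwartzMap.coeFn_toLp A 2 volume).mono fun x hx => by
    simp only [hx])

theorem lintegral_enorm_fourier_sq (A : 𝓢(E, ℂ)) :
    ∫⁻ x, ‖(𝓕 A : 𝓢(E, ℂ)) x‖ₑ ^ 2 = ∫⁻ x, ‖A x‖ₑ ^ 2 := by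
  rw [← enorm_toLp_sq, ← enorm_toLp_sq, ← ofReal_norm, SchwartzMap.norm_fourier_toL2_eq,
    ofReal_norm]

end SchwartzProduct

theorem schrodingerSymbol_eq_fourierChar (σ ζ : ℝ) :
    schrodingerSymbol σ ζ = 𝐞 (-(σ * (2 * Real.pi * ζ ^ 2))) := by
  rw [schrodingerSymbol_eq_exp_mul_I, Real.fourierChar_apply]
  ring_nf

theorem lintegral_lintegral_mul_mul_sub {m : ℝ → ℝ≥0∞} (hm : Measurable m) :
    ∫⁻ η, ∫⁻ p : ℝ × ℝ, m p.1 * m p.2 * m (η - p.1 - p.2) = (∫⁻ x, m x) ^ 3 := by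
  rw [lintegral_lintegral_swap (by fun_prop)]
  have hinner (p : ℝ × ℝ) : ∫⁻ η, m p.1 * m p.2 * m (η - p.1 - p.2) =
      m p.1 * m p.2 * ∫⁻ x, m x := by
    simp only [sub_sub]
    rw [lintegral_const_mul _ (by fun_prop), lintegral_sub_right_eq_self m]
  simp only [hinner]
  rw [lintegral_mul_const _ (by fun_prop), Measure.volume_eq_prod,
    lintegral_prod_mul hm.aemeasurable hm.aemeasurable, pow_succ, pow_two]

section TripleProduct

variable (φ : 𝓢(ℝ, ℂ))

/-- The amplitude `φ̂(ζ₁) φ̂(ζ₂) φ̂(η - ζ₁ - ζ₂)` of `û³(η)` for a free solution `u` with datum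
`φ`. -/
def tripleAmplitude (η : ℝ) (p : ℝ × ℝ) : ℂ :=
  (𝓕 φ : 𝓢(ℝ, ℂ)) p.1 * ((𝓕 φ : 𝓢(ℝ, ℂ)) p.2 * (𝓕 φ : 𝓢(ℝ, ℂ)) (η - p.1 - p.2))

theorem integrable_tripleAmplitude (η : ℝ) : Integrable (tripleAmplitude φ η) := by
  have hfourier := (𝓕 φ : 𝓢(ℝ, ℂ)).integrable (μ := volume)
  refine ((hfourier.mul_prod hfourier).mul_bdd (c := SchwartzMap.seminorm ℝ 0 0 (𝓕 φ))
    (g := fun p : ℝ × ℝ => (𝓕 φ : 𝓢(ℝ, ℂ)) (η - p.1 - p.2)) ?_ ?_).congr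
    (.of_forall fun p => mul_assoc _ _ _)
  · exact (by fun_prop : Continuous _).aestronglyMeasurable
  · exact .of_forall fun p => SchwartzMap.norm_le_seminorm ℝ _ _

theorem integrable_tripleAmplitude_mul_fourierChar (σ η : ℝ) :
    Integrable fun p => tripleAmplitude φ η p * (𝐞 (-(σ * triplePhase η p)) : ℂ) := by
  refine (integrable_tripleAmplitude φ η).mul_bdd (c := 1) ?_ (.of_forall fun p => ?_)
  · unfold triplePhase
    exact (continuous_subtype_val.comp (Real.continuous_fourierChar.comp
      (by fun_prop))).aestronglyMeasurable
  · rw [Circle.norm_coe]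

theorem fourierChar_triplePhase (σ η p₁ p₂ : ℝ) :
    (𝐞 (-(σ * triplePhase η (p₁, p₂))) : ℂ) = schrodingerSymbol σ p₁ *
      (schrodingerSymbol σ p₂ * schrodingerSymbol σ (η - p₁ - p₂)) := by
  simp only [schrodingerSymbol_eq_fourierChar, ← Circle.coe_mul, ← AddChar.map_add_eq_mul,
    triplePhase]
  ring_nf

theorem fourier_freeEvolution_cubed (σ η : ℝ) :
    (𝓕 (schwartzMul (freeEvolution σ φ) (schwartzMul (freeEvolution σ φ) (freeEvolution σ φ))) :
      𝓢(ℝ, ℂ)) η = oscillatoryIntegral volume (triplePhase η) (tripleAmplitude φ η) σ := by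
  rw [fourier_schwartzMul, oscillatoryIntegral, Measure.volume_eq_prod,
    integral_prod _ (integrable_tripleAmplitude_mul_fourierChar φ σ η)]
  congr 1
  funext p₁
  rw [fourier_schwartzMul, ← integral_const_mul]
  congr 1
  funext p₂
  simp only [fourier_freeEvolution, tripleAmplitude, fourierChar_triplePhase]
  ring

theorem sixthPower_schrodinger_toLp (σ : ℝ) :
    sixthPower (schrodinger σ (φ.toLp 2)) =
      ∫⁻ η, ‖oscillatoryIntegral volume (triplePhase η) (tripleAmplitude φ η) σ‖ₑ ^ 2 := by
  simp_rw [← fourier_freeEvolution_cubed]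
  rw [lintegral_enorm_fourier_sq, schrodinger_toLp,
    sixthPower_congr_ae (SchwartzMap.coeFn_toLp (freeEvolution σ φ) 2 volume)]
  refine lintegral_congr fun x => ?_
  simp only [schwartzMul_apply, enorm_mul]
  ring

theorem lintegral_tripleAmplitude_sq :
    ∫⁻ η, ∫⁻ p, ‖tripleAmplitude φ η p‖ₑ ^ 2 = (∫⁻ x, ‖φ x‖ₑ ^ 2) ^ 3 := by
  have hmeas : Measurable fun x => ‖(𝓕 φ : 𝓢(ℝ, ℂ)) x‖ₑ ^ 2 :=
    (𝓕 φ : 𝓢(ℝ, ℂ)).continuous.enorm.measurable.pow_const 2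
  rw [← lintegral_enorm_fourier_sq, ← lintegral_lintegral_mul_mul_sub hmeas]
  simp only [tripleAmplitude, enorm_mul, mul_pow, mul_assoc]

theorem measurable_gaussian_mul_enorm_oscillatoryIntegral_sq :
    Measurable fun y : ℝ × ℝ => ENNReal.ofReal (gaussian y.1) *
      ‖oscillatoryIntegral volume (triplePhase y.2) (tripleAmplitude φ y.2) y.1‖ₑ ^ 2 := by
  have hphase : Continuous fun z : (ℝ × ℝ) × ℝ × ℝ =>
      (𝐞 (-(z.1.1 * triplePhase z.1.2 z.2)) : ℂ) := by
    unfold triplePhase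
    exact continuous_subtype_val.comp (Real.continuous_fourierChar.comp (by fun_prop))
  have hamplitude : Continuous fun z : (ℝ × ℝ) × ℝ × ℝ => tripleAmplitude φ z.1.2 z.2 := by
    unfold tripleAmplitude
    fun_prop
  have hgaussian := continuous_gaussian.measurable
  have hintegral := (hamplitude.mul hphase).stronglyMeasurable.integral_prod_right'
    (ν := (volume : Measure (ℝ × ℝ)))
  exact Measurable.mul (by fun_prop) (hintegral.enorm.pow_const 2)

theorem lintegral_gaussian_mul_sixthPower_toLp_le :
    ∫⁻ σ : ℝ, ENNReal.ofReal (gaussian σ) * sixthPower (schrodinger σ (φ.toLp 2)) ≤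
      2 * ENNReal.ofReal (2 * Real.pi) * (∫⁻ x, ‖φ x‖ₑ ^ 2) ^ 3 := by
  simp_rw [sixthPower_schrodinger_toLp, ← lintegral_const_mul' _ _ ENNReal.ofReal_ne_top]
  rw [lintegral_lintegral_swap
    (measurable_gaussian_mul_enorm_oscillatoryIntegral_sq φ).aemeasurable,
    ← lintegral_tripleAmplitude_sq, ← lintegral_const_mul' _ _ (by finiteness)]
  refine lintegral_mono fun η => ?_
  exact lintegral_gaussian_mul_enorm_oscillatoryIntegral_sq_le
    (by unfold triplePhase; fun_prop) (integrable_tripleAmplitude φ η)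
    fun c => lintegral_gaussian_triplePhase_le c η

end TripleProduct

/-- A constant for the `L⁶` Strichartz estimate on the unit time interval; `e^π` is the price of
inserting the Gaussian time weight. -/
def strichartzConst : ℝ := Real.exp Real.pi * (4 * Real.pi)

theorem strichartzConst_pos : 0 < strichartzConst := by
  unfold strichartzConst
  positivity

theorem lintegral_Icc_le_exp_mul_lintegral_gaussian_mul (g : ℝ → ℝ≥0∞) :
    ∫⁻ σ in Icc (0 : ℝ) 1, g σ ≤
      ENNReal.ofReal (Real.exp Real.pi) * ∫⁻ σ, ENNReal.ofReal (gaussian σ) * g σ := by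
  rw [← lintegral_const_mul' _ _ ENNReal.ofReal_ne_top]
  refine (setLIntegral_mono' measurableSet_Icc fun σ hσ => ?_).trans
    (setLIntegral_le_lintegral _ _)
  have hweight : 1 ≤ Real.exp Real.pi * gaussian σ := by
    rw [gaussian, ← Real.exp_add]
    refine Real.one_le_exp ?_
    nlinarith [Real.pi_pos, pow_le_one₀ (n := 2) hσ.1 hσ.2]
  rw [← mul_assoc, ← ENNReal.ofReal_mul (by positivity)]
  exact le_mul_of_one_le_left zero_le (ENNReal.one_le_ofReal.2 hweight)

theorem lintegral_sixthPower_toLp_le (φ : 𝓢(ℝ, ℂ)) :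
    ∫⁻ σ in Icc (0 : ℝ) 1, sixthPower (schrodinger σ (φ.toLp 2)) ≤
      ENNReal.ofReal strichartzConst * (∫⁻ x, ‖φ x‖ₑ ^ 2) ^ 3 := by
  have hconst : ENNReal.ofReal strichartzConst =
      ENNReal.ofReal (Real.exp Real.pi) * (2 * ENNReal.ofReal (2 * Real.pi)) := by
    rw [← ENNReal.ofReal_ofNat 2, ← ENNReal.ofReal_mul zero_le_two,
      ← ENNReal.ofReal_mul (Real.exp_nonneg _), strichartzConst]
    ring_nf
  rw [hconst, mul_assoc]
  exact (lintegral_Icc_le_exp_mul_lintegral_gaussian_mul _).trans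
    (mul_le_mul_right (lintegral_gaussian_mul_sixthPower_toLp_le φ) _)

theorem exists_schwartz_seq_tendsto (f : L2) :
    ∃ φ : ℕ → 𝓢(ℝ, ℂ), Tendsto (fun n => (φ n).toLp 2) atTop (𝓝 f) := by
  have hdense : DenseRange (SchwartzMap.toLpCLM ℝ (E := ℝ) ℂ 2 volume) :=
    SchwartzMap.denseRange_toLpCLM ENNReal.ofNat_ne_top
  obtain ⟨v, hv, hlim⟩ := mem_closure_iff_seq_limit.1 (hdense f)
  choose φ hφ using hv
  exact ⟨φ, hlim.congr fun n => (hφ n).symm⟩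

theorem lintegral_sixthPower_le_liminf {g : ℕ → L2} {f : L2} (hg : Tendsto g atTop (𝓝 f)) :
    ∫⁻ σ in Icc (0 : ℝ) 1, sixthPower (schrodinger σ f) ≤
      liminf (fun n => ∫⁻ σ in Icc (0 : ℝ) 1, sixthPower (schrodinger σ (g n))) atTop := by
  have hpointwise (σ : ℝ) : sixthPower (schrodinger σ f) ≤
      liminf (fun n => sixthPower (schrodinger σ (g n))) atTop :=
    (lowerSemicontinuousAt_iff_le_liminf.1
      (lowerSemicontinuous_lintegral_enorm_pow 6 (schrodinger σ f))).trans
      (liminf_le_liminf_of_le (((propagator σ).continuous.tendsto f).comp hg))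
  exact (lintegral_mono hpointwise).trans
    (lintegral_liminf_le fun n => measurable_sixthPower_schrodinger (g n))

theorem lintegral_sixthPower_le (f : L2) :
    ∫⁻ σ in Icc (0 : ℝ) 1, sixthPower (schrodinger σ f) ≤
      ENNReal.ofReal strichartzConst * ‖f‖ₑ ^ 6 := by
  obtain ⟨φ, hφ⟩ := exists_schwartz_seq_tendsto f
  have hbound (n : ℕ) : ∫⁻ σ in Icc (0 : ℝ) 1, sixthPower (schrodinger σ ((φ n).toLp 2)) ≤
      ENNReal.ofReal strichartzConst * (‖((φ n).toLp 2 : L2)‖ₑ ^ 2) ^ 3 :=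
    (lintegral_sixthPower_toLp_le (φ n)).trans_eq (by rw [enorm_toLp_sq])
  have hlim : Tendsto (fun n => ENNReal.ofReal strichartzConst *
      (‖((φ n).toLp 2 : L2)‖ₑ ^ 2) ^ 3) atTop
      (𝓝 (ENNReal.ofReal strichartzConst * (‖f‖ₑ ^ 2) ^ 3)) :=
    ENNReal.Tendsto.const_mul (((ENNReal.continuous_pow 3).comp
      (ENNReal.continuous_pow 2)).continuousAt.tendsto.comp hφ.enorm)
      (.inr ENNReal.ofReal_ne_top)
  refine (lintegral_sixthPower_le_liminf hφ).trans ?_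
  rw [pow_mul ‖f‖ₑ 2 3, ← hlim.liminf_eq]
  exact liminf_le_liminf (.of_forall hbound)

theorem ae_hasCube (f : L2) :
    ∀ᵐ σ ∂(volume.restrict (Icc (0 : ℝ) 1)), HasCube (schrodinger σ f) := by
  have hfinite := ae_lt_top (measurable_sixthPower_schrodinger f)
    ((lintegral_sixthPower_le f).trans_lt (by finiteness)).ne
  exact hfinite.mono fun σ => (hasCube_iff_sixthPower_lt_top _).2

theorem hasCube_zero : HasCube 0 := by
  rw [hasCube_iff_sixthPower_lt_top, sixthPower_congr_ae (Lp.coeFn_zero ℂ 2 volume)]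
  simp

theorem cube_zero : cube 0 = 0 := by
  apply Lp.ext
  filter_upwards [coeFn_cube hasCube_zero, Lp.coeFn_zero ℂ 2 volume] with x hcube hzero
  rw [hcube, hzero]
  simp [cubeFun]

theorem nonlinearityIntegrand_zero (σ : ℝ) : nonlinearityIntegrand 0 σ = 0 := by
  rw [nonlinearityIntegrand, schrodinger_zero_right, cube_zero, schrodinger_zero_right]

theorem nonlinearity_zero : nonlinearity 0 = 0 := by
  simp [nonlinearity, nonlinearityIntegrand_zero]

theorem aestronglyMeasurable_nonlinearityIntegrand (f : L2) :
    AEStronglyMeasurable (nonlinearityIntegrand f) (volume.restrict (Icc (0 : ℝ) 1)) := by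
  refine aestronglyMeasurable_of_tendsto_ae (u := atTop)
    (f := fun (n : ℕ) σ => schrodinger (-σ) (truncCube n (schrodinger σ f))) (fun n => ?_) ?_
  · have hpath : Continuous fun σ : ℝ => (-σ, truncCube n (schrodinger σ f)) :=
      continuous_neg.prodMk ((continuous_truncCube n).comp (continuous_schrodinger_left f))
    exact (continuous_schrodinger.comp hpath).aestronglyMeasurable
  · filter_upwards [ae_hasCube f] with σ hσ
    exact ((propagator (-σ)).continuous.tendsto _).comp (tendsto_truncCube hσ)

/-- A constant for the local Lipschitz estimate of the nonlinearity. -/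
def nonlinearityConst : ℝ := 1 + 27 * strichartzConst

theorem nonlinearityConst_pos : 0 < nonlinearityConst := by
  have := strichartzConst_pos
  unfold nonlinearityConst
  positivity

theorem lintegral_sixthPower_mul_le {f : L2} {R : ℝ} (hR : 0 < R) (hf : ‖f‖ ≤ R) :
    ∫⁻ σ in Icc (0 : ℝ) 1, sixthPower (schrodinger σ f) * ENNReal.ofReal (R⁻¹ ^ 6) ≤
      ENNReal.ofReal strichartzConst := by
  rw [lintegral_mul_const _ (measurable_sixthPower_schrodinger f)]
  have hnorm : ‖f‖ₑ ^ 6 ≤ ENNReal.ofReal (R ^ 6) := by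
    rw [ENNReal.ofReal_pow hR.le, ← ofReal_norm]
    gcongr
  calc _ ≤ ENNReal.ofReal strichartzConst * ENNReal.ofReal (R ^ 6) * ENNReal.ofReal (R⁻¹ ^ 6) := by
        gcongr
        exact (lintegral_sixthPower_le f).trans (by gcongr)
    _ = ENNReal.ofReal strichartzConst := by
        rw [mul_assoc, ← ENNReal.ofReal_mul (by positivity), ← mul_pow, mul_inv_cancel₀ hR.ne',
          one_pow, ENNReal.ofReal_one, mul_one]

theorem enorm_nonlinearityIntegrand_sub (f g : L2) (σ : ℝ) :
    ‖nonlinearityIntegrand f σ - nonlinearityIntegrand g σ‖ₑ =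
      ‖cube (schrodinger σ f) - cube (schrodinger σ g)‖ₑ := by
  rw [nonlinearityIntegrand, nonlinearityIntegrand, ← schrodinger_sub, ← ofReal_norm,
    norm_schrodinger, ofReal_norm]

theorem lintegral_nonlinearityIntegrand_sub_sq_le {f g : L2} {R d : ℝ} (hR : 0 < R) (hd : 0 < d)
    (hf : ‖f‖ ≤ R) (hg : ‖g‖ ≤ R) (hfg : ‖f - g‖ ≤ d) :
    ∫⁻ σ in Icc (0 : ℝ) 1, ‖nonlinearityIntegrand f σ - nonlinearityIntegrand g σ‖ₑ ^ 2 ≤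
      ENNReal.ofReal (27 * strichartzConst * (R ^ 2 * d) ^ 2) := by
  have hS := strichartzConst_pos
  calc _ ≤ ∫⁻ σ in Icc (0 : ℝ) 1, ENNReal.ofReal (9 * R ^ 4 * d ^ 2) *
      (sixthPower (schrodinger σ f) * ENNReal.ofReal (R⁻¹ ^ 6) +
        sixthPower (schrodinger σ g) * ENNReal.ofReal (R⁻¹ ^ 6) +
        sixthPower (schrodinger σ (f - g)) * ENNReal.ofReal (d⁻¹ ^ 6)) := by
        refine lintegral_mono_ae ?_
        filter_upwards [ae_hasCube f, ae_hasCube g] with σ hcf hcg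
        rw [enorm_nonlinearityIntegrand_sub, schrodinger_sub]
        exact enorm_cube_sub_cube_sq_le hcf hcg hR hd
    _ ≤ ENNReal.ofReal (9 * R ^ 4 * d ^ 2) * (ENNReal.ofReal strichartzConst +
        ENNReal.ofReal strichartzConst + ENNReal.ofReal strichartzConst) := by
        rw [lintegral_const_mul' _ _ ENNReal.ofReal_ne_top,
          lintegral_add_right _ ((measurable_sixthPower_schrodinger _).mul_const _),
          lintegral_add_right _ ((measurable_sixthPower_schrodinger _).mul_const _)]
        gcongr
        · exact lintegral_sixthPower_mul_le hR hf
        · exact lintegral_sixthPower_mul_le hR hg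
        · exact lintegral_sixthPower_mul_le hd hfg
    _ = ENNReal.ofReal (27 * strichartzConst * (R ^ 2 * d) ^ 2) := by
        rw [← ENNReal.ofReal_add hS.le hS.le, ← ENNReal.ofReal_add (by positivity) hS.le,
          ← ENNReal.ofReal_mul (by positivity)]
        ring_nf

theorem enorm_le_add_inv_mul_sq (x : ℝ≥0∞) {l : ℝ} (hl : 0 < l) :
    x ≤ ENNReal.ofReal l + ENNReal.ofReal l⁻¹ * x ^ 2 := by
  rcases le_total x (ENNReal.ofReal l) with hx | hx
  · exact hx.trans le_self_add
  · refine le_trans ?_ le_add_self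
    calc x = ENNReal.ofReal l⁻¹ * ENNReal.ofReal l * x := by
          rw [← ENNReal.ofReal_mul (by positivity), inv_mul_cancel₀ hl.ne', ENNReal.ofReal_one,
            one_mul]
      _ ≤ ENNReal.ofReal l⁻¹ * x * x := by gcongr
      _ = ENNReal.ofReal l⁻¹ * x ^ 2 := by ring

theorem lintegral_nonlinearityIntegrand_sub_le {f g : L2} {R d : ℝ} (hR : 0 < R) (hd : 0 < d)
    (hf : ‖f‖ ≤ R) (hg : ‖g‖ ≤ R) (hfg : ‖f - g‖ ≤ d) :
    ∫⁻ σ in Icc (0 : ℝ) 1, ‖nonlinearityIntegrand f σ - nonlinearityIntegrand g σ‖ₑ ≤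
      ENNReal.ofReal (nonlinearityConst * R ^ 2 * d) := by
  have hl : 0 < R ^ 2 * d := by positivity
  have hS := strichartzConst_pos
  calc _ ≤ ∫⁻ σ in Icc (0 : ℝ) 1, (ENNReal.ofReal (R ^ 2 * d) + ENNReal.ofReal (R ^ 2 * d)⁻¹ *
        ‖nonlinearityIntegrand f σ - nonlinearityIntegrand g σ‖ₑ ^ 2) :=
        lintegral_mono fun σ => enorm_le_add_inv_mul_sq _ hl
    _ ≤ ENNReal.ofReal (R ^ 2 * d) + ENNReal.ofReal (R ^ 2 * d)⁻¹ *
        ENNReal.ofReal (27 * strichartzConst * (R ^ 2 * d) ^ 2) := by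
        rw [lintegral_add_left measurable_const, lintegral_const_mul' _ _ ENNReal.ofReal_ne_top,
          setLIntegral_const, Real.volume_Icc, sub_zero, ENNReal.ofReal_one, mul_one]
        gcongr
        exact lintegral_nonlinearityIntegrand_sub_sq_le hR hd hf hg hfg
    _ = ENNReal.ofReal (nonlinearityConst * R ^ 2 * d) := by
        rw [← ENNReal.ofReal_mul (by positivity),
          ← ENNReal.ofReal_add (by positivity) (by positivity), nonlinearityConst]
        congr 1
        field_simp

theorem intervalIntegrable_nonlinearityIntegrand (f : L2) :
    IntervalIntegrable (nonlinearityIntegrand f) volume 0 1 := by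
  rw [intervalIntegrable_iff_integrableOn_Icc_of_le zero_le_one]
  refine ⟨aestronglyMeasurable_nonlinearityIntegrand f, ?_⟩
  have hbound := lintegral_nonlinearityIntegrand_sub_le (f := f) (g := 0) (R := ‖f‖ + 1)
    (d := ‖f‖ + 1) (by positivity) (by positivity) (by simp) (by simpa using by positivity)
    (by simp)
  simp only [nonlinearityIntegrand_zero, sub_zero] at hbound
  exact hbound.trans_lt ENNReal.ofReal_lt_top

theorem norm_nonlinearity_sub_le {f g : L2} {R : ℝ} (hR : 0 < R) (hf : ‖f‖ ≤ R) (hg : ‖g‖ ≤ R) :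
    ‖nonlinearity f - nonlinearity g‖ ≤ nonlinearityConst * R ^ 2 * ‖f - g‖ := by
  rcases eq_or_ne f g with rfl | hne
  · simp
  have hd : 0 < ‖f - g‖ := norm_pos_iff.2 (sub_ne_zero.2 hne)
  have hC := nonlinearityConst_pos
  rw [nonlinearity, nonlinearity, ← intervalIntegral.integral_sub
    (intervalIntegrable_nonlinearityIntegrand f) (intervalIntegrable_nonlinearityIntegrand g),
    intervalIntegral.integral_of_le zero_le_one, ← integral_Icc_eq_integral_Ioc,
    ← ENNReal.ofReal_le_ofReal_iff (by positivity), ofReal_norm]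
  exact (enorm_integral_le_lintegral_enorm _).trans
    (lintegral_nonlinearityIntegrand_sub_le hR hd hf hg le_rfl)

theorem continuous_nonlinearity : Continuous nonlinearity := by
  refine LocallyLipschitz.continuous fun f => ?_
  refine ⟨(nonlinearityConst * (‖f‖ + 1) ^ 2).toNNReal, Metric.ball 0 (‖f‖ + 1),
    Metric.isOpen_ball.mem_nhds (by simp), LipschitzOnWith.of_dist_le_mul fun x hx y hy => ?_⟩
  rw [dist_eq_norm, dist_eq_norm, Real.coe_toNNReal _
    (mul_nonneg nonlinearityConst_pos.le (sq_nonneg _))]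
  rw [mem_ball_zero_iff] at hx hy
  exact norm_nonlinearity_sub_le (by positivity) hx.le hy.le

theorem inner_cube_self {f : L2} (hf : HasCube f) :
    inner ℂ f (cube f) = ((∫ x, ‖f x‖ ^ 4 : ℝ) : ℂ) := by
  rw [L2.inner_def, ← integral_complex_ofReal]
  refine integral_congr_ae ?_
  filter_upwards [coeFn_cube hf] with x hx
  rw [hx, RCLike.inner_apply, cubeFun, mul_assoc, Complex.mul_conj, Complex.normSq_eq_norm_sq,
    ← Complex.ofReal_mul]
  congr 1
  ring

theorem inner_nonlinearity (g f : L2) :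
    inner ℂ g (nonlinearity f) =
      ∫ σ in (0 : ℝ)..1, inner ℂ (schrodinger σ g) (cube (schrodinger σ f)) := by
  have hcomm := (innerSL ℂ g).intervalIntegral_comp_comm
    (intervalIntegrable_nonlinearityIntegrand f)
  simp only [innerSL_apply_apply] at hcomm
  rw [nonlinearity, ← hcomm]
  refine intervalIntegral.integral_congr fun σ _ => ?_
  simp only [nonlinearityIntegrand, inner_schrodinger_right, neg_neg]

theorem im_inner_nonlinearity (f : L2) : (inner ℂ f (nonlinearity f)).im = 0 := by
  have hreal : inner ℂ f (nonlinearity f) =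
      ∫ σ in (0 : ℝ)..1, ((∫ x, ‖schrodinger σ f x‖ ^ 4 : ℝ) : ℂ) := by
    rw [inner_nonlinearity, intervalIntegral.integral_of_le zero_le_one,
      ← integral_Icc_eq_integral_Ioc, intervalIntegral.integral_of_le zero_le_one,
      ← integral_Icc_eq_integral_Ioc]
    exact integral_congr_ae ((ae_hasCube f).mono fun σ hσ => inner_cube_self hσ)
  rw [hreal, intervalIntegral.integral_ofReal, Complex.ofReal_im]

/-- The nonlinearity conjugated by the free flow. In the interaction picture
`w(t) = e^{-iγtΔ} u(t)` the equation reads `w' = i • interactionField γ t w`. -/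
def interactionField (γ t : ℝ) (w : L2) : L2 :=
  schrodinger (-(γ * t)) (nonlinearity (schrodinger (γ * t) w))

theorem continuousOn_interactionField (γ : ℝ) {X : Type*} [TopologicalSpace X] {a : X → ℝ}
    {w : X → L2} {s : Set X} (ha : ContinuousOn a s) (hw : ContinuousOn w s) :
    ContinuousOn (fun x => interactionField γ (a x) (w x)) s :=
  continuousOn_schrodinger (continuousOn_const.mul ha).neg
    (continuous_nonlinearity.comp_continuousOn
      (continuousOn_schrodinger (continuousOn_const.mul ha) hw))

theorem norm_interactionField_sub_le (γ t : ℝ) {f g : L2} {R : ℝ} (hR : 0 < R) (hf : ‖f‖ ≤ R)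
    (hg : ‖g‖ ≤ R) :
    ‖interactionField γ t f - interactionField γ t g‖ ≤ nonlinearityConst * R ^ 2 * ‖f - g‖ := by
  rw [← norm_schrodinger (γ * t)] at hf hg
  rw [interactionField, interactionField, ← schrodinger_sub, norm_schrodinger,
    ← norm_schrodinger (γ * t) (f - g), schrodinger_sub]
  exact norm_nonlinearity_sub_le hR hf hg

theorem interactionField_zero (γ t : ℝ) : interactionField γ t 0 = 0 := by
  rw [interactionField, schrodinger_zero_right, nonlinearity_zero, schrodinger_zero_right]

theorem im_inner_interactionField (γ t : ℝ) (f : L2) :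
    (inner ℂ f (interactionField γ t f)).im = 0 := by
  rw [interactionField, inner_schrodinger_right, neg_neg, im_inner_nonlinearity]

theorem isConservativeField_interactionField (γ : ℝ) :
    IsConservativeField ℂ fun t w => Complex.I • interactionField γ t w where
  continuous_apply w := by
    rw [← continuousOn_univ]
    exact (continuousOn_interactionField γ continuousOn_id continuousOn_const).const_smul
      Complex.I
  exists_lipschitzOnWith R hR := by
    refine ⟨(nonlinearityConst * R ^ 2).toNNReal, fun t =>
      LipschitzOnWith.of_dist_le_mul fun x hx y hy => ?_⟩
    rw [mem_closedBall_zero_iff] at hx hy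
    rw [dist_smul₀, Complex.norm_I, one_mul, dist_eq_norm, dist_eq_norm, Real.coe_toNNReal _
      (mul_nonneg nonlinearityConst_pos.le (sq_nonneg _))]
    exact norm_interactionField_sub_le γ t hR hx hy
  re_inner_eq_zero t w := by
    rw [inner_smul_right, RCLike.re_eq_complex_re, Complex.I_mul_re, im_inner_interactionField,
      neg_zero]

section WellPosedness

variable {γ T t : ℝ} {u₀ : L2} {u w : ℝ → L2}

/-- The path `t ↦ e^{-iγtΔ} u(t)`, which is constant for solutions of the linear equation. -/
def interactionPicture (γ : ℝ) (u : ℝ → L2) (t : ℝ) : L2 :=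
  schrodinger (-(γ * t)) (u t)

theorem schrodinger_interactionPicture (γ : ℝ) (u : ℝ → L2) (t : ℝ) :
    schrodinger (γ * t) (interactionPicture γ u t) = u t := by
  rw [interactionPicture, schrodinger_schrodinger, add_neg_cancel, schrodinger_zero_left]

theorem interactionPicture_schrodinger (γ : ℝ) (w : ℝ → L2) :
    interactionPicture γ (fun t => schrodinger (γ * t) (w t)) = w := by
  funext t
  rw [interactionPicture, schrodinger_schrodinger, neg_add_cancel, schrodinger_zero_left]

theorem interactionPicture_apply_zero (γ : ℝ) (u : ℝ → L2) : interactionPicture γ u 0 = u 0 := by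
  rw [interactionPicture, mul_zero, neg_zero, schrodinger_zero_left]

theorem norm_interactionPicture (γ : ℝ) (u : ℝ → L2) (t : ℝ) :
    ‖interactionPicture γ u t‖ = ‖u t‖ :=
  norm_schrodinger _ _

theorem continuousOn_interactionPicture {s : Set ℝ} (hu : ContinuousOn u s) :
    ContinuousOn (interactionPicture γ u) s :=
  continuousOn_schrodinger (by fun_prop) hu

theorem uIcc_zero_subset_Ioo (ht : t ∈ Ioo (-T) T) : uIcc 0 t ⊆ Ioo (-T) T :=
  ordConnected_Ioo.uIcc_subset (zero_mem_Ioo_neg_self ht) ht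

theorem intervalIntegrable_interactionField (hw : ContinuousOn w (Ioo (-T) T))
    (ht : t ∈ Ioo (-T) T) :
    IntervalIntegrable (fun τ => interactionField γ τ (w τ)) volume 0 t :=
  ((continuousOn_interactionField γ continuousOn_id hw).mono
    (uIcc_zero_subset_Ioo ht)).intervalIntegrable

theorem schrodinger_interactionField (γ t τ : ℝ) (u : ℝ → L2) :
    schrodinger (γ * t) (interactionField γ τ (interactionPicture γ u τ)) =
      schrodinger (γ * (t - τ)) (nonlinearity (u τ)) := by
  rw [interactionField, schrodinger_schrodinger, schrodinger_interactionPicture]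
  ring_nf

theorem duhamel_iff_interactionPicture_eq (hu : ContinuousOn u (Ioo (-T) T))
    (ht : t ∈ Ioo (-T) T) :
    u t = schrodinger (γ * t) u₀ +
        Complex.I • ∫ τ in (0 : ℝ)..t, schrodinger (γ * (t - τ)) (nonlinearity (u τ)) ↔
      interactionPicture γ u t = u₀ +
        Complex.I • ∫ τ in (0 : ℝ)..t, interactionField γ τ (interactionPicture γ u τ) := by
  have hint := intervalIntegrable_interactionField (γ := γ)
    (continuousOn_interactionPicture (γ := γ) hu) ht
  rw [← (propagator (γ * t)).injective.eq_iff (a := interactionPicture γ u t)]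
  change _ ↔ schrodinger (γ * t) _ = schrodinger (γ * t) _
  rw [schrodinger_interactionPicture, schrodinger_add, schrodinger_smul,
    schrodinger_intervalIntegral _ hint]
  simp only [schrodinger_interactionField]

theorem interactionPicture_eq_of_isSolution (hu : IsSolution γ T u₀ u) (ht : t ∈ Ioo (-T) T) :
    interactionPicture γ u t = u₀ +
      Complex.I • ∫ τ in (0 : ℝ)..t, interactionField γ τ (interactionPicture γ u τ) :=
  (duhamel_iff_interactionPicture_eq hu.continuousOn ht).1 (hu.duhamel t ht)

theorem isSolution_of_interactionPicture_eq (hu : ContinuousOn u (Ioo (-T) T))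
    (hint : ∀ t ∈ Ioo (-T) T, interactionPicture γ u t = u₀ +
      Complex.I • ∫ τ in (0 : ℝ)..t, interactionField γ τ (interactionPicture γ u τ)) :
    IsSolution γ T u₀ u where
  continuousOn := hu
  hasCube t _ := ae_hasCube _
  integrable_nonlinearity t _ := intervalIntegrable_nonlinearityIntegrand _
  integrable_duhamel t ht := by
    have hcont : ContinuousOn (fun τ => schrodinger (γ * (t - τ)) (nonlinearity (u τ)))
        (Ioo (-T) T) :=
      continuousOn_schrodinger (by fun_prop) (continuous_nonlinearity.comp_continuousOn hu)
    exact (hcont.mono (uIcc_zero_subset_Ioo ht)).intervalIntegrable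
  duhamel t ht := (duhamel_iff_interactionPicture_eq hu ht).2 (hint t ht)

theorem apply_zero_of_isSolution (hT : 0 < T) (hu : IsSolution γ T u₀ u) : u 0 = u₀ := by
  simpa [schrodinger_zero_left] using hu.duhamel 0 ⟨neg_lt_zero.2 hT, hT⟩

theorem hasDerivAt_interactionPicture (hu : IsSolution γ T u₀ u) (ht : t ∈ Ioo (-T) T) :
    HasDerivAt (interactionPicture γ u)
      (Complex.I • interactionField γ t (interactionPicture γ u t)) t := by
  have hcont := continuousOn_interactionPicture (γ := γ) hu.continuousOn
  have hfield := continuousOn_interactionField γ continuousOn_id hcont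
  have hprimitive : HasDerivAt
      (fun t => ∫ τ in (0 : ℝ)..t, interactionField γ τ (interactionPicture γ u τ))
      (interactionField γ t (interactionPicture γ u t)) t :=
    intervalIntegral.integral_hasDerivAt_right (intervalIntegrable_interactionField hcont ht)
      (hfield.stronglyMeasurableAtFilter isOpen_Ioo t ht)
      (hfield.continuousAt (isOpen_Ioo.mem_nhds ht))
  refine ((hprimitive.const_smul Complex.I).const_add u₀).congr_of_eventuallyEq ?_
  filter_upwards [isOpen_Ioo.mem_nhds ht] with τ hτ
  exact interactionPicture_eq_of_isSolution hu hτ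

theorem isSolution_schrodinger_of_hasDerivAt
    (hw : ∀ t ∈ Ioo (-T) T, HasDerivAt w (Complex.I • interactionField γ t (w t)) t) :
    IsSolution γ T (w 0) fun t => schrodinger (γ * t) (w t) := by
  have hcont : ContinuousOn w (Ioo (-T) T) := fun t ht => (hw t ht).continuousAt.continuousWithinAt
  refine isSolution_of_interactionPicture_eq (continuousOn_schrodinger (by fun_prop) hcont)
    fun t ht => ?_
  have hftc := intervalIntegral.integral_eq_sub_of_hasDerivAt
    (fun τ hτ => hw τ (uIcc_zero_subset_Ioo ht hτ))
    ((intervalIntegrable_interactionField (γ := γ) hcont ht).smul Complex.I)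
  rw [interactionPicture_schrodinger, ← intervalIntegral.integral_smul, hftc, add_sub_cancel]

theorem norm_eq_of_isSolution (hu : IsSolution γ T u₀ u) (ht : t ∈ Ioo (-T) T) :
    ‖u t‖ = ‖u₀‖ := by
  have hnorm := (isConservativeField_interactionField γ).norm_eq
    (fun t ht => hasDerivAt_interactionPicture hu ht) ht
  rwa [norm_interactionPicture, norm_interactionPicture,
    apply_zero_of_isSolution (zero_mem_Ioo_neg_self ht).2 hu] at hnorm

theorem eqOn_of_isSolution {v : ℝ → L2} (hu : IsSolution γ T u₀ u) (hv : IsSolution γ T u₀ v) :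
    EqOn u v (Ioo (-T) T) := by
  intro t ht
  have hT : 0 < T := (zero_mem_Ioo_neg_self ht).2
  have heq := (isConservativeField_interactionField γ).eqOn
    (fun t ht => hasDerivAt_interactionPicture hu ht)
    (fun t ht => hasDerivAt_interactionPicture hv ht)
    (by simp only [interactionPicture_apply_zero, apply_zero_of_isSolution hT hu,
      apply_zero_of_isSolution hT hv]) ht
  rw [← schrodinger_interactionPicture γ u, heq, schrodinger_interactionPicture]

theorem exists_isSolution (γ : ℝ) (hT : 0 < T) (u₀ : L2) : ∃ u, IsSolution γ T u₀ u := by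
  obtain ⟨w, rfl, hw⟩ :=
    (isConservativeField_interactionField γ).exists_forall_hasDerivAt hT.le u₀
  exact ⟨_, isSolution_schrodinger_of_hasDerivAt hw⟩

theorem exists_isDataToSolutionMap (γ : ℝ) (hT : 0 < T) : ∃ S, IsDataToSolutionMap γ T S := by
  choose S hS using exists_isSolution γ hT
  exact ⟨S, fun u₀ => ⟨hS u₀, fun _ hu => eqOn_of_isSolution hu (hS u₀)⟩⟩

theorem isSolution_zero (γ T : ℝ) : IsSolution γ T 0 0 := by
  have hsol := isSolution_schrodinger_of_hasDerivAt (γ := γ) (T := T) (w := 0) fun t _ => by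
    simp only [Pi.zero_apply, interactionField_zero, smul_zero]
    exact hasDerivAt_const t 0
  simp only [Pi.zero_apply, schrodinger_zero_right] at hsol
  exact hsol

end WellPosedness

section Dispersion

theorem schwartz_fourier_eq_integral (φ : 𝓢(ℝ, ℂ)) (ζ : ℝ) :
    (𝓕 φ : 𝓢(ℝ, ℂ)) ζ =
      ∫ y, Complex.exp (((-(2 * Real.pi * (ζ * y)) : ℝ) : ℂ) * Complex.I) * φ y := by
  rw [SchwartzMap.fourier_coe, Real.fourier_eq']
  simp only [smul_eq_mul, RCLike.inner_apply, conj_trivial, neg_mul]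

theorem schwartz_fourierInv_eq_integral (φ : 𝓢(ℝ, ℂ)) (x : ℝ) :
    (𝓕⁻ φ : 𝓢(ℝ, ℂ)) x =
      ∫ ζ, Complex.exp (((2 * Real.pi * (x * ζ) : ℝ) : ℂ) * Complex.I) * φ ζ := by
  rw [SchwartzMap.fourierInv_coe, Real.fourierInv_eq']
  simp only [smul_eq_mul, RCLike.inner_apply, conj_trivial]

theorem freeEvolution_apply (σ : ℝ) (φ : 𝓢(ℝ, ℂ)) (x : ℝ) :
    freeEvolution σ φ x = ∫ ζ, Complex.exp (((2 * Real.pi * (x * ζ) : ℝ) : ℂ) * Complex.I) *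
      (schrodingerSymbol σ ζ * (𝓕 φ : 𝓢(ℝ, ℂ)) ζ) := by
  simpa only [FourierTransform.fourierInv_fourier_eq, fourier_freeEvolution] using
    schwartz_fourierInv_eq_integral (𝓕 (freeEvolution σ φ)) x

theorem norm_freeEvolution_le_integral_fourier (σ : ℝ) (φ : 𝓢(ℝ, ℂ)) (x : ℝ) :
    ‖freeEvolution σ φ x‖ ≤ ∫ ζ, ‖(𝓕 φ : 𝓢(ℝ, ℂ)) ζ‖ := by
  rw [freeEvolution_apply]
  refine (norm_integral_le_integral_norm _).trans_eq ?_
  simp only [norm_mul, Complex.norm_exp_ofReal_mul_I, norm_schrodingerSymbol, one_mul]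

theorem norm_fourierIntegral_gaussian_le {b : ℂ} (hb : 0 < b.re) (c : ℝ) :
    ‖∫ ζ : ℝ, Complex.exp (Complex.I * c * ζ) * Complex.exp (-b * ζ ^ 2)‖ ≤
      (Real.pi / ‖b‖) ^ (1 / 2 : ℝ) := by
  have hb₀ : b ≠ 0 := by
    rintro rfl
    exact lt_irrefl 0 hb
  have hexponent : -(c : ℂ) ^ 2 / (4 * b) = ((-(c ^ 2) / 4 : ℝ) : ℂ) * b⁻¹ := by
    push_cast
    field_simp
  have hre : 0 ≤ b.re / Complex.normSq b := div_nonneg hb.le (Complex.normSq_nonneg _)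
  rw [fourierIntegral_gaussian hb, show (1 / 2 : ℂ) = ((1 / 2 : ℝ) : ℂ) by push_cast; rfl,
    norm_mul, Complex.norm_cpow_real, norm_div, Complex.norm_real,
    Real.norm_of_nonneg Real.pi_pos.le]
  refine mul_le_of_le_one_right (by positivity) ?_
  rw [Complex.norm_exp, Real.exp_le_one_iff, hexponent, Complex.re_ofReal_mul, Complex.inv_re]
  nlinarith [sq_nonneg c]

theorem integrable_mul_fourier_gaussian {b : ℂ} (hb : 0 < b.re) (φ : 𝓢(ℝ, ℂ)) (x : ℝ) :
    Integrable (Function.uncurry fun (ζ y : ℝ) =>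
      φ y * (Complex.exp (Complex.I * ((2 * Real.pi * (x - y) : ℝ) : ℂ) * ζ) *
        Complex.exp (-b * ζ ^ 2))) (volume.prod volume) := by
  have hcont := φ.continuous
  refine ((integrable_cexp_neg_mul_sq hb).mul_prod (φ.integrable (μ := volume))).mono
    (Continuous.aestronglyMeasurable (by unfold Function.uncurry; fun_prop))
    (Eventually.of_forall fun p => le_of_eq ?_)
  have hphase : Complex.I * ((2 * Real.pi * (x - p.2) : ℝ) : ℂ) * (p.1 : ℂ) =
      ((2 * Real.pi * (x - p.2) * p.1 : ℝ) : ℂ) * Complex.I := by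
    push_cast
    ring
  simp only [Function.uncurry]
  rw [hphase, norm_mul, norm_mul, Complex.norm_exp_ofReal_mul_I, norm_mul, one_mul, mul_comm]

theorem integral_gaussian_mul_fourier {b : ℂ} (hb : 0 < b.re) (φ : 𝓢(ℝ, ℂ)) (x : ℝ) :
    ∫ ζ : ℝ, Complex.exp (((2 * Real.pi * (x * ζ) : ℝ) : ℂ) * Complex.I) *
      (Complex.exp (-b * ζ ^ 2) * (𝓕 φ : 𝓢(ℝ, ℂ)) ζ) =
    ∫ y : ℝ, φ y * ∫ ζ : ℝ, Complex.exp (Complex.I * ((2 * Real.pi * (x - y) : ℝ) : ℂ) * ζ) *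
      Complex.exp (-b * ζ ^ 2) := by
  simp only [← integral_const_mul]
  rw [← integral_integral_swap (integrable_mul_fourier_gaussian hb φ x)]
  congr with ζ
  rw [schwartz_fourier_eq_integral, ← integral_const_mul, ← integral_const_mul]
  congr with y
  have hphase : Complex.exp (Complex.I * ((2 * Real.pi * (x - y) : ℝ) : ℂ) * ζ) =
      Complex.exp (((2 * Real.pi * (x * ζ) : ℝ) : ℂ) * Complex.I) *
        Complex.exp (((-(2 * Real.pi * (ζ * y)) : ℝ) : ℂ) * Complex.I) := by
    rw [← Complex.exp_add]
    congr 1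
    push_cast
    ring
  rw [hphase]
  ring

theorem norm_integral_gaussian_mul_fourier_le {b : ℂ} (hb : 0 < b.re) (φ : 𝓢(ℝ, ℂ)) (x : ℝ) :
    ‖∫ ζ : ℝ, Complex.exp (((2 * Real.pi * (x * ζ) : ℝ) : ℂ) * Complex.I) *
      (Complex.exp (-b * ζ ^ 2) * (𝓕 φ : 𝓢(ℝ, ℂ)) ζ)‖ ≤
      (Real.pi / ‖b‖) ^ (1 / 2 : ℝ) * ∫ y, ‖φ y‖ := by
  rw [integral_gaussian_mul_fourier hb, ← integral_const_mul]
  refine norm_integral_le_of_norm_le (φ.integrable.norm.const_mul _)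
    (Eventually.of_forall fun y => ?_)
  rw [norm_mul, mul_comm]
  gcongr
  exact norm_fourierIntegral_gaussian_le hb _

theorem schrodingerSymbol_eq_gaussian (σ ζ : ℝ) :
    schrodingerSymbol σ ζ =
      Complex.exp (-(((σ * (2 * Real.pi) ^ 2 : ℝ) : ℂ) * Complex.I) * ζ ^ 2) := by
  rw [schrodingerSymbol]
  congr 1
  push_cast
  ring

theorem norm_exp_neg_mul_sq_le_one {b : ℂ} (hb : 0 ≤ b.re) (ζ : ℝ) :
    ‖Complex.exp (-b * ζ ^ 2)‖ ≤ 1 := by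
  rw [norm_cexp_neg_mul_sq, Real.exp_le_one_iff, neg_mul, neg_nonpos]
  positivity

theorem tendsto_integral_gaussian_mul_fourier (σ : ℝ) (φ : 𝓢(ℝ, ℂ)) (x : ℝ) :
    Tendsto (fun δ : ℝ =>
      ∫ ζ : ℝ, Complex.exp (((2 * Real.pi * (x * ζ) : ℝ) : ℂ) * Complex.I) *
        (Complex.exp (-(δ + ((σ * (2 * Real.pi) ^ 2 : ℝ) : ℂ) * Complex.I) * ζ ^ 2) *
          (𝓕 φ : 𝓢(ℝ, ℂ)) ζ)) (𝓝[>] 0) (𝓝 (freeEvolution σ φ x)) := by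
  have hcont := (𝓕 φ : 𝓢(ℝ, ℂ)).continuous
  rw [freeEvolution_apply]
  refine tendsto_integral_filter_of_dominated_convergence (fun ζ => ‖(𝓕 φ : 𝓢(ℝ, ℂ)) ζ‖)
    (Eventually.of_forall fun δ => Continuous.aestronglyMeasurable (by fun_prop)) ?_
    (𝓕 φ : 𝓢(ℝ, ℂ)).integrable.norm (Eventually.of_forall fun ζ => ?_)
  · filter_upwards [self_mem_nhdsWithin] with δ (hδ : 0 < δ)
    refine Eventually.of_forall fun ζ => ?_
    rw [norm_mul, norm_mul, Complex.norm_exp_ofReal_mul_I, one_mul]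
    refine mul_le_of_le_one_left (norm_nonneg _) (norm_exp_neg_mul_sq_le_one ?_ ζ)
    rw [← Complex.mk_eq_add_mul_I]
    exact hδ.le
  · have hlim : Continuous fun δ : ℝ =>
        Complex.exp (((2 * Real.pi * (x * ζ) : ℝ) : ℂ) * Complex.I) *
          (Complex.exp (-(δ + ((σ * (2 * Real.pi) ^ 2 : ℝ) : ℂ) * Complex.I) * ζ ^ 2) *
            (𝓕 φ : 𝓢(ℝ, ℂ)) ζ) := by fun_prop
    simpa only [schrodingerSymbol_eq_gaussian, Complex.ofReal_zero, zero_add] using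
      (hlim.tendsto 0).mono_left nhdsWithin_le_nhds

theorem pi_div_norm_le {σ : ℝ} (hσ : σ ≠ 0) (δ : ℝ) :
    Real.pi / ‖(δ + ((σ * (2 * Real.pi) ^ 2 : ℝ) : ℂ) * Complex.I : ℂ)‖ ≤ |σ|⁻¹ := by
  have him : |σ| * (2 * Real.pi) ^ 2 ≤
      ‖(δ + ((σ * (2 * Real.pi) ^ 2 : ℝ) : ℂ) * Complex.I : ℂ)‖ := by
    rw [← Complex.mk_eq_add_mul_I]
    refine le_of_eq_of_le ?_ (Complex.abs_im_le_norm _)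
    rw [abs_mul, abs_sq]
  calc Real.pi / ‖(δ + ((σ * (2 * Real.pi) ^ 2 : ℝ) : ℂ) * Complex.I : ℂ)‖
      ≤ Real.pi / (|σ| * (2 * Real.pi) ^ 2) := by gcongr
    _ = |σ|⁻¹ * (4 * Real.pi)⁻¹ := by field_simp; ring
    _ ≤ |σ|⁻¹ := mul_le_of_le_one_right (by positivity)
        (inv_le_one_of_one_le₀ (by linarith [Real.pi_gt_three]))

theorem norm_freeEvolution_le_rpow {σ : ℝ} (hσ : σ ≠ 0) (φ : 𝓢(ℝ, ℂ)) (x : ℝ) :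
    ‖freeEvolution σ φ x‖ ≤ |σ| ^ (-(1 / 2) : ℝ) * ∫ y, ‖φ y‖ := by
  refine le_of_tendsto (tendsto_integral_gaussian_mul_fourier σ φ x).norm ?_
  filter_upwards [self_mem_nhdsWithin] with δ (hδ : 0 < δ)
  have hre : 0 < (δ + ((σ * (2 * Real.pi) ^ 2 : ℝ) : ℂ) * Complex.I : ℂ).re := by
    rwa [← Complex.mk_eq_add_mul_I]
  refine (norm_integral_gaussian_mul_fourier_le hre φ x).trans ?_
  rw [Real.rpow_neg (abs_nonneg σ), ← Real.inv_rpow (abs_nonneg σ)]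
  gcongr
  exact pi_div_norm_le hσ δ

end Dispersion

theorem hasCube_toLp (φ : 𝓢(ℝ, ℂ)) : HasCube (φ.toLp 2) := by
  rw [hasCube_iff_sixthPower_lt_top, sixthPower_congr_ae (SchwartzMap.coeFn_toLp φ 2 volume)]
  have h := lintegral_rpow_enorm_lt_top_of_eLpNorm_lt_top (p := 6) (by norm_num) (by norm_num)
    (φ.memLp 6 volume).eLpNorm_lt_top
  simpa only [ENNReal.toReal_ofNat, ENNReal.rpow_ofNat] using h

theorem coeFn_cube_toLp (φ : 𝓢(ℝ, ℂ)) :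
    cube (φ.toLp 2) =ᵐ[volume] fun x => cubeFun (φ x) := by
  filter_upwards [coeFn_cube (hasCube_toLp φ), SchwartzMap.coeFn_toLp φ 2 volume] with x hcube hφ
  rw [hcube, hφ]

theorem inner_toLp_cube_toLp (ψ φ : 𝓢(ℝ, ℂ)) :
    inner ℂ (ψ.toLp 2) (cube (φ.toLp 2)) =
      ∫ η, (starRingEnd ℂ) ((𝓕 (schwartzMul ψ φ) : 𝓢(ℝ, ℂ)) η) *
        (𝓕 (schwartzMul φ φ) : 𝓢(ℝ, ℂ)) η := by
  have hparseval := SchwartzMap.integral_inner_fourier_fourier (schwartzMul ψ φ) (schwartzMul φ φ)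
  simp only [RCLike.inner_apply, mul_comm _ ((starRingEnd ℂ) _)] at hparseval
  rw [hparseval, L2.inner_def]
  refine integral_congr_ae ?_
  filter_upwards [coeFn_cube_toLp φ, SchwartzMap.coeFn_toLp ψ 2 volume] with x hφ hψ
  have hsq : ((‖φ x‖ ^ 2 : ℝ) : ℂ) = φ x * (starRingEnd ℂ) (φ x) := by
    rw [Complex.mul_conj, Complex.normSq_eq_norm_sq]
  rw [hφ, hψ, RCLike.inner_apply, schwartzMul_apply, schwartzMul_apply, cubeFun, map_mul, hsq]
  ring

/-- The Schwartz function `φ` has the real-valued Fourier transform `f`. -/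
def HasRealFourier (φ : 𝓢(ℝ, ℂ)) (f : ℝ → ℝ) : Prop :=
  ∀ ζ, (𝓕 φ : 𝓢(ℝ, ℂ)) ζ = (f ζ : ℂ)

section QuarticForm

variable (κ a : ℝ → ℝ)

/-- The amplitude, at the frequencies `(η, (ζ, ζ₁))`, of the quartic form `⟨ψ, nonlinearity φ⟩` of
functions `ψ`, `φ` with real Fourier transforms `κ`, `a`. The four interacting frequencies are
`ζ`, `η - ζ`, `ζ₁` and `η - ζ₁`. -/
def quarticAmplitude (p : ℝ × (ℝ × ℝ)) : ℝ :=
  κ p.2.1 * a (p.1 - p.2.1) * (a p.2.2 * a (p.1 - p.2.2))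

/-- The resonance function `4π² (ζ² + (η - ζ)² - ζ₁² - (η - ζ₁)²)` of the quartic form at the
frequencies `(η, (ζ, ζ₁))`, in factored form. -/
def quarticPhase (p : ℝ × (ℝ × ℝ)) : ℝ :=
  8 * Real.pi ^ 2 * (p.2.2 - p.2.1) * (p.1 - p.2.2 - p.2.1)

/-- The imaginary part of the integrand of the quartic form, averaged over `σ ∈ [0, 1]`. -/
def quarticDensity (p : ℝ × (ℝ × ℝ)) : ℝ :=
  quarticAmplitude κ a p * ∫ σ in (0 : ℝ)..1, Real.sin (σ * quarticPhase p)

theorem continuous_quarticPhase : Continuous quarticPhase := by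
  unfold quarticPhase
  fun_prop

variable {κ a}

theorem integrable_quarticAmplitude (hκ : Continuous κ) (ha : Continuous a)
    (hκs : HasCompactSupport κ) (has : HasCompactSupport a) :
    Integrable (quarticAmplitude κ a) := by
  refine Continuous.integrable_of_hasCompactSupport (by unfold quarticAmplitude; fun_prop) ?_
  have hcompact : IsCompact ((fun q : ℝ × ℝ × ℝ => (q.2.1 + q.2.2, (q.1, q.2.1))) ''
      (tsupport κ ×ˢ tsupport a ×ˢ tsupport a)) :=
    (hκs.prod (has.prod has)).image (by fun_prop)
  refine HasCompactSupport.of_support_subset_isCompact hcompact ?_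
  rintro ⟨η, ζ, ζ₁⟩ hp
  simp only [Function.mem_support, quarticAmplitude, mul_ne_zero_iff] at hp
  exact ⟨(ζ, ζ₁, η - ζ₁), ⟨subset_tsupport _ hp.1.1, subset_tsupport _ hp.2.1,
    subset_tsupport _ hp.2.2⟩, by simp⟩

theorem integrable_quarticAmplitude_mul_exp (hA : Integrable (quarticAmplitude κ a)) (σ : ℝ) :
    Integrable fun p => (quarticAmplitude κ a p : ℂ) *
      Complex.exp (((σ * quarticPhase p : ℝ) : ℂ) * Complex.I) := by
  have hphase := continuous_quarticPhase
  refine hA.ofReal.mul_bdd (c := 1)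
    (by fun_prop : Continuous fun p : ℝ × ℝ × ℝ =>
      Complex.exp (((σ * quarticPhase p : ℝ) : ℂ) * Complex.I)).aestronglyMeasurable
    (.of_forall fun p => ?_)
  rw [Complex.norm_exp_ofReal_mul_I]

theorem integrable_uncurry_quarticAmplitude_mul_exp (hA : Integrable (quarticAmplitude κ a)) :
    Integrable (Function.uncurry fun (σ : ℝ) p => (quarticAmplitude κ a p : ℂ) *
      Complex.exp (((σ * quarticPhase p : ℝ) : ℂ) * Complex.I))
      ((volume.restrict (Ioc (0 : ℝ) 1)).prod volume) := by
  have hphase := continuous_quarticPhase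
  have hA' : Integrable (fun p => (quarticAmplitude κ a p : ℂ)) := hA.ofReal
  refine (hA'.comp_snd (volume.restrict (Ioc (0 : ℝ) 1))).mul_bdd (c := 1)
    (by fun_prop : Continuous fun z : ℝ × ℝ × ℝ × ℝ =>
      Complex.exp (((z.1 * quarticPhase z.2 : ℝ) : ℂ) * Complex.I)).aestronglyMeasurable
    (.of_forall fun z => ?_)
  rw [Complex.norm_exp_ofReal_mul_I]

theorem exp_mul_quarticPhase (σ η ζ ζ₁ : ℝ) :
    Complex.exp (((σ * quarticPhase (η, (ζ, ζ₁)) : ℝ) : ℂ) * Complex.I) =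
      (starRingEnd ℂ) (schrodingerSymbol σ ζ) * (starRingEnd ℂ) (schrodingerSymbol σ (η - ζ)) *
        (schrodingerSymbol σ ζ₁ * schrodingerSymbol σ (η - ζ₁)) := by
  simp only [schrodingerSymbol_eq_exp_mul_I, quarticPhase, ← Complex.exp_conj, map_mul,
    Complex.conj_ofReal, Complex.conj_I, ← Complex.exp_add]
  congr 1
  push_cast
  ring

theorem inner_schrodinger_cube_eq_integral (hA : Integrable (quarticAmplitude κ a))
    {ψ φ : 𝓢(ℝ, ℂ)} (hψ : HasRealFourier ψ κ) (hφ : HasRealFourier φ a) (σ : ℝ) :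
    inner ℂ (schrodinger σ (ψ.toLp 2)) (cube (schrodinger σ (φ.toLp 2))) =
      ∫ p, (quarticAmplitude κ a p : ℂ) *
        Complex.exp (((σ * quarticPhase p : ℝ) : ℂ) * Complex.I) := by
  rw [schrodinger_toLp, schrodinger_toLp, inner_toLp_cube_toLp, Measure.volume_eq_prod,
    integral_prod _ (integrable_quarticAmplitude_mul_exp hA σ)]
  congr with η
  rw [fourier_schwartzMul, fourier_schwartzMul, ← integral_conj, ← integral_prod_mul,
    ← Measure.volume_eq_prod]
  congr with ⟨ζ, ζ₁⟩
  simp only [fourier_freeEvolution, hψ _, hφ _, map_mul, Complex.conj_ofReal, quarticAmplitude,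
    exp_mul_quarticPhase]
  push_cast
  ring

theorem inner_nonlinearity_eq_integral (hA : Integrable (quarticAmplitude κ a))
    {ψ φ : 𝓢(ℝ, ℂ)} (hψ : HasRealFourier ψ κ) (hφ : HasRealFourier φ a) :
    inner ℂ (ψ.toLp 2) (nonlinearity (φ.toLp 2)) =
      ∫ p, (quarticAmplitude κ a p : ℂ) *
        ∫ σ in (0 : ℝ)..1, Complex.exp (((σ * quarticPhase p : ℝ) : ℂ) * Complex.I) := by
  simp_rw [inner_nonlinearity, inner_schrodinger_cube_eq_integral hA hψ hφ,
    intervalIntegral.integral_of_le zero_le_one]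
  rw [integral_integral_swap (integrable_uncurry_quarticAmplitude_mul_exp hA)]
  simp_rw [integral_const_mul]

theorem im_quarticAmplitude_mul_integral_exp (p : ℝ × ℝ × ℝ) :
    ((quarticAmplitude κ a p : ℂ) *
      ∫ σ in (0 : ℝ)..1, Complex.exp (((σ * quarticPhase p : ℝ) : ℂ) * Complex.I)).im =
        quarticDensity κ a p := by
  have hcomm := Complex.imCLM.intervalIntegral_comp_comm (μ := volume) (a := 0) (b := 1)
    ((by fun_prop : Continuous fun σ : ℝ =>
      Complex.exp (((σ * quarticPhase p : ℝ) : ℂ) * Complex.I)).intervalIntegrable 0 1)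
  simp only [Complex.imCLM_apply, Complex.exp_ofReal_mul_I_im] at hcomm
  rw [Complex.im_ofReal_mul, ← hcomm, quarticDensity]

theorem integrable_quarticAmplitude_mul_integral_exp (hA : Integrable (quarticAmplitude κ a)) :
    Integrable fun p => (quarticAmplitude κ a p : ℂ) *
      ∫ σ in (0 : ℝ)..1, Complex.exp (((σ * quarticPhase p : ℝ) : ℂ) * Complex.I) := by
  simpa only [Function.uncurry, intervalIntegral.integral_of_le zero_le_one, integral_const_mul]
    using (integrable_uncurry_quarticAmplitude_mul_exp hA).integral_prod_right

theorem integrable_quarticDensity (hA : Integrable (quarticAmplitude κ a)) :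
    Integrable (quarticDensity κ a) :=
  (integrable_quarticAmplitude_mul_integral_exp hA).im.congr
    (.of_forall im_quarticAmplitude_mul_integral_exp)

theorem im_inner_nonlinearity_eq_integral (hA : Integrable (quarticAmplitude κ a))
    {ψ φ : 𝓢(ℝ, ℂ)} (hψ : HasRealFourier ψ κ) (hφ : HasRealFourier φ a) :
    (inner ℂ (ψ.toLp 2) (nonlinearity (φ.toLp 2))).im = ∫ p, quarticDensity κ a p := by
  have hcomm :=
    Complex.imCLM.integral_comp_comm (integrable_quarticAmplitude_mul_integral_exp hA)
  simp only [Complex.imCLM_apply, im_quarticAmplitude_mul_integral_exp] at hcomm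
  rw [inner_nonlinearity_eq_integral hA hψ hφ, ← hcomm]

theorem intervalIntegral_sin_mul {c : ℝ} (hc : c ≠ 0) :
    ∫ σ in (0 : ℝ)..1, Real.sin (σ * c) = (1 - Real.cos c) / c := by
  rw [intervalIntegral.integral_comp_mul_right (fun x => Real.sin x) hc, integral_sin, zero_mul,
    Real.cos_zero, one_mul, smul_eq_mul, inv_mul_eq_div]

theorem quarticDensity_eq {p : ℝ × ℝ × ℝ} (hp : quarticPhase p ≠ 0) :
    quarticDensity κ a p =
      quarticAmplitude κ a p * ((1 - Real.cos (quarticPhase p)) / quarticPhase p) := by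
  rw [quarticDensity, intervalIntegral_sin_mul hp]

theorem quarticPhase_pos {η ζ ζ₁ : ℝ} (h₁ : ζ < ζ₁) (h₂ : ζ < η - ζ₁) :
    0 < quarticPhase (η, (ζ, ζ₁)) := by
  have := sub_pos.2 h₁
  have := sub_pos.2 h₂
  unfold quarticPhase
  positivity

theorem quarticPhase_le {η ζ ζ₁ M : ℝ} (h₁ : ζ < ζ₁) (h₂ : ζ < η - ζ₁) (h₁' : ζ₁ - ζ ≤ M)
    (h₂' : η - ζ₁ - ζ ≤ M) : quarticPhase (η, (ζ, ζ₁)) ≤ 8 * Real.pi ^ 2 * M ^ 2 := by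
  have := sub_pos.2 h₁
  have := sub_pos.2 h₂
  have : 0 ≤ M := by linarith
  calc quarticPhase (η, (ζ, ζ₁)) ≤ 8 * Real.pi ^ 2 * M * M := by
        unfold quarticPhase
        gcongr
    _ = 8 * Real.pi ^ 2 * M ^ 2 := by ring

theorem setIntegral_one_sub_cos_ge {α β c m : ℝ} (hm : 0 < m) (hαβ : α ≤ β) :
    β - α - 2 / m ≤ ∫ x in Icc α β, (1 - Real.cos (m * x - c)) := by
  rw [integral_Icc_eq_integral_Ioc, ← intervalIntegral.integral_of_le hαβ,
    intervalIntegral.integral_sub (by simp) (Continuous.intervalIntegrable (by fun_prop) _ _),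
    intervalIntegral.integral_const, intervalIntegral.integral_comp_mul_sub _ hm.ne',
    integral_cos, smul_eq_mul, smul_eq_mul, mul_one, inv_mul_eq_div]
  gcongr
  linarith [Real.sin_le_one (m * β - c), Real.neg_one_le_sin (m * α - c)]

theorem setIntegral_one_sub_cos_quarticPhase_ge {N ζ ζ₁ : ℝ} (hN : 4 ≤ N)
    (hζ : ζ ∈ Icc (-(1 / 2) : ℝ) (1 / 2)) (hζ₁ : ζ₁ ∈ Icc N (5 / 4 * N)) :
    N / 8 ≤ ∫ η in Icc (ζ₁ + N) (ζ₁ + 5 / 4 * N),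
      (1 - Real.cos (quarticPhase (η, (ζ, ζ₁)))) := by
  set m := 8 * Real.pi ^ 2 * (ζ₁ - ζ) with hm
  have hphase (η : ℝ) : quarticPhase (η, (ζ, ζ₁)) = m * η - m * (ζ₁ + ζ) := by
    simp only [quarticPhase, hm]
    ring
  have hgap : 1 ≤ ζ₁ - ζ := by linarith [hζ.2, hζ₁.1]
  have hm8 : 8 ≤ m := by nlinarith [Real.pi_gt_three]
  have hsmall : 2 / m ≤ 2 / 8 := by gcongr
  simp only [hphase]
  have hbound := setIntegral_one_sub_cos_ge (c := m * (ζ₁ + ζ)) (by linarith : 0 < m)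
    (by linarith : ζ₁ + N ≤ ζ₁ + 5 / 4 * N)
  linarith

end QuarticForm

/-- `f` is a continuous function with values in `[0, c]` that equals `c` on `I` and vanishes outside
`J`. The Fourier transforms of the initial datum and of the test function are of this kind. -/
structure IsPlateau (c : ℝ) (I J : Set ℝ) (f : ℝ → ℝ) : Prop where
  continuous : Continuous f
  nonneg : ∀ x, 0 ≤ f x
  le : ∀ x, f x ≤ c
  eq_of_mem : ∀ x ∈ I, f x = c
  mem_of_ne_zero : ∀ x, f x ≠ 0 → x ∈ J

section Resonance

variable {κ a : ℝ → ℝ}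

theorem IsPlateau.hasCompactSupport {c : ℝ} {I J : Set ℝ} {f : ℝ → ℝ} (hf : IsPlateau c I J f)
    (hJ : IsCompact J) : HasCompactSupport f :=
  HasCompactSupport.of_support_subset_isCompact hJ hf.mem_of_ne_zero

theorem quarticAmplitude_nonneg (hκ : ∀ x, 0 ≤ κ x) (ha : ∀ x, 0 ≤ a x) (p : ℝ × ℝ × ℝ) :
    0 ≤ quarticAmplitude κ a p :=
  mul_nonneg (mul_nonneg (hκ _) (ha _)) (mul_nonneg (ha _) (ha _))

theorem quarticDensity_nonneg {b c M N : ℝ} {I J : Set ℝ} (hMN : M < N)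
    (hκ : IsPlateau c I (Iic M) κ) (ha : IsPlateau b J (Ici N) a) (p : ℝ × ℝ × ℝ) :
    0 ≤ quarticDensity κ a p := by
  obtain ⟨η, ζ, ζ₁⟩ := p
  rcases eq_or_ne (quarticAmplitude κ a (η, (ζ, ζ₁))) 0 with hA | hA
  · rw [quarticDensity, hA, zero_mul]
  have hne := hA
  simp only [quarticAmplitude, mul_ne_zero_iff] at hne
  have hζ : ζ ≤ M := hκ.mem_of_ne_zero _ hne.1.1
  have hζ₁ : N ≤ ζ₁ := ha.mem_of_ne_zero _ hne.2.1
  have hηζ₁ : N ≤ η - ζ₁ := ha.mem_of_ne_zero _ hne.2.2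
  have hphase : 0 < quarticPhase (η, (ζ, ζ₁)) := quarticPhase_pos (by linarith) (by linarith)
  rw [quarticDensity_eq hphase.ne']
  exact mul_nonneg (quarticAmplitude_nonneg hκ.nonneg ha.nonneg _)
    (div_nonneg (sub_nonneg.2 (Real.cos_le_one _)) hphase.le)

variable {N l : ℝ}

theorem quarticDensity_ge {J K : Set ℝ} (hN : 4 ≤ N) (hl : 0 ≤ l)
    (hκ : IsPlateau 1 (Icc (-(1 / 2)) (1 / 2)) K κ) (ha : IsPlateau l (Icc N (7 / 2 * N)) J a)
    {η ζ ζ₁ : ℝ} (hζ : ζ ∈ Icc (-(1 / 2) : ℝ) (1 / 2)) (hζ₁ : ζ₁ ∈ Icc N (5 / 4 * N))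
    (hη : η ∈ Icc (ζ₁ + N) (ζ₁ + 5 / 4 * N)) :
    l ^ 3 / (32 * Real.pi ^ 2 * N ^ 2) * (1 - Real.cos (quarticPhase (η, (ζ, ζ₁)))) ≤
      quarticDensity κ a (η, (ζ, ζ₁)) := by
  obtain ⟨hζ_ge, hζ_le⟩ := hζ
  obtain ⟨hζ₁_ge, hζ₁_le⟩ := hζ₁
  obtain ⟨hη_ge, hη_le⟩ := hη
  have hgap₁ : ζ < ζ₁ := by linarith
  have hgap₂ : ζ < η - ζ₁ := by linarith
  have hphase : quarticPhase (η, (ζ, ζ₁)) ≤ 32 * Real.pi ^ 2 * N ^ 2 :=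
    (quarticPhase_le hgap₁ hgap₂ (M := 2 * N) (by linarith) (by linarith)).trans_eq (by ring)
  have hphase_pos := quarticPhase_pos hgap₁ hgap₂
  have hA : quarticAmplitude κ a (η, (ζ, ζ₁)) = l ^ 3 := by
    rw [quarticAmplitude, hκ.eq_of_mem ζ ⟨hζ_ge, hζ_le⟩,
      ha.eq_of_mem (η - ζ) ⟨by linarith, by linarith⟩,
      ha.eq_of_mem ζ₁ ⟨by linarith, by linarith⟩,
      ha.eq_of_mem (η - ζ₁) ⟨by linarith, by linarith⟩]
    ring
  rw [quarticDensity_eq hphase_pos.ne', hA, div_mul_eq_mul_div, mul_div_assoc]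
  have := Real.cos_le_one (quarticPhase (η, (ζ, ζ₁)))
  gcongr

theorem lintegral_quarticDensity_ge {J K : Set ℝ} (hN : 4 ≤ N) (hl : 0 < l)
    (hκ : IsPlateau 1 (Icc (-(1 / 2)) (1 / 2)) K κ) (ha : IsPlateau l (Icc N (7 / 2 * N)) J a)
    {ζ ζ₁ : ℝ} (hζ : ζ ∈ Icc (-(1 / 2) : ℝ) (1 / 2)) (hζ₁ : ζ₁ ∈ Icc N (5 / 4 * N)) :
    ENNReal.ofReal (l ^ 3 / (256 * Real.pi ^ 2 * N)) ≤
      ∫⁻ η, ENNReal.ofReal (quarticDensity κ a (η, (ζ, ζ₁))) := by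
  set c := l ^ 3 / (32 * Real.pi ^ 2 * N ^ 2) with hc
  have hcN : l ^ 3 / (256 * Real.pi ^ 2 * N) = c * (N / 8) := by
    rw [hc]
    field_simp
    norm_num
  have hcont : Continuous fun η => c * (1 - Real.cos (quarticPhase (η, (ζ, ζ₁)))) := by
    unfold quarticPhase
    fun_prop
  have hnonneg (η : ℝ) : 0 ≤ c * (1 - Real.cos (quarticPhase (η, (ζ, ζ₁)))) :=
    mul_nonneg (by positivity) (sub_nonneg.2 (Real.cos_le_one _))
  calc ENNReal.ofReal (l ^ 3 / (256 * Real.pi ^ 2 * N))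
      ≤ ENNReal.ofReal (∫ η in Icc (ζ₁ + N) (ζ₁ + 5 / 4 * N),
          c * (1 - Real.cos (quarticPhase (η, (ζ, ζ₁))))) := by
        rw [hcN, integral_const_mul]
        gcongr
        exact setIntegral_one_sub_cos_quarticPhase_ge hN hζ hζ₁
    _ = ∫⁻ η in Icc (ζ₁ + N) (ζ₁ + 5 / 4 * N),
          ENNReal.ofReal (c * (1 - Real.cos (quarticPhase (η, (ζ, ζ₁))))) :=
        ofReal_integral_eq_lintegral_ofReal
          (hcont.continuousOn.integrableOn_compact isCompact_Icc) (.of_forall hnonneg)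
    _ ≤ ∫⁻ η in Icc (ζ₁ + N) (ζ₁ + 5 / 4 * N),
          ENNReal.ofReal (quarticDensity κ a (η, (ζ, ζ₁))) :=
        setLIntegral_mono' measurableSet_Icc fun η hη =>
          ENNReal.ofReal_le_ofReal (quarticDensity_ge hN hl.le hκ ha hζ hζ₁ hη)
    _ ≤ ∫⁻ η, ENNReal.ofReal (quarticDensity κ a (η, (ζ, ζ₁))) := setLIntegral_le_lintegral _ _

theorem IsPlateau.mono {c : ℝ} {I J K : Set ℝ} {f : ℝ → ℝ} (hf : IsPlateau c I J f)
    (hJK : J ⊆ K) : IsPlateau c I K f :=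
  { hf with mem_of_ne_zero := fun x hx => hJK (hf.mem_of_ne_zero x hx) }

theorem integral_quarticDensity_ge (hN : 4 ≤ N) (hl : 0 < l)
    (hκ : IsPlateau 1 (Icc (-(1 / 2)) (1 / 2)) (Icc (-1) 1) κ)
    (ha : IsPlateau l (Icc N (7 / 2 * N)) (Icc (N / 2) (4 * N)) a) :
    l ^ 3 / (1024 * Real.pi ^ 2) ≤ ∫ p, quarticDensity κ a p := by
  have hD := integrable_quarticDensity (integrable_quarticAmplitude hκ.continuous ha.continuous
    (hκ.hasCompactSupport isCompact_Icc) (ha.hasCompactSupport isCompact_Icc))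
  have hD0 (p : ℝ × ℝ × ℝ) : 0 ≤ quarticDensity κ a p :=
    quarticDensity_nonneg (by linarith : 1 < N / 2) (hκ.mono Icc_subset_Iic_self)
      (ha.mono Icc_subset_Ici_self) p
  set B := Icc (-(1 / 2) : ℝ) (1 / 2) ×ˢ Icc N (5 / 4 * N)
  rw [← ENNReal.ofReal_le_ofReal_iff (integral_nonneg hD0),
    ofReal_integral_eq_lintegral_ofReal hD (.of_forall hD0), Measure.volume_eq_prod,
    lintegral_prod_symm _ hD.aestronglyMeasurable.aemeasurable.ennreal_ofReal]
  calc ENNReal.ofReal (l ^ 3 / (1024 * Real.pi ^ 2))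
      = ∫⁻ _ in B, ENNReal.ofReal (l ^ 3 / (256 * Real.pi ^ 2 * N)) := by
        rw [setLIntegral_const, Measure.volume_eq_prod, Measure.prod_prod, Real.volume_Icc,
          Real.volume_Icc, ← ENNReal.ofReal_mul (by norm_num), ← ENNReal.ofReal_mul (by positivity)]
        congr 1
        field_simp
        ring
    _ ≤ ∫⁻ q in B, ∫⁻ η, ENNReal.ofReal (quarticDensity κ a (η, q)) :=
        setLIntegral_mono' (measurableSet_Icc.prod measurableSet_Icc) fun q hq =>
          lintegral_quarticDensity_ge hN hl hκ ha hq.1 hq.2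
    _ ≤ ∫⁻ q, ∫⁻ η, ENNReal.ofReal (quarticDensity κ a (η, q)) := setLIntegral_le_lintegral _ _

theorem im_inner_nonlinearity_ge (hN : 4 ≤ N) (hl : 0 < l)
    (hκ : IsPlateau 1 (Icc (-(1 / 2)) (1 / 2)) (Icc (-1) 1) κ)
    (ha : IsPlateau l (Icc N (7 / 2 * N)) (Icc (N / 2) (4 * N)) a)
    {ψ φ : 𝓢(ℝ, ℂ)} (hψ : HasRealFourier ψ κ) (hφ : HasRealFourier φ a) :
    l ^ 3 / (1024 * Real.pi ^ 2) ≤ (inner ℂ (ψ.toLp 2) (nonlinearity (φ.toLp 2))).im := by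
  rw [im_inner_nonlinearity_eq_integral (integrable_quarticAmplitude hκ.continuous ha.continuous
    (hκ.hasCompactSupport isCompact_Icc) (ha.hasCompactSupport isCompact_Icc)) hψ hφ]
  exact integral_quarticDensity_ge hN hl hκ ha

end Resonance

theorem enorm_inner_le_sobolevNorm_mul (s : ℝ) (f g : L2) :
    ‖inner ℂ f g‖ₑ ≤ sobolevNorm (-s) f * sobolevNorm s g := by
  set w : ℝ → ℝ := fun ζ => 1 + (2 * Real.pi * ζ) ^ 2
  have hw (ζ : ℝ) : 0 < w ζ := by positivity
  have hweight (r : ℝ) (h : L2) : ∫⁻ ζ, (ENNReal.ofReal (w ζ ^ (r / 2)) * ‖(𝓕 h : L2) ζ‖ₑ) ^ 2 =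
      ∫⁻ ζ, ENNReal.ofReal (w ζ ^ r) * ENNReal.ofReal (‖(𝓕 h : L2) ζ‖ ^ 2) := by
    congr with ζ
    rw [mul_pow, ← ENNReal.ofReal_pow (Real.rpow_pos_of_pos (hw ζ) _).le, ← Real.rpow_mul_natCast
      (hw ζ).le, Nat.cast_ofNat, div_mul_cancel₀ r two_ne_zero, ← ofReal_norm,
      ENNReal.ofReal_pow (norm_nonneg _)]
  have hmeas (r : ℝ) (h : L2) : AEMeasurable fun ζ =>
      ENNReal.ofReal (w ζ ^ (r / 2)) * ‖(𝓕 h : L2) ζ‖ₑ := by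
    have hwr : Measurable fun ζ => ENNReal.ofReal (w ζ ^ (r / 2)) := by fun_prop
    exact hwr.aemeasurable.mul (Lp.aestronglyMeasurable _).enorm
  have hholder := ENNReal.lintegral_mul_le_Lp_mul_Lq volume Real.HolderConjugate.two_two
    (hmeas (-s) f) (hmeas s g)
  simp only [ENNReal.rpow_two, hweight, Pi.mul_apply] at hholder
  rw [← Lp.inner_fourier_eq, L2.inner_def]
  refine (enorm_integral_le_lintegral_enorm _).trans ((lintegral_mono fun ζ => ?_).trans hholder)
  have hcancel : ENNReal.ofReal (w ζ ^ (-s / 2)) * ENNReal.ofReal (w ζ ^ (s / 2)) = 1 := by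
    rw [← ENNReal.ofReal_mul (Real.rpow_pos_of_pos (hw ζ) _).le, ← Real.rpow_add (hw ζ), neg_div,
      neg_add_cancel, Real.rpow_zero, ENNReal.ofReal_one]
  rw [mul_mul_mul_comm, hcancel, one_mul, RCLike.inner_apply', enorm_mul, RCLike.enorm_conj]

section FrequencySupport

variable {φ ψ : 𝓢(ℝ, ℂ)}

theorem norm_schrodingerSymbol_sub_one_le (r ζ : ℝ) :
    ‖schrodingerSymbol r ζ - 1‖ ≤ |r| * (2 * Real.pi * ζ) ^ 2 := by
  rw [schrodingerSymbol_eq_exp_mul_I, mul_comm _ Complex.I]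
  refine Real.norm_exp_I_mul_ofReal_sub_one_le.trans_eq ?_
  rw [norm_neg, Real.norm_eq_abs, abs_mul, abs_of_nonneg (sq_nonneg (2 * Real.pi * ζ))]

theorem coeFn_fourier_toLp (φ : 𝓢(ℝ, ℂ)) :
    (𝓕 (φ.toLp 2 : L2) : L2) =ᵐ[volume] (𝓕 φ : 𝓢(ℝ, ℂ)) := by
  rw [SchwartzMap.toLp_fourier_eq]
  exact SchwartzMap.coeFn_toLp (𝓕 φ) 2 volume

theorem norm_schrodinger_sub_le {R : ℝ} (hψ : ∀ ζ, R < |ζ| → (𝓕 ψ : 𝓢(ℝ, ℂ)) ζ = 0) (r : ℝ) :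
    ‖schrodinger r (ψ.toLp 2) - ψ.toLp 2 volume‖ ≤
      |r| * (2 * Real.pi * R) ^ 2 * ‖ψ.toLp 2 volume‖ := by
  have hsub : (𝓕 (schrodinger r (ψ.toLp 2) - ψ.toLp 2 volume) : L2) =
      𝓕 (schrodinger r (ψ.toLp 2)) - 𝓕 (ψ.toLp 2 volume) :=
    (Lp.fourierTransformₗᵢ ℝ ℂ).map_sub _ _
  rw [← Lp.norm_fourier_eq, ← Lp.norm_fourier_eq (ψ.toLp 2 volume), hsub]
  refine Lp.norm_le_mul_norm_of_ae_le_mul ?_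
  filter_upwards [Lp.coeFn_sub (𝓕 (schrodinger r (ψ.toLp 2 volume))) (𝓕 (ψ.toLp 2 volume)),
    fourier_schrodinger r (ψ.toLp 2), coeFn_fourier_toLp ψ] with ζ hdiff hsymbol hfourier
  rw [hdiff, Pi.sub_apply, hsymbol, ← sub_one_mul, norm_mul, hfourier]
  by_cases hζ : R < |ζ|
  · simp only [hψ ζ hζ, norm_zero, mul_zero, le_refl]
  · have hsq : (2 * Real.pi * ζ) ^ 2 ≤ (2 * Real.pi * R) ^ 2 := by
      rw [mul_pow, mul_pow _ R, ← sq_abs ζ]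
      gcongr
      exact not_lt.1 hζ
    grw [norm_schrodingerSymbol_sub_one_le, hsq]

theorem inner_schrodinger_eq_zero
    (h : ∀ ζ, (𝓕 ψ : 𝓢(ℝ, ℂ)) ζ = 0 ∨ (𝓕 φ : 𝓢(ℝ, ℂ)) ζ = 0) (r : ℝ) :
    inner ℂ (schrodinger r (ψ.toLp 2)) (φ.toLp 2) = 0 := by
  rw [← Lp.inner_fourier_eq, L2.inner_def]
  refine integral_eq_zero_of_ae ?_
  filter_upwards [fourier_schrodinger r (ψ.toLp 2), coeFn_fourier_toLp ψ,
    coeFn_fourier_toLp φ] with ζ hsymbol hψ hφ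
  rw [hsymbol, hψ, hφ]
  rcases h ζ with hζ | hζ <;> simp [hζ]

variable {J : Set ℝ} {c : ℝ} (hJ : MeasurableSet J)
  (hφ : ∀ ζ, ‖(𝓕 φ : 𝓢(ℝ, ℂ)) ζ‖ ≤ J.indicator (fun _ => c) ζ)

include hJ hφ

theorem integral_norm_fourier_le (hJ' : volume J ≠ ⊤) :
    ∫ ζ, ‖(𝓕 φ : 𝓢(ℝ, ℂ)) ζ‖ ≤ volume.real J * c := by
  rw [← smul_eq_mul, ← setIntegral_const, ← integral_indicator hJ]
  exact integral_mono (𝓕 φ : 𝓢(ℝ, ℂ)).integrable.norm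
    ((integrable_indicator_iff hJ).2 (integrableOn_const hJ')) hφ

theorem lintegral_mul_fourier_sq_le {g : ℝ → ℝ≥0∞} {b : ℝ≥0∞} (hg : ∀ ζ ∈ J, g ζ ≤ b) :
    ∫⁻ ζ, g ζ * ‖(𝓕 φ : 𝓢(ℝ, ℂ)) ζ‖ₑ ^ 2 ≤ b * ENNReal.ofReal c ^ 2 * volume J := by
  rw [← setLIntegral_const, ← lintegral_indicator hJ]
  refine lintegral_mono fun ζ => ?_
  have hζ := hφ ζ
  by_cases h : ζ ∈ J
  · rw [indicator_of_mem h] at hζ ⊢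
    rw [← ofReal_norm]
    gcongr
    exact hg ζ h
  · rw [indicator_of_notMem h] at hζ ⊢
    simp [norm_le_zero_iff.1 hζ]

theorem enorm_toLp_sq_le : ‖(φ.toLp 2 : L2)‖ₑ ^ 2 ≤ ENNReal.ofReal c ^ 2 * volume J := by
  have h := lintegral_mul_fourier_sq_le hJ hφ (g := fun _ => 1) (b := 1) fun _ _ => le_rfl
  simp only [one_mul] at h
  rwa [enorm_toLp_sq, ← lintegral_enorm_fourier_sq]

theorem sobolevNorm_toLp_le {s b : ℝ} (hb : ∀ ζ ∈ J, (1 + (2 * Real.pi * ζ) ^ 2) ^ s ≤ b) :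
    sobolevNorm s (φ.toLp 2) ≤
      (ENNReal.ofReal b * ENNReal.ofReal c ^ 2 * volume J) ^ (1 / 2 : ℝ) := by
  refine ENNReal.rpow_le_rpow (le_of_eq_of_le ?_ (lintegral_mul_fourier_sq_le hJ hφ fun ζ hζ =>
    ENNReal.ofReal_le_ofReal (hb ζ hζ))) (by norm_num)
  refine lintegral_congr_ae ?_
  filter_upwards [coeFn_fourier_toLp φ] with ζ hζ
  rw [hζ, ENNReal.ofReal_pow (norm_nonneg _), ofReal_norm]

end FrequencySupport

/-- The free evolution of `φ` disperses at the rate `M |σ|^(-p)`. -/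
def HasDecay (φ : 𝓢(ℝ, ℂ)) (M p : ℝ) : Prop :=
  ∀ σ : ℝ, σ ≠ 0 → ∀ x, ‖freeEvolution σ φ x‖ ≤ M * |σ| ^ (-p)

theorem hasDecay_interpolation {φ : 𝓢(ℝ, ℂ)} {A B k : ℝ} (hk₀ : 0 ≤ k) (hk₁ : k ≤ 1)
    (hA : ∫ ζ, ‖(𝓕 φ : 𝓢(ℝ, ℂ)) ζ‖ ≤ A) (hB : ∫ x, ‖φ x‖ ≤ B) :
    HasDecay φ (A ^ k * B ^ (1 - k)) ((1 - k) / 2) := by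
  intro σ hσ x
  have hA₀ : 0 ≤ A := (integral_nonneg fun _ => norm_nonneg _).trans hA
  have hB₀ : 0 ≤ B := (integral_nonneg fun _ => norm_nonneg _).trans hB
  have hfourier := (norm_freeEvolution_le_integral_fourier σ φ x).trans hA
  have hdispersive : ‖freeEvolution σ φ x‖ ≤ |σ| ^ (-(1 / 2) : ℝ) * B := by
    grw [norm_freeEvolution_le_rpow hσ φ x, hB]
  have hexp : (|σ| ^ (-(1 / 2) : ℝ)) ^ (1 - k) = |σ| ^ (-((1 - k) / 2)) := by
    rw [← Real.rpow_mul (abs_nonneg σ)]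
    congr 1
    ring
  calc ‖freeEvolution σ φ x‖ = ‖freeEvolution σ φ x‖ ^ k * ‖freeEvolution σ φ x‖ ^ (1 - k) := by
        rw [← Real.rpow_add_of_nonneg (norm_nonneg _) hk₀ (by linarith), add_sub_cancel,
          Real.rpow_one]
    _ ≤ A ^ k * (|σ| ^ (-(1 / 2) : ℝ) * B) ^ (1 - k) := by gcongr
    _ = A ^ k * B ^ (1 - k) * |σ| ^ (-((1 - k) / 2)) := by
        rw [Real.mul_rpow (by positivity) hB₀, hexp]
        ring

section RealFourier

variable {φ : 𝓢(ℝ, ℂ)} {f : ℝ → ℝ}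

theorem exists_hasRealFourier (hf : ContDiff ℝ (⊤ : ℕ∞) f) (hs : HasCompactSupport f) :
    ∃ φ, HasRealFourier φ f := by
  have hs' : HasCompactSupport fun ζ => (f ζ : ℂ) :=
    hs.comp_left (g := fun x : ℝ => (x : ℂ)) Complex.ofReal_zero
  have hf' : ContDiff ℝ (⊤ : ℕ∞) fun ζ => (f ζ : ℂ) := Complex.ofRealCLM.contDiff.comp hf
  refine ⟨𝓕⁻ (hs'.toSchwartzMap hf'), fun ζ => ?_⟩
  rw [FourierTransform.fourier_fourierInv_eq]
  rfl

theorem IsPlateau.norm_fourier_le {c : ℝ} {I J : Set ℝ} (hf : IsPlateau c I J f)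
    (hφ : HasRealFourier φ f) (ζ : ℝ) :
    ‖(𝓕 φ : 𝓢(ℝ, ℂ)) ζ‖ ≤ J.indicator (fun _ => c) ζ := by
  rw [hφ ζ, Complex.norm_real, Real.norm_of_nonneg (hf.nonneg ζ)]
  by_cases h : ζ ∈ J
  · rw [indicator_of_mem h]
    exact hf.le ζ
  · rw [indicator_of_notMem h]
    exact (not_ne_iff.1 (mt (hf.mem_of_ne_zero ζ) h)).le

theorem HasRealFourier.integral_norm_comp_div {X : 𝓢(ℝ, ℂ)} {N l : ℝ} (hN : 0 < N) (hl : 0 ≤ l)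
    (hX : HasRealFourier X f) (hφ : HasRealFourier φ fun ζ => l * f (ζ / N)) :
    ∫ x, ‖φ x‖ = l * ∫ x, ‖X x‖ := by
  have hscale (x : ℝ) : φ x = ((l * N : ℝ) : ℂ) * X (N * x) := by
    have hφx := schwartz_fourierInv_eq_integral (𝓕 φ) x
    have hXx := schwartz_fourierInv_eq_integral (𝓕 X) (N * x)
    have hsubst := Measure.integral_comp_div (fun ζ =>
      Complex.exp (((2 * Real.pi * (N * x * ζ) : ℝ) : ℂ) * Complex.I) * (𝓕 X : 𝓢(ℝ, ℂ)) ζ) N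
    rw [FourierTransform.fourierInv_fourier_eq] at hφx hXx
    rw [← hXx, abs_of_pos hN, Complex.real_smul] at hsubst
    rw [Complex.ofReal_mul, mul_assoc, ← hsubst, hφx, ← integral_const_mul]
    congr with ζ
    have hphase : N * x * (ζ / N) = x * ζ := by field_simp
    simp only [hφ ζ, hX (ζ / N), hphase, Complex.ofReal_mul]
    ring
  simp_rw [hscale, norm_mul, Complex.norm_real, Real.norm_of_nonneg (mul_nonneg hl hN.le)]
  rw [integral_const_mul, Measure.integral_comp_mul_left (fun x => ‖X x‖) N,
    abs_of_pos (inv_pos.2 hN), smul_eq_mul]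
  field_simp

end RealFourier

theorem isPlateau_contDiffBump {c : ℝ} (f : ContDiffBump c) :
    IsPlateau 1 (Icc (c - f.rIn) (c + f.rIn)) (Icc (c - f.rOut) (c + f.rOut)) f where
  continuous := f.continuous
  nonneg _ := f.nonneg
  le _ := f.le_one
  eq_of_mem x hx := f.one_of_mem_closedBall (by rwa [Real.closedBall_eq_Icc])
  mem_of_ne_zero x hx := by
    rw [← Real.closedBall_eq_Icc, Metric.mem_closedBall]
    exact (not_le.1 (mt f.zero_of_le_dist hx)).le

theorem IsPlateau.mul_comp_div {a b c d : ℝ} {f : ℝ → ℝ} (hf : IsPlateau 1 (Icc a b) (Icc c d) f)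
    {N l : ℝ} (hN : 0 < N) (hl : 0 ≤ l) :
    IsPlateau l (Icc (a * N) (b * N)) (Icc (c * N) (d * N)) fun ζ => l * f (ζ / N) where
  continuous := by have := hf.continuous; fun_prop
  nonneg ζ := mul_nonneg hl (hf.nonneg _)
  le ζ := mul_le_of_le_one_right hl (hf.le _)
  eq_of_mem ζ hζ := by
    rw [hf.eq_of_mem _ ⟨(le_div_iff₀ hN).2 hζ.1, (div_le_iff₀ hN).2 hζ.2⟩, mul_one]
  mem_of_ne_zero ζ hζ := by
    have h := hf.mem_of_ne_zero _ (right_ne_zero_of_mul hζ)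
    exact ⟨(le_div_iff₀ hN).1 h.1, (div_le_iff₀ hN).1 h.2⟩

/-- The Fourier transform of the test function. -/
def lowBump : ContDiffBump (0 : ℝ) := ⟨1 / 2, 1, by norm_num, by norm_num⟩

/-- The profile of the Fourier transform of the initial datum: supported in `[1/2, 4]` and equal to
`1` on `[1, 7/2]`. -/
def highBump : ContDiffBump (9 / 4 : ℝ) := ⟨5 / 4, 7 / 4, by norm_num, by norm_num⟩

/-- `φ` is the initial datum of height `l` at the frequency scale `N`. -/
def IsDatum (N l : ℝ) (φ : 𝓢(ℝ, ℂ)) : Prop :=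
  HasRealFourier φ fun ζ => l * highBump (ζ / N)

/-- `ψ` is the function of frequencies of order one against which the solution is tested. -/
def IsTestFunction (ψ : 𝓢(ℝ, ℂ)) : Prop :=
  HasRealFourier ψ lowBump

theorem isPlateau_lowBump : IsPlateau 1 (Icc (-(1 / 2)) (1 / 2)) (Icc (-1) 1) lowBump := by
  convert isPlateau_contDiffBump lowBump using 2 <;> norm_num [lowBump]

theorem isPlateau_highBump {N l : ℝ} (hN : 0 < N) (hl : 0 ≤ l) :
    IsPlateau l (Icc N (7 / 2 * N)) (Icc (N / 2) (4 * N)) fun ζ => l * highBump (ζ / N) := by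
  convert (isPlateau_contDiffBump highBump).mul_comp_div hN hl using 2 <;>
    norm_num [highBump]
  ring

theorem exists_isTestFunction : ∃ ψ, IsTestFunction ψ :=
  exists_hasRealFourier lowBump.contDiff lowBump.hasCompactSupport

theorem exists_isDatum {N l : ℝ} (hN : 0 < N) (hl : 0 ≤ l) : ∃ φ, IsDatum N l φ :=
  exists_hasRealFourier
    (contDiff_const.mul (highBump.contDiff.comp (contDiff_id.div_const N)))
    ((isPlateau_highBump hN hl).hasCompactSupport isCompact_Icc)

section Datum

variable {N l : ℝ} {φ ψ : 𝓢(ℝ, ℂ)}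

theorem IsDatum.norm_fourier_le (hφ : IsDatum N l φ) (hN : 0 < N) (hl : 0 ≤ l) (ζ : ℝ) :
    ‖(𝓕 φ : 𝓢(ℝ, ℂ)) ζ‖ ≤ (Icc (N / 2) (4 * N)).indicator (fun _ => l) ζ :=
  (isPlateau_highBump hN hl).norm_fourier_le hφ ζ

theorem IsDatum.norm_toLp_le (hφ : IsDatum N l φ) (hN : 0 < N) (hl : 0 ≤ l) :
    ‖φ.toLp 2 volume‖ ≤ 2 * l * √N := by
  have hsq := enorm_toLp_sq_le measurableSet_Icc (hφ.norm_fourier_le hN hl)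
  rw [← ofReal_norm, ← ENNReal.ofReal_pow (norm_nonneg _), ← ENNReal.ofReal_pow hl,
    Real.volume_Icc, ← ENNReal.ofReal_mul (by positivity), ENNReal.ofReal_le_ofReal_iff
      (mul_nonneg (by positivity) (by linarith))] at hsq
  refine le_of_sq_le_sq ?_ (by positivity)
  rw [mul_pow, Real.sq_sqrt hN.le]
  nlinarith [sq_nonneg l]

theorem IsDatum.sobolevNorm_le (hφ : IsDatum N l φ) (hN : 0 < N) (hl : 0 ≤ l) {s : ℝ}
    (hs : s ≤ 0) : sobolevNorm s (φ.toLp 2) ≤ ENNReal.ofReal (2 * l * N ^ (s + 1 / 2)) := by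
  have hweight (ζ : ℝ) (hζ : ζ ∈ Icc (N / 2) (4 * N)) :
      (1 + (2 * Real.pi * ζ) ^ 2) ^ s ≤ (N ^ s) ^ 2 := by
    have hle : N ≤ 2 * Real.pi * ζ := by nlinarith [Real.pi_gt_three, hζ.1]
    rw [Real.rpow_pow_comm hN.le]
    exact Real.rpow_le_rpow_of_nonpos (by positivity) (by nlinarith) hs
  refine (sobolevNorm_toLp_le measurableSet_Icc (hφ.norm_fourier_le hN hl) hweight).trans ?_
  rw [Real.volume_Icc, ← ENNReal.ofReal_pow hl, ← ENNReal.ofReal_mul (by positivity),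
    ← ENNReal.ofReal_mul (by positivity), ENNReal.ofReal_rpow_of_nonneg
      (mul_nonneg (by positivity) (by linarith)) (by norm_num), ← Real.sqrt_eq_rpow]
  refine ENNReal.ofReal_le_ofReal (Real.sqrt_le_iff.2 ⟨by positivity, ?_⟩)
  rw [Real.rpow_add hN, ← Real.sqrt_eq_rpow, mul_pow, mul_pow, mul_pow, Real.sq_sqrt hN.le]
  nlinarith [mul_nonneg (sq_nonneg (N ^ s)) (sq_nonneg l)]

theorem IsDatum.integral_norm_fourier_le (hφ : IsDatum N l φ) (hN : 0 < N) (hl : 0 ≤ l) :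
    ∫ ζ, ‖(𝓕 φ : 𝓢(ℝ, ℂ)) ζ‖ ≤ 4 * l * N := by
  have h := GabitovTuritsyn.integral_norm_fourier_le measurableSet_Icc (hφ.norm_fourier_le hN hl)
    (by simp)
  rw [Real.volume_real_Icc_of_le (by linarith)] at h
  nlinarith [mul_nonneg hl hN.le]

theorem exists_hasDecay_datum :
    ∃ C : ℝ, 0 < C ∧ ∀ {N l k : ℝ} {φ : 𝓢(ℝ, ℂ)}, 0 < N → 0 ≤ l → 0 ≤ k → k ≤ 1 →
      IsDatum N l φ → HasDecay φ (C * l * N ^ k) ((1 - k) / 2) := by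
  obtain ⟨X, hX⟩ := exists_hasRealFourier highBump.contDiff highBump.hasCompactSupport
  set L := ∫ x, ‖X x‖
  have hL : 0 ≤ L := integral_nonneg fun _ => norm_nonneg _
  refine ⟨4 + L, by positivity, fun {N l k φ} hN hl hk₀ hk₁ hφ σ hσ x => ?_⟩
  have hfourier : ∫ ζ, ‖(𝓕 φ : 𝓢(ℝ, ℂ)) ζ‖ ≤ (4 + L) * l * N := by
    refine (hφ.integral_norm_fourier_le hN hl).trans ?_
    gcongr
    exact le_add_of_nonneg_right hL
  have hphysical : ∫ x, ‖φ x‖ ≤ (4 + L) * l := by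
    rw [hX.integral_norm_comp_div hN hl hφ]
    linarith
  have hD : 0 ≤ (4 + L) * l := by positivity
  have hM : ((4 + L) * l * N) ^ k * ((4 + L) * l) ^ (1 - k) = (4 + L) * l * N ^ k := by
    rw [Real.mul_rpow hD hN.le, mul_right_comm, ← Real.rpow_add_of_nonneg hD hk₀ (by linarith),
      add_sub_cancel, Real.rpow_one]
  rw [← hM]
  exact hasDecay_interpolation hk₀ hk₁ hfourier hphysical σ hσ x

theorem IsTestFunction.norm_fourier_le (hψ : IsTestFunction ψ) (ζ : ℝ) :
    ‖(𝓕 ψ : 𝓢(ℝ, ℂ)) ζ‖ ≤ (Icc (-1) 1).indicator (fun _ => 1) ζ :=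
  isPlateau_lowBump.norm_fourier_le hψ ζ

theorem IsTestFunction.integral_norm_fourier_le (hψ : IsTestFunction ψ) :
    ∫ ζ, ‖(𝓕 ψ : 𝓢(ℝ, ℂ)) ζ‖ ≤ 2 := by
  have h := GabitovTuritsyn.integral_norm_fourier_le measurableSet_Icc hψ.norm_fourier_le (by simp)
  rw [Real.volume_real_Icc_of_le (by norm_num)] at h
  linarith

theorem IsTestFunction.sobolevNorm_lt_top (hψ : IsTestFunction ψ) {s : ℝ} (hs : 0 ≤ s) :
    sobolevNorm s (ψ.toLp 2) < ⊤ := by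
  have hweight (ζ : ℝ) (hζ : ζ ∈ Icc (-1) 1) :
      (1 + (2 * Real.pi * ζ) ^ 2) ^ s ≤ (1 + (2 * Real.pi) ^ 2) ^ s := by
    rw [mul_pow _ ζ]
    gcongr
    exact mul_le_of_le_one_right (sq_nonneg _) ((sq_le_one_iff_abs_le_one ζ).2 (abs_le.2 hζ))
  refine (sobolevNorm_toLp_le measurableSet_Icc hψ.norm_fourier_le hweight).trans_lt ?_
  rw [Real.volume_Icc]
  finiteness

theorem IsTestFunction.norm_schrodinger_sub_le (hψ : IsTestFunction ψ) (r : ℝ) :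
    ‖schrodinger r (ψ.toLp 2) - ψ.toLp 2 volume‖ ≤
      |r| * (2 * Real.pi) ^ 2 * ‖ψ.toLp 2 volume‖ := by
  refine (GabitovTuritsyn.norm_schrodinger_sub_le (R := 1) (fun ζ hζ => ?_) r).trans_eq
    (by rw [mul_one])
  have hζ' : ζ ∉ Icc (-1) 1 := fun h => hζ.not_ge (abs_le.2 h)
  simpa only [indicator_of_notMem hζ', norm_le_zero_iff] using hψ.norm_fourier_le ζ

theorem IsTestFunction.inner_schrodinger_datum (hψ : IsTestFunction ψ) (hN : 2 < N) (hl : 0 ≤ l)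
    (hφ : IsDatum N l φ) (r : ℝ) : inner ℂ (schrodinger r (ψ.toLp 2)) (φ.toLp 2) = 0 := by
  refine inner_schrodinger_eq_zero (fun ζ => ?_) r
  by_cases hζ : ζ ∈ Icc (-1) 1
  · have hζ' : ζ ∉ Icc (N / 2) (4 * N) := fun h => by linarith [h.1, hζ.2]
    have h := hφ.norm_fourier_le (by linarith) hl ζ
    exact .inr (by simpa only [indicator_of_notMem hζ', norm_le_zero_iff] using h)
  · have h := hψ.norm_fourier_le ζ
    exact .inl (by simpa only [indicator_of_notMem hζ, norm_le_zero_iff] using h)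

end Datum

theorem intervalIntegrable_abs_rpow {p : ℝ} (hp : p < 1) (a b : ℝ) :
    IntervalIntegrable (fun σ : ℝ => |σ| ^ (-p)) volume a b := by
  refine intervalIntegrable_of_even (fun x => by rw [abs_neg]) fun x hx => ?_
  refine (intervalIntegral.intervalIntegrable_rpow' (r := -p) (by linarith)).congr fun y hy => ?_
  rw [uIoc_of_le hx.le] at hy
  simp only [abs_of_pos hy.1]

/-- The constant bounding the integral of `|σ|^(-p)` over the intervals `[α, 1 + α]`, `|α| ≤ 1`. -/
def decayConst (p : ℝ) : ℝ :=
  ∫ σ in (-1 : ℝ)..2, |σ| ^ (-p)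

theorem decayConst_pos {p : ℝ} (hp : p < 1) : 0 < decayConst p :=
  calc 0 < ∫ σ in (1 : ℝ)..2, |σ| ^ (-p) :=
        intervalIntegral.intervalIntegral_pos_of_pos_on (intervalIntegrable_abs_rpow hp 1 2)
          (fun σ hσ => Real.rpow_pos_of_pos (abs_pos.2 (by linarith [hσ.1])) _) (by norm_num)
    _ ≤ decayConst p := intervalIntegral.integral_mono_interval (by norm_num) (by norm_num) le_rfl
        (.of_forall fun σ => by positivity) (intervalIntegrable_abs_rpow hp _ _)

theorem lintegral_abs_add_rpow_le {p α : ℝ} (hp : p < 1) (hα : |α| ≤ 1) :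
    ∫⁻ σ in Icc (0 : ℝ) 1, ENNReal.ofReal (|σ + α| ^ (-p)) ≤ ENNReal.ofReal (decayConst p) := by
  obtain ⟨hα₁, hα₂⟩ := abs_le.1 hα
  have hint : IntegrableOn (fun σ : ℝ => |σ + α| ^ (-p)) (Icc 0 1) := by
    rw [← intervalIntegrable_iff_integrableOn_Icc_of_le zero_le_one]
    simpa only [sub_self, add_sub_cancel_right] using
      (intervalIntegrable_abs_rpow hp α (1 + α)).comp_add_right α
  rw [← ofReal_integral_eq_lintegral_ofReal hint (.of_forall fun σ => by positivity),
    integral_Icc_eq_integral_Ioc, ← intervalIntegral.integral_of_le zero_le_one,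
    intervalIntegral.integral_comp_add_right (fun σ => |σ| ^ (-p)), zero_add]
  exact ENNReal.ofReal_le_ofReal (intervalIntegral.integral_mono_interval hα₁ (by linarith)
    (by linarith) (.of_forall fun σ => by positivity) (intervalIntegrable_abs_rpow hp _ _))

theorem ae_restrict_add_ne_zero (s : Set ℝ) (α : ℝ) :
    ∀ᵐ σ ∂(volume.restrict s), σ + α ≠ 0 := by
  refine ae_restrict_of_ae ((Measure.ae_ne volume (-α)).mono fun σ hσ h => ?_)
  exact hσ (eq_neg_of_add_eq_zero_left h)

theorem norm_cube_toLp_le {φ : 𝓢(ℝ, ℂ)} {B : ℝ} (hB : ∀ x, ‖φ x‖ ≤ B) :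
    ‖cube (φ.toLp 2)‖ ≤ B ^ 2 * ‖φ.toLp 2 volume‖ := by
  refine Lp.norm_le_mul_norm_of_ae_le_mul ?_
  filter_upwards [coeFn_cube_toLp φ, SchwartzMap.coeFn_toLp φ 2 volume] with x hcube hφ
  rw [hcube, hφ, norm_cubeFun, pow_succ]
  gcongr
  exact hB x

theorem pow_three_le {h D : ℝ} (hh : 0 ≤ h) (hD : 0 < D) :
    h ^ 3 ≤ D * h ^ 2 + D⁻¹ ^ 3 * h ^ 6 := by
  rcases le_total h D with hle | hle
  · have hsmall : h ^ 3 ≤ D * h ^ 2 := by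
      rw [pow_succ' h 2]
      gcongr
    exact hsmall.trans (le_add_of_nonneg_right (by positivity))
  · have hone : 1 ≤ D⁻¹ * h := by rwa [inv_mul_eq_div, one_le_div hD]
    have hlarge : h ^ 3 ≤ D⁻¹ ^ 3 * h ^ 6 := by
      calc h ^ 3 ≤ (D⁻¹ * h) ^ 3 * h ^ 3 := le_mul_of_one_le_left (by positivity) (one_le_pow₀ hone)
        _ = D⁻¹ ^ 3 * h ^ 6 := by ring
    exact hlarge.trans (le_add_of_nonneg_left (by positivity))

theorem norm_cubeFun_sub_le_of_le {z w : ℂ} {B D : ℝ} (hw : ‖w‖ ≤ B) (hD : 0 < D) :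
    ‖cubeFun z - cubeFun w‖ ≤ 9 / 2 * B * (‖w‖ * ‖z - w‖) +
      (3 * D * ‖z - w‖ ^ 2 + 3 * D⁻¹ ^ 3 * ‖z - w‖ ^ 6) := by
  set h := ‖z - w‖
  have hz : ‖z‖ ≤ ‖w‖ + h := norm_le_norm_add_norm_sub' z w
  have hzsq : ‖z‖ ^ 2 ≤ 2 * ‖w‖ ^ 2 + 2 * h ^ 2 := by
    grw [hz]
    linarith [two_mul_le_add_sq ‖w‖ h]
  have hwsq : ‖w‖ ^ 2 * h ≤ B * (‖w‖ * h) := by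
    rw [sq, mul_assoc]
    gcongr
  calc ‖cubeFun z - cubeFun w‖ ≤ 3 / 2 * (‖z‖ ^ 2 + ‖w‖ ^ 2) * h := norm_cubeFun_sub_le z w
    _ ≤ 3 / 2 * (2 * ‖w‖ ^ 2 + 2 * h ^ 2 + ‖w‖ ^ 2) * h := by gcongr
    _ = 9 / 2 * (‖w‖ ^ 2 * h) + 3 * h ^ 3 := by ring
    _ ≤ _ := by linarith [pow_three_le (norm_nonneg (z - w)) hD]

theorem lintegral_enorm_mul_le (f g : L2) : ∫⁻ x, ‖f x‖ₑ * ‖g x‖ₑ ≤ ‖f‖ₑ * ‖g‖ₑ := by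
  have hholder := ENNReal.lintegral_mul_le_Lp_mul_Lq volume Real.HolderConjugate.two_two
    (Lp.aestronglyMeasurable f).enorm (Lp.aestronglyMeasurable g).enorm
  have hsqrt (a : ℝ≥0∞) : (a ^ 2) ^ (1 / 2 : ℝ) = a := by
    rw [← ENNReal.rpow_two, ← ENNReal.rpow_mul, mul_one_div_cancel two_ne_zero, ENNReal.rpow_one]
  simpa only [Pi.mul_apply, ENNReal.rpow_two, ← enorm_sq_eq_lintegral, hsqrt] using hholder

theorem ofReal_mul_add_eq {G b c d x y z : ℝ} (hG : 0 ≤ G) (hb : 0 ≤ b) (hc : 0 ≤ c) (hd : 0 ≤ d)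
    (hx : 0 ≤ x) (hy : 0 ≤ y) (hz : 0 ≤ z) :
    ENNReal.ofReal (G * (b * x + (c * y + d * z))) = ENNReal.ofReal G *
      (ENNReal.ofReal b * ENNReal.ofReal x +
        (ENNReal.ofReal c * ENNReal.ofReal y + ENNReal.ofReal d * ENNReal.ofReal z)) := by
  rw [ENNReal.ofReal_mul hG, ENNReal.ofReal_add (by positivity) (by positivity),
    ENNReal.ofReal_add (by positivity) (by positivity), ENNReal.ofReal_mul hb,
    ENNReal.ofReal_mul hc, ENNReal.ofReal_mul hd]

section InnerCube

variable {Ψ Φ : 𝓢(ℝ, ℂ)} {f : L2} {G B D : ℝ}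

theorem ae_enorm_inner_cube_sub_le (hf : HasCube f) (hG : ∀ x, ‖Ψ x‖ ≤ G) (hB : ∀ x, ‖Φ x‖ ≤ B)
    (hD : 0 < D) :
    ∀ᵐ x, ‖inner ℂ ((Ψ.toLp 2 : L2) x) ((cube f - cube (Φ.toLp 2)) x)‖ₑ ≤ ENNReal.ofReal G *
      (ENNReal.ofReal (9 / 2 * B) * (‖Φ.toLp 2 volume x‖ₑ * ‖(f - Φ.toLp 2 volume) x‖ₑ) +
        (ENNReal.ofReal (3 * D) * ‖(f - Φ.toLp 2 volume) x‖ₑ ^ 2 +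
          ENNReal.ofReal (3 * D⁻¹ ^ 3) * ‖(f - Φ.toLp 2 volume) x‖ₑ ^ 6)) := by
  filter_upwards [Lp.coeFn_sub (cube f) (cube (Φ.toLp 2)), coeFn_cube hf, coeFn_cube_toLp Φ,
    SchwartzMap.coeFn_toLp Φ 2 volume, SchwartzMap.coeFn_toLp Ψ 2 volume,
    Lp.coeFn_sub f (Φ.toLp 2)] with x hcube hcubef hcubeΦ hΦ hΨ hsub
  have hB₀ : 0 ≤ B := (norm_nonneg _).trans (hB x)
  have hG₀ : 0 ≤ G := (norm_nonneg _).trans (hG x)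
  rw [hcube, Pi.sub_apply, hcubef, hcubeΦ, hΨ, hsub, Pi.sub_apply, hΦ]
  simp only [← ofReal_norm, ← ENNReal.ofReal_pow (norm_nonneg _),
    ← ENNReal.ofReal_mul (norm_nonneg (Φ x))]
  rw [← ofReal_mul_add_eq hG₀ (by positivity) (by positivity) (by positivity) (by positivity)
    (by positivity) (by positivity)]
  grw [norm_inner_le_norm, hG x, norm_cubeFun_sub_le_of_le (hB x) hD]

theorem enorm_inner_cube_sub_le (hf : HasCube f) (hG : ∀ x, ‖Ψ x‖ ≤ G) (hB : ∀ x, ‖Φ x‖ ≤ B)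
    (hD : 0 < D) :
    ‖inner ℂ (Ψ.toLp 2) (cube f - cube (Φ.toLp 2))‖ₑ ≤ ENNReal.ofReal G *
      (ENNReal.ofReal (9 / 2 * B) * (‖Φ.toLp 2 volume‖ₑ * ‖f - Φ.toLp 2 volume‖ₑ) +
        (ENNReal.ofReal (3 * D) * ‖f - Φ.toLp 2 volume‖ₑ ^ 2 +
          ENNReal.ofReal (3 * D⁻¹ ^ 3) * sixthPower (f - Φ.toLp 2 volume))) := by
  have : AEMeasurable (fun x => ‖(f - Φ.toLp 2 volume) x‖ₑ) volume :=
    (Lp.aestronglyMeasurable _).enorm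
  have : AEMeasurable (fun x => ‖Φ.toLp 2 volume x‖ₑ) volume :=
    (Lp.aestronglyMeasurable _).enorm
  rw [L2.inner_def]
  grw [enorm_integral_le_lintegral_enorm,
    lintegral_mono_ae (ae_enorm_inner_cube_sub_le hf hG hB hD)]
  rw [lintegral_const_mul' _ _ ENNReal.ofReal_ne_top, lintegral_add_left' (by fun_prop),
    lintegral_add_left' (by fun_prop), lintegral_const_mul' _ _ ENNReal.ofReal_ne_top,
    lintegral_const_mul' _ _ ENNReal.ofReal_ne_top, lintegral_const_mul' _ _ ENNReal.ofReal_ne_top,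
    ← enorm_sq_eq_lintegral, ← sixthPower]
  gcongr
  exact lintegral_enorm_mul_le _ _

end InnerCube

theorem norm_intervalIntegral_le_of_lintegral_enorm_le {E : Type*} [NormedAddCommGroup E]
    [NormedSpace ℝ E] {f : ℝ → E} {a b C : ℝ} (hab : a ≤ b) (hC : 0 ≤ C)
    (hf : ∫⁻ σ in Icc a b, ‖f σ‖ₑ ≤ ENNReal.ofReal C) : ‖∫ σ in a..b, f σ‖ ≤ C := by
  rw [← ENNReal.ofReal_le_ofReal_iff hC, intervalIntegral.integral_of_le hab,
    ← integral_Icc_eq_integral_Ioc, ofReal_norm]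
  exact (enorm_integral_le_lintegral_enorm f).trans hf

theorem enorm_schrodinger (t : ℝ) (f : L2) : ‖schrodinger t f‖ₑ = ‖f‖ₑ := by
  rw [← ofReal_norm, norm_schrodinger, ofReal_norm]

theorem enorm_le_ofReal {f : L2} {A : ℝ} (hf : ‖f‖ ≤ A) : ‖f‖ₑ ≤ ENNReal.ofReal A := by
  rw [← ofReal_norm]
  exact ENNReal.ofReal_le_ofReal hf

theorem inner_interactionField (γ τ : ℝ) (g f : L2) :
    inner ℂ g (interactionField γ τ f) = ∫ σ in (0 : ℝ)..1,
      inner ℂ (schrodinger (σ + γ * τ) g) (cube (schrodinger (σ + γ * τ) f)) := by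
  rw [interactionField, inner_schrodinger_right, neg_neg, inner_nonlinearity]
  simp only [schrodinger_schrodinger]

theorem intervalIntegrable_inner_cube_add (g f : L2) (α : ℝ) :
    IntervalIntegrable (fun σ => inner ℂ (schrodinger (σ + α) g) (cube (schrodinger (σ + α) f)))
      volume 0 1 := by
  have hint := intervalIntegrable_nonlinearityIntegrand (schrodinger α f)
  refine IntervalIntegrable.congr (fun σ _ => ?_)
    ⟨(innerSL ℂ (schrodinger α g)).integrable_comp hint.1,
      (innerSL ℂ (schrodinger α g)).integrable_comp hint.2⟩
  simp only [innerSL_apply_apply, nonlinearityIntegrand]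
  rw [inner_schrodinger_right, neg_neg, schrodinger_schrodinger, schrodinger_schrodinger]

theorem intervalIntegrable_inner_cube (g f : L2) :
    IntervalIntegrable (fun σ => inner ℂ (schrodinger σ g) (cube (schrodinger σ f)))
      volume (-1) 2 := by
  have hunit (α : ℝ) := (intervalIntegrable_inner_cube_add g f α).comp_sub_right α
  have hleft := hunit (-1)
  have hmiddle := hunit 0
  have hright := hunit 1
  norm_num at hleft hmiddle hright
  exact (hleft.trans hmiddle).trans hright

theorem lintegral_sixthPower_add_le (f : L2) (α : ℝ) :
    ∫⁻ σ in Icc (0 : ℝ) 1, sixthPower (schrodinger (σ + α) f) ≤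
      ENNReal.ofReal strichartzConst * ‖f‖ₑ ^ 6 := by
  simpa only [schrodinger_schrodinger, enorm_schrodinger] using
    lintegral_sixthPower_le (schrodinger α f)

theorem norm_intervalIntegral_comp_add_sub_le {q : ℝ → ℂ} {C α : ℝ} (hq : ∀ σ, ‖q σ‖ ≤ C)
    (hint : IntervalIntegrable q volume (-1) 2) (hα : |α| ≤ 1) :
    ‖(∫ σ in (0 : ℝ)..1, q (σ + α)) - ∫ σ in (0 : ℝ)..1, q σ‖ ≤ 2 * |α| * C := by
  obtain ⟨hα₁, hα₂⟩ := abs_le.1 hα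
  have hsub {a b : ℝ} (ha : a ∈ Icc (-1 : ℝ) 2) (hb : b ∈ Icc (-1 : ℝ) 2) :
      IntervalIntegrable q volume a b :=
    hint.mono_set ((uIcc_subset_Icc ha hb).trans Icc_subset_uIcc)
  have hzero : (0 : ℝ) ∈ Icc (-1 : ℝ) 2 := by norm_num
  have hone : (1 : ℝ) ∈ Icc (-1 : ℝ) 2 := by norm_num
  have hmem : α ∈ Icc (-1 : ℝ) 2 := ⟨hα₁, by linarith⟩
  have hmem_add : 1 + α ∈ Icc (-1 : ℝ) 2 := ⟨by linarith, by linarith⟩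
  rw [intervalIntegral.integral_comp_add_right q, zero_add,
    intervalIntegral.integral_interval_sub_interval_comm (hsub hmem hmem_add) (hsub hzero hone)
      (hsub hmem hzero)]
  have hleft := intervalIntegral.norm_integral_le_of_norm_le_const (a := α) (b := 0)
    fun σ _ => hq σ
  have hright := intervalIntegral.norm_integral_le_of_norm_le_const (a := 1 + α) (b := 1)
    fun σ _ => hq σ
  rw [zero_sub, abs_neg] at hleft
  rw [sub_add_cancel_left, abs_neg] at hright
  linarith [norm_sub_le (∫ σ in α..0, q σ) (∫ σ in 1 + α..1, q σ)]

theorem norm_inner_interactionField_sub_inner_nonlinearity_le {f g : L2} {C γ τ : ℝ}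
    (hC : ∀ σ, ‖inner ℂ (schrodinger σ g) (cube (schrodinger σ f))‖ ≤ C) (hτ : |γ * τ| ≤ 1) :
    ‖inner ℂ g (interactionField γ τ f) - inner ℂ g (nonlinearity f)‖ ≤ 2 * |γ * τ| * C := by
  rw [inner_interactionField, inner_nonlinearity]
  exact norm_intervalIntegral_comp_add_sub_le hC (intervalIntegrable_inner_cube g f) hτ

section InteractionField

variable {φ ψ : 𝓢(ℝ, ℂ)} {f : L2} {γ τ M p A G H Q : ℝ}

theorem HasDecay.norm_cube_schrodinger_le (hφ : HasDecay φ M p) {σ : ℝ} (hσ : σ ≠ 0) :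
    ‖cube (schrodinger σ (φ.toLp 2))‖ ≤ M ^ 2 * |σ| ^ (-(2 * p)) * ‖φ.toLp 2 volume‖ := by
  have hpow : |σ| ^ (-(2 * p)) = (|σ| ^ (-p)) ^ 2 := by
    rw [← Real.rpow_mul_natCast (abs_nonneg σ)]
    congr 1
    push_cast
    ring
  rw [← norm_schrodinger σ (φ.toLp 2 volume), schrodinger_toLp, hpow, ← mul_pow]
  exact norm_cube_toLp_le (hφ σ hσ)

theorem HasDecay.enorm_nonlinearityIntegrand_le (hφ : HasDecay φ M p)
    (hA : ‖φ.toLp 2 volume‖ ≤ A) {σ α : ℝ} (hσ : σ + α ≠ 0) :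
    ‖nonlinearityIntegrand (schrodinger α (φ.toLp 2)) σ‖ₑ ≤
      ENNReal.ofReal (M ^ 2 * A) * ENNReal.ofReal (|σ + α| ^ (-(2 * p))) := by
  have hA₀ : 0 ≤ A := (norm_nonneg _).trans hA
  rw [nonlinearityIntegrand, enorm_schrodinger, schrodinger_schrodinger,
    ← ENNReal.ofReal_mul (by positivity), mul_right_comm]
  refine enorm_le_ofReal ((hφ.norm_cube_schrodinger_le hσ).trans ?_)
  exact mul_le_mul_of_nonneg_left hA (by positivity)

theorem HasDecay.norm_interactionField_le (hφ : HasDecay φ M p) (hp : 2 * p < 1)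
    (hA : ‖φ.toLp 2 volume‖ ≤ A) (hτ : |γ * τ| ≤ 1) :
    ‖interactionField γ τ (φ.toLp 2)‖ ≤ M ^ 2 * A * decayConst (2 * p) := by
  have hMA : 0 ≤ M ^ 2 * A := mul_nonneg (sq_nonneg M) ((norm_nonneg _).trans hA)
  rw [interactionField, norm_schrodinger, nonlinearity]
  refine norm_intervalIntegral_le_of_lintegral_enorm_le zero_le_one
    (mul_nonneg hMA (decayConst_pos hp).le) ?_
  refine (lintegral_mono_ae ((ae_restrict_add_ne_zero _ (γ * τ)).mono fun σ hσ =>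
    hφ.enorm_nonlinearityIntegrand_le hA hσ)).trans ?_
  rw [lintegral_const_mul' _ _ ENNReal.ofReal_ne_top, ENNReal.ofReal_mul hMA]
  exact mul_le_mul_right (lintegral_abs_add_rpow_le hp hτ) _

theorem HasDecay.enorm_inner_cube_sub_le (hφ : HasDecay φ M p) (hM : 0 ≤ M)
    (hψ : ∀ σ x, ‖freeEvolution σ ψ x‖ ≤ G) (hA : ‖φ.toLp 2 volume‖ ≤ A) (hH : 0 < H)
    (hf : ‖f - φ.toLp 2 volume‖ ≤ H) {σ : ℝ} (hσ : σ ≠ 0) (hcube : HasCube (schrodinger σ f)) :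
    ‖inner ℂ (schrodinger σ (ψ.toLp 2)) (cube (schrodinger σ f)) -
        inner ℂ (schrodinger σ (ψ.toLp 2)) (cube (schrodinger σ (φ.toLp 2)))‖ₑ ≤
      ENNReal.ofReal G * (ENNReal.ofReal (9 / 2 * M * (A * H)) * ENNReal.ofReal (|σ| ^ (-p)) +
        (ENNReal.ofReal (3 * H ^ 3) + ENNReal.ofReal (3 * H⁻¹ ^ 3) *
          sixthPower (schrodinger σ (f - φ.toLp 2 volume)))) := by
  have hA₀ : 0 ≤ A := (norm_nonneg _).trans hA
  have hbound := GabitovTuritsyn.enorm_inner_cube_sub_le (Ψ := freeEvolution σ ψ)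
    (Φ := freeEvolution σ φ) hcube (hψ σ) (hφ σ hσ) hH
  simp only [← schrodinger_toLp] at hbound
  rw [← schrodinger_sub, inner_sub_right, enorm_schrodinger, enorm_schrodinger] at hbound
  have hlinear : ENNReal.ofReal (9 / 2 * (M * |σ| ^ (-p))) *
      (‖φ.toLp 2 volume‖ₑ * ‖f - φ.toLp 2 volume‖ₑ) ≤
        ENNReal.ofReal (9 / 2 * M * (A * H)) * ENNReal.ofReal (|σ| ^ (-p)) := by
    grw [enorm_le_ofReal hA, enorm_le_ofReal hf]
    rw [← ENNReal.ofReal_mul hA₀, ← ENNReal.ofReal_mul (by positivity),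
      ← ENNReal.ofReal_mul (by positivity)]
    exact (congrArg ENNReal.ofReal (by ring)).le
  have hquadratic : ENNReal.ofReal (3 * H) * ‖f - φ.toLp 2 volume‖ₑ ^ 2 ≤
      ENNReal.ofReal (3 * H ^ 3) := by
    grw [enorm_le_ofReal hf]
    rw [← ENNReal.ofReal_pow hH.le, ← ENNReal.ofReal_mul (by positivity)]
    exact (congrArg ENNReal.ofReal (by ring)).le
  grw [hlinear, hquadratic] at hbound
  exact hbound

theorem HasDecay.norm_inner_interactionField_sub_le (hφ : HasDecay φ M p) (hM : 0 ≤ M) (hp : p < 1)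
    (hψ : ∀ σ x, ‖freeEvolution σ ψ x‖ ≤ G) (hA : ‖φ.toLp 2 volume‖ ≤ A) (hH : 0 < H)
    (hf : ‖f - φ.toLp 2 volume‖ ≤ H) (hτ : |γ * τ| ≤ 1) :
    ‖inner ℂ (ψ.toLp 2) (interactionField γ τ f - interactionField γ τ (φ.toLp 2))‖ ≤
      G * (9 / 2 * M * (A * H) * decayConst p + 3 * (1 + strichartzConst) * H ^ 3) := by
  have hS := strichartzConst_pos
  have hK := decayConst_pos hp
  have hA₀ : 0 ≤ A := (norm_nonneg _).trans hA
  have hG₀ : 0 ≤ G := (norm_nonneg _).trans (hψ 0 0)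
  rw [inner_sub_right, inner_interactionField, inner_interactionField,
    ← intervalIntegral.integral_sub (intervalIntegrable_inner_cube_add _ _ _)
      (intervalIntegrable_inner_cube_add _ _ _)]
  refine norm_intervalIntegral_le_of_lintegral_enorm_le zero_le_one (by positivity) ?_
  have hcube := ae_hasCube (schrodinger (γ * τ) f)
  simp only [schrodinger_schrodinger] at hcube
  have hpointwise := (ae_restrict_add_ne_zero (Icc 0 1) (γ * τ)).and hcube |>.mono fun σ hσ =>
    hφ.enorm_inner_cube_sub_le hM hψ hA hH hf hσ.1 hσ.2
  grw [lintegral_mono_ae hpointwise, lintegral_const_mul' _ _ ENNReal.ofReal_ne_top,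
    lintegral_add_left (by fun_prop), lintegral_add_left (by fun_prop),
    lintegral_const_mul' _ _ ENNReal.ofReal_ne_top, lintegral_const_mul' _ _ ENNReal.ofReal_ne_top,
    setLIntegral_const, lintegral_abs_add_rpow_le hp hτ, lintegral_sixthPower_add_le,
    enorm_le_ofReal hf]
  rw [Real.volume_Icc, sub_zero, ENNReal.ofReal_one, mul_one, ← ENNReal.ofReal_pow hH.le,
    ← ENNReal.ofReal_mul hS.le, ← ENNReal.ofReal_mul (by positivity),
    ← ENNReal.ofReal_mul (by positivity), ← ENNReal.ofReal_add (by positivity) (by positivity),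
    ← ENNReal.ofReal_add (by positivity) (by positivity), ← ENNReal.ofReal_mul hG₀]
  refine (congrArg ENNReal.ofReal ?_).le
  field_simp

theorem norm_inner_cube_schrodinger_le (hQ : ∀ σ x, ‖freeEvolution σ φ x‖ ≤ Q) (g : L2) (σ : ℝ) :
    ‖inner ℂ (schrodinger σ g) (cube (schrodinger σ (φ.toLp 2)))‖ ≤
      ‖g‖ * (Q ^ 2 * ‖φ.toLp 2 volume‖) := by
  refine (norm_inner_le_norm _ _).trans ?_
  rw [norm_schrodinger, ← norm_schrodinger σ (φ.toLp 2 volume), schrodinger_toLp]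
  exact mul_le_mul_of_nonneg_left (norm_cube_toLp_le (hQ σ)) (norm_nonneg g)

end InteractionField

section Bootstrap

variable {γ T t A F : ℝ} {u₀ : L2} {u : ℝ → L2}

theorem norm_interactionField_interactionPicture_le (hu : IsSolution γ T u₀ u)
    (ht : t ∈ Ioo (-T) T) (hA₀ : 0 < A) (hA : ‖u₀‖ ≤ A) :
    ‖interactionField γ t (interactionPicture γ u t)‖ ≤ ‖interactionField γ t u₀‖ +
      nonlinearityConst * A ^ 2 * ‖interactionPicture γ u t - u₀‖ := by
  have hnorm : ‖interactionPicture γ u t‖ ≤ A := by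
    rwa [norm_interactionPicture, norm_eq_of_isSolution hu ht]
  have htriangle := norm_le_norm_add_norm_sub' (interactionField γ t (interactionPicture γ u t))
    (interactionField γ t u₀)
  grw [norm_interactionField_sub_le γ t hA₀ hnorm hA] at htriangle
  exact htriangle

theorem norm_interactionPicture_sub_le (hu : IsSolution γ T u₀ u) (ht₀ : 0 ≤ t) (ht : t < T)
    (hA₀ : 0 < A) (hA : ‖u₀‖ ≤ A) (hF : ∀ τ ∈ Icc 0 t, ‖interactionField γ τ u₀‖ ≤ F)
    (htA : t * (nonlinearityConst * A ^ 2) ≤ 1 / 2) {τ : ℝ} (hτ : τ ∈ Icc 0 t) :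
    ‖interactionPicture γ u τ - u₀‖ ≤ 2 * t * F := by
  have hC := nonlinearityConst_pos
  have hsub : Icc 0 t ⊆ Ioo (-T) T := fun x hx => ⟨by linarith [hx.1], hx.2.trans_lt ht⟩
  have hcont : ContinuousOn (fun x => ‖interactionPicture γ u x - u₀‖) (Icc 0 t) :=
    (((continuousOn_interactionPicture hu.continuousOn).mono hsub).sub continuousOn_const).norm
  obtain ⟨τ₀, hτ₀, hmax⟩ := isCompact_Icc.exists_isMaxOn (nonempty_Icc.2 ht₀) hcont
  set m := ‖interactionPicture γ u τ₀ - u₀‖ with hm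
  have hF₀ : 0 ≤ F := (norm_nonneg _).trans (hF τ₀ hτ₀)
  have hfield : ∀ x ∈ uIoc 0 τ₀, ‖interactionField γ x (interactionPicture γ u x)‖ ≤
      F + nonlinearityConst * A ^ 2 * m := by
    intro x hx
    rw [uIoc_of_le hτ₀.1] at hx
    have hxt : x ∈ Icc 0 t := ⟨hx.1.le, hx.2.trans hτ₀.2⟩
    have hxm : ‖interactionPicture γ u x - u₀‖ ≤ m := hmax hxt
    grw [norm_interactionField_interactionPicture_le hu (hsub hxt) hA₀ hA, hF x hxt, hxm]
  have hduhamel : m ≤ (F + nonlinearityConst * A ^ 2 * m) * τ₀ := by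
    have hintegral : m = ‖∫ x in (0 : ℝ)..τ₀, interactionField γ x (interactionPicture γ u x)‖ := by
      rw [hm, interactionPicture_eq_of_isSolution hu (hsub hτ₀), add_sub_cancel_left, norm_smul,
        Complex.norm_I, one_mul]
    have hbound := intervalIntegral.norm_integral_le_of_norm_le_const hfield
    rwa [sub_zero, abs_of_nonneg hτ₀.1, ← hintegral] at hbound
  have hself : m ≤ t * F + t * (nonlinearityConst * A ^ 2) * m := by
    grw [hτ₀.2] at hduhamel
    linarith
  grw [htA] at hself
  have hτm : ‖interactionPicture γ u τ - u₀‖ ≤ m := hmax hτ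
  linarith

end Bootstrap

theorem intervalIntegrable_interactionField_of_isSolution {γ T t : ℝ} {u₀ : L2} {u : ℝ → L2}
    (hu : IsSolution γ T u₀ u) (ht : t ∈ Ioo (-T) T) :
    IntervalIntegrable (fun τ => interactionField γ τ (interactionPicture γ u τ)) volume 0 t :=
  intervalIntegrable_interactionField (continuousOn_interactionPicture hu.continuousOn) ht

theorem inner_eq_of_isSolution {γ T t : ℝ} {u₀ : L2} {u : ℝ → L2} (hu : IsSolution γ T u₀ u)
    (ht : t ∈ Ioo (-T) T) (g : L2) :
    inner ℂ g (u t) = inner ℂ (schrodinger (-(γ * t)) g) u₀ + Complex.I * ∫ τ in (0 : ℝ)..t,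
      inner ℂ (schrodinger (-(γ * t)) g) (interactionField γ τ (interactionPicture γ u τ)) := by
  have hcomm := (innerSL ℂ (schrodinger (-(γ * t)) g)).intervalIntegral_comp_comm
    (intervalIntegrable_interactionField_of_isSolution hu ht)
  simp only [innerSL_apply_apply] at hcomm
  rw [← schrodinger_interactionPicture γ u t, inner_schrodinger_right,
    interactionPicture_eq_of_isSolution hu ht, inner_add_right, inner_smul_right, hcomm]

theorem mul_sub_le_norm_intervalIntegral {t E c : ℝ} {f : ℝ → ℂ} {z : ℂ} (ht : 0 ≤ t)
    (hf : IntervalIntegrable f volume 0 t) (hE : ∀ τ ∈ Icc 0 t, ‖f τ - z‖ ≤ E) (hc : c ≤ ‖z‖) :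
    t * (c - E) ≤ ‖∫ τ in (0 : ℝ)..t, f τ‖ := by
  have hconst : ∫ _ in (0 : ℝ)..t, z = t * z := by
    rw [intervalIntegral.integral_const, sub_zero, Complex.real_smul]
  have herror : ‖(∫ τ in (0 : ℝ)..t, f τ) - t * z‖ ≤ E * t := by
    rw [← hconst, ← intervalIntegral.integral_sub hf intervalIntegrable_const]
    have hbound := intervalIntegral.norm_integral_le_of_norm_le_const (a := 0) (b := t)
      (f := fun τ => f τ - z) (C := E) fun τ hτ => by
        rw [uIoc_of_le ht] at hτ
        exact hE τ ⟨hτ.1.le, hτ.2⟩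
    rwa [sub_zero, abs_of_nonneg ht] at hbound
  have hmain : t * c ≤ ‖(t : ℂ) * z‖ := by
    rw [norm_mul, Complex.norm_real, Real.norm_of_nonneg ht]
    gcongr
  linarith [norm_le_norm_add_norm_sub (∫ τ in (0 : ℝ)..t, f τ) ((t : ℂ) * z)]

theorem mul_sub_le_norm_inner_of_isSolution {γ T t E c : ℝ} {u₀ g : L2} {u : ℝ → L2} {z : ℂ}
    (hu : IsSolution γ T u₀ u) (ht₀ : 0 ≤ t) (ht : t < T)
    (hg : inner ℂ (schrodinger (-(γ * t)) g) u₀ = 0)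
    (hE : ∀ τ ∈ Icc 0 t, ‖inner ℂ (schrodinger (-(γ * t)) g)
      (interactionField γ τ (interactionPicture γ u τ)) - z‖ ≤ E) (hc : c ≤ ‖z‖) :
    t * (c - E) ≤ ‖inner ℂ g (u t)‖ := by
  have htT : t ∈ Ioo (-T) T := ⟨by linarith, ht⟩
  have hint := intervalIntegrable_interactionField_of_isSolution hu htT
  rw [inner_eq_of_isSolution hu htT, hg, zero_add, norm_mul, Complex.norm_I, one_mul]
  exact mul_sub_le_norm_intervalIntegral ht₀
    ⟨(innerSL ℂ (schrodinger (-(γ * t)) g)).integrable_comp hint.1,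
      (innerSL ℂ (schrodinger (-(γ * t)) g)).integrable_comp hint.2⟩ hE hc

theorem IsDatum.norm_freeEvolution_le {N l : ℝ} {φ : 𝓢(ℝ, ℂ)} (hφ : IsDatum N l φ)
    (hN : 0 < N) (hl : 0 ≤ l) (σ x : ℝ) :
    ‖freeEvolution σ φ x‖ ≤ 4 * l * N :=
  (norm_freeEvolution_le_integral_fourier σ φ x).trans (hφ.integral_norm_fourier_le hN hl)

theorem IsDatum.le_norm_inner_nonlinearity {N l : ℝ} {φ ψ : 𝓢(ℝ, ℂ)} (hφ : IsDatum N l φ)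
    (hψ : IsTestFunction ψ) (hN : 4 ≤ N) (hl : 0 < l) :
    l ^ 3 / (1024 * Real.pi ^ 2) ≤ ‖inner ℂ (ψ.toLp 2) (nonlinearity (φ.toLp 2))‖ :=
  (im_inner_nonlinearity_ge hN hl isPlateau_lowBump (isPlateau_highBump (by linarith) hl.le)
    hψ hφ).trans ((le_abs_self _).trans (Complex.abs_im_le_norm _))

theorem abs_mul_le_abs_mul (γ : ℝ) {τ t : ℝ} (hτ : τ ∈ Icc 0 t) : |γ * τ| ≤ |γ| * t := by
  rw [abs_mul, abs_of_nonneg hτ.1]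
  exact mul_le_mul_of_nonneg_left hτ.2 (abs_nonneg γ)

/-- The size of the interaction field of a datum of `L²` norm `A` whose free evolution decays at
rate `p` with constant `M`. -/
def fieldBound (M p A : ℝ) : ℝ :=
  M ^ 2 * A * decayConst (2 * p)

/-- The error made up to time `t` in replacing the tested interaction field of a solution by the
quartic form of its datum. The parameters `M`, `p`, `A` are those of `IsPerturbative`, `Q` bounds
the free evolution of the datum and `P` is the `L²` norm of the test function. -/
def quarticError (γ t M p A Q P : ℝ) : ℝ :=
  2 * (9 / 2 * M * (A * (2 * t * fieldBound M p A)) * decayConst p +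
      3 * (1 + strichartzConst) * (2 * t * fieldBound M p A) ^ 3) +
    |γ| * t * (2 * Real.pi) ^ 2 * P * fieldBound M p A + 2 * (|γ| * t) * (P * (Q ^ 2 * A))

/-- Up to time `t`, the solution `u` with datum `φ` stays close to the free evolution of `φ`:
the datum has `L²` norm at most `A`, its free evolution decays at rate `p` with constant `M`, and
`t` is short compared with the lifespan `A⁻²` of the contraction argument. -/
structure IsPerturbative (γ T t M p A : ℝ) (φ : 𝓢(ℝ, ℂ)) (u : ℝ → L2) : Prop where
  isSolution : IsSolution γ T (φ.toLp 2) u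
  time_pos : 0 < t
  time_lt : t < T
  abs_mul_time_le : |γ| * t ≤ 1
  hasDecay : HasDecay φ M p
  decay_pos : 0 < M
  two_mul_lt : 2 * p < 1
  mass_pos : 0 < A
  norm_le : ‖φ.toLp 2 volume‖ ≤ A
  time_mul_le : t * (nonlinearityConst * A ^ 2) ≤ 1 / 2

namespace IsPerturbative

variable {γ T t τ M p A Q N l : ℝ} {φ ψ : 𝓢(ℝ, ℂ)} {u : ℝ → L2}

theorem fieldBound_pos (h : IsPerturbative γ T t M p A φ u) : 0 < fieldBound M p A :=
  mul_pos (mul_pos (pow_pos h.decay_pos 2) h.mass_pos) (decayConst_pos h.two_mul_lt)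

theorem norm_interactionField_le (h : IsPerturbative γ T t M p A φ u) (hτ : τ ∈ Icc 0 t) :
    ‖interactionField γ τ (φ.toLp 2)‖ ≤ fieldBound M p A :=
  h.hasDecay.norm_interactionField_le h.two_mul_lt h.norm_le
    ((abs_mul_le_abs_mul γ hτ).trans h.abs_mul_time_le)

theorem norm_interactionPicture_sub_le (h : IsPerturbative γ T t M p A φ u)
    (hτ : τ ∈ Icc 0 t) :
    ‖interactionPicture γ u τ - φ.toLp 2 volume‖ ≤ 2 * t * fieldBound M p A :=
  GabitovTuritsyn.norm_interactionPicture_sub_le h.isSolution h.time_pos.le h.time_lt h.mass_pos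
    h.norm_le (fun _ => h.norm_interactionField_le) h.time_mul_le hτ

theorem norm_inner_interactionField_sub_le (h : IsPerturbative γ T t M p A φ u)
    (hψ : IsTestFunction ψ) (hτ : τ ∈ Icc 0 t) (r : ℝ) :
    ‖inner ℂ (schrodinger r (ψ.toLp 2)) (interactionField γ τ (interactionPicture γ u τ) -
        interactionField γ τ (φ.toLp 2))‖ ≤
      2 * (9 / 2 * M * (A * (2 * t * fieldBound M p A)) * decayConst p +
        3 * (1 + strichartzConst) * (2 * t * fieldBound M p A) ^ 3) := by
  rw [schrodinger_toLp]
  refine h.hasDecay.norm_inner_interactionField_sub_le h.decay_pos.le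
    (by linarith [h.two_mul_lt]) (fun σ x => ?_) h.norm_le
    (mul_pos (mul_pos two_pos h.time_pos) h.fieldBound_pos)
    (h.norm_interactionPicture_sub_le hτ) ((abs_mul_le_abs_mul γ hτ).trans h.abs_mul_time_le)
  refine (norm_freeEvolution_le_integral_fourier σ _ x).trans ?_
  simpa only [fourier_freeEvolution, norm_mul, norm_schrodingerSymbol, one_mul] using
    hψ.integral_norm_fourier_le

theorem norm_inner_schrodinger_sub_le (h : IsPerturbative γ T t M p A φ u)
    (hψ : IsTestFunction ψ) (hτ : τ ∈ Icc 0 t) :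
    ‖inner ℂ (schrodinger (-(γ * t)) (ψ.toLp 2) - ψ.toLp 2 volume)
        (interactionField γ τ (φ.toLp 2))‖ ≤
      |γ| * t * (2 * Real.pi) ^ 2 * ‖ψ.toLp 2 volume‖ * fieldBound M p A := by
  have htest := hψ.norm_schrodinger_sub_le (-(γ * t))
  rw [abs_neg, abs_mul, abs_of_pos h.time_pos] at htest
  exact (norm_inner_le_norm _ _).trans (mul_le_mul htest (h.norm_interactionField_le hτ)
    (norm_nonneg _) ((norm_nonneg _).trans htest))

theorem norm_inner_interactionField_sub_inner_nonlinearity_le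
    (h : IsPerturbative γ T t M p A φ u) (hQ : ∀ σ x, ‖freeEvolution σ φ x‖ ≤ Q)
    (hτ : τ ∈ Icc 0 t) :
    ‖inner ℂ (ψ.toLp 2) (interactionField γ τ (φ.toLp 2)) -
        inner ℂ (ψ.toLp 2) (nonlinearity (φ.toLp 2))‖ ≤
      2 * (|γ| * t) * (‖ψ.toLp 2 volume‖ * (Q ^ 2 * A)) := by
  have hmass := mul_le_mul_of_nonneg_left (mul_le_mul_of_nonneg_left h.norm_le (sq_nonneg Q))
    (norm_nonneg (ψ.toLp 2 volume))
  refine (GabitovTuritsyn.norm_inner_interactionField_sub_inner_nonlinearity_le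
    (fun σ => (norm_inner_cube_schrodinger_le hQ _ σ).trans hmass)
    ((abs_mul_le_abs_mul γ hτ).trans h.abs_mul_time_le)).trans ?_
  have := h.mass_pos
  gcongr
  exact abs_mul_le_abs_mul γ hτ

theorem norm_inner_sub_le_quarticError (h : IsPerturbative γ T t M p A φ u)
    (hψ : IsTestFunction ψ) (hQ : ∀ σ x, ‖freeEvolution σ φ x‖ ≤ Q) (hτ : τ ∈ Icc 0 t) :
    ‖inner ℂ (schrodinger (-(γ * t)) (ψ.toLp 2))
          (interactionField γ τ (interactionPicture γ u τ)) -
        inner ℂ (ψ.toLp 2) (nonlinearity (φ.toLp 2))‖ ≤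
      quarticError γ t M p A Q ‖ψ.toLp 2 volume‖ := by
  have hsplit (a b g g' : L2) (z : ℂ) :
      inner ℂ g a - z = inner ℂ g (a - b) + inner ℂ (g - g') b + (inner ℂ g' b - z) := by
    rw [inner_sub_left, inner_sub_right]
    ring
  rw [hsplit _ (interactionField γ τ (φ.toLp 2)) _ (ψ.toLp 2 volume)]
  exact norm_add₃_le.trans (add_le_add (add_le_add
    (h.norm_inner_interactionField_sub_le hψ hτ _) (h.norm_inner_schrodinger_sub_le hψ hτ))
    (h.norm_inner_interactionField_sub_inner_nonlinearity_le hQ hτ))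

theorem le_norm_inner (h : IsPerturbative γ T t M p A φ u) (hψ : IsTestFunction ψ)
    (hφ : IsDatum N l φ) (hN : 4 ≤ N) (hl : 0 < l) :
    t * (l ^ 3 / (1024 * Real.pi ^ 2) -
        quarticError γ t M p A (4 * l * N) ‖ψ.toLp 2 volume‖) ≤
      ‖inner ℂ (ψ.toLp 2) (u t)‖ :=
  mul_sub_le_norm_inner_of_isSolution h.isSolution h.time_pos.le h.time_lt
    (hψ.inner_schrodinger_datum (by linarith) hl.le hφ _)
    (fun _ => h.norm_inner_sub_le_quarticError hψ
      (hφ.norm_freeEvolution_le (by linarith) hl.le))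
    (hφ.le_norm_inner_nonlinearity hψ hN hl)

end IsPerturbative

/-- Amplitude `l` and time `t` for a datum at frequency `N` whose `H^s` norm is of order `n⁻¹`,
while `t * l ^ 3`, the size of its low-frequency output at time `t`, is at least `n`. The last three
fields make the errors smaller than the output by a factor `n⁻¹`. -/
structure IsInflationScale (s N n l t : ℝ) : Prop where
  four_le : 4 ≤ N
  one_le : 1 ≤ n
  amplitude_pos : 0 < l
  time_pos : 0 < t
  time_le : t ≤ n⁻¹
  mul_rpow_eq : l * N ^ (s + 1 / 2) = n⁻¹
  le_time_mul : n ≤ t * l ^ 3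
  balance : t * l ^ 2 * n ^ 4 * √N ^ 2 = 1
  time_mul_pow_le : t * n ^ 3 * √N ≤ 1
  time_mul_sqrt_pow_le : t * √N ^ 5 * n ≤ 1

theorem isInflationScale_rpow {s k N : ℝ} (hk₀ : 0 < k) (hk : k ≤ 1 / 2)
    (hks : 6 * k ≤ -s - 3 / 2) (hN : 4 ≤ N) :
    IsInflationScale s N (N ^ k) (N ^ (-s - 1 / 2 - k)) (N ^ (2 * s - 2 * k)) := by
  have hN₀ : 0 < N := by linarith
  have hN₁ : 1 ≤ N := by linarith
  have hmono {a b : ℝ} (hab : a ≤ b) : N ^ a ≤ N ^ b := Real.rpow_le_rpow_of_exponent_le hN₁ hab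
  have hone {a : ℝ} (ha : a ≤ 0) : N ^ a ≤ 1 := Real.rpow_le_one_of_one_le_of_nonpos hN₁ ha
  refine ⟨hN, Real.one_le_rpow hN₁ hk₀.le, by positivity, by positivity, ?_, ?_, ?_, ?_, ?_, ?_⟩ <;>
    simp only [Real.sqrt_eq_rpow, ← Real.rpow_mul_natCast hN₀.le, ← Real.rpow_neg hN₀.le,
      ← Real.rpow_add hN₀]
  · exact hmono (by linarith)
  · ring_nf
  · refine hmono ?_
    push_cast
    linarith
  · rw [← Real.rpow_zero N]
    congr 1
    push_cast
    ring
  · refine hone ?_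
    push_cast
    linarith
  · refine hone ?_
    push_cast
    linarith

theorem exists_isInflationScale {s : ℝ} (hs : s < -3 / 2) :
    ∃ k : ℝ, 0 < k ∧ k ≤ 1 ∧ ∀ N : ℝ, 4 ≤ N → ∃ l t, IsInflationScale s N (N ^ k) l t := by
  set k := min (1 / 2) ((-s - 3 / 2) / 6)
  have hk : k ≤ 1 / 2 := min_le_left _ _
  have hks : k ≤ (-s - 3 / 2) / 6 := min_le_right _ _
  have hk₀ : 0 < k := lt_min (by norm_num) (by linarith)
  exact ⟨k, hk₀, by linarith, fun N hN => ⟨_, _, isInflationScale_rpow hk₀ hk (by linarith) hN⟩⟩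

/-- The error of a datum at an inflation scale relative to its output is at most this constant
times `n⁻¹`. Here `C` and `p` describe the decay of the free evolution of the datum and `P` is the
`L²` norm of the test function. -/
def errorConst (γ C p P : ℝ) : ℝ :=
  2 * (36 * C ^ 3 * decayConst p * decayConst (2 * p) +
      3 * (1 + strichartzConst) * (4 * C ^ 2 * decayConst (2 * p)) ^ 3) +
    8 * Real.pi ^ 2 * |γ| * P * C ^ 2 * decayConst (2 * p) + 64 * |γ| * P

namespace IsInflationScale

variable {γ s N n l t p C P T : ℝ} {φ ψ : 𝓢(ℝ, ℂ)} {u : ℝ → L2}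

theorem frequency_pos (h : IsInflationScale s N n l t) : 0 < N := by
  linarith [h.four_le]

theorem pos (h : IsInflationScale s N n l t) : 0 < n := by
  linarith [h.one_le]

theorem one_le_sqrt (h : IsInflationScale s N n l t) : 1 ≤ √N :=
  Real.one_le_sqrt.2 (by linarith [h.four_le])

theorem inv_le_one (h : IsInflationScale s N n l t) : n⁻¹ ≤ 1 :=
  inv_le_one_of_one_le₀ h.one_le

theorem mul_sqrt_mul_eq_inv (h : IsInflationScale s N n l t) :
    n * √N * (t * l ^ 2 * n ^ 2 * √N) = n⁻¹ :=
  eq_inv_of_mul_eq_one_left (by linear_combination h.balance)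

theorem time_mul_le_inv (h : IsInflationScale s N n l t) : t * l ^ 2 * n ^ 2 * √N ≤ n⁻¹ := by
  have := h.time_pos
  rw [← h.mul_sqrt_mul_eq_inv]
  exact le_mul_of_one_le_left (by positivity)
    (one_le_mul_of_one_le_of_one_le h.one_le h.one_le_sqrt)

theorem pow_three_le_inv (h : IsInflationScale s N n l t) :
    (t * l ^ 2 * n ^ 2 * √N) ^ 3 ≤ n⁻¹ := by
  have := h.time_pos
  refine (pow_le_of_le_one (by positivity) (h.time_mul_le_inv.trans h.inv_le_one)
    three_ne_zero).trans h.time_mul_le_inv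

theorem quarticError_le (h : IsInflationScale s N n l t) (hC : 0 ≤ C) (hp : 2 * p < 1)
    (hP : 0 ≤ P) :
    quarticError γ t (C * l * n) p (2 * l * √N) (4 * l * N) P ≤
      errorConst γ C p P * n⁻¹ * l ^ 3 := by
  have hS := strichartzConst_pos
  have : 0 < decayConst p := decayConst_pos (by linarith)
  have hK₂ := decayConst_pos hp
  have hl := h.amplitude_pos
  have hsqrt : N ^ 2 = √N ^ 4 := by
    rw [pow_mul √N 2 2, Real.sq_sqrt h.frequency_pos.le]
  have hresonant : t * n ^ 2 * √N ≤ n⁻¹ := by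
    rw [inv_eq_one_div, le_div_iff₀ h.pos]
    linarith [h.time_mul_pow_le]
  have hfrequency : t * √N ^ 5 ≤ n⁻¹ := by
    rw [inv_eq_one_div, le_div_iff₀ h.pos]
    exact h.time_mul_sqrt_pow_le
  calc quarticError γ t (C * l * n) p (2 * l * √N) (4 * l * N) P
    _ = 2 * (36 * C ^ 3 * decayConst p * decayConst (2 * p) * l ^ 3 *
            (n * √N * (t * l ^ 2 * n ^ 2 * √N)) +
          3 * (1 + strichartzConst) * (4 * C ^ 2 * decayConst (2 * p)) ^ 3 * l ^ 3 *
            (t * l ^ 2 * n ^ 2 * √N) ^ 3) +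
        8 * Real.pi ^ 2 * |γ| * P * C ^ 2 * decayConst (2 * p) * l ^ 3 * (t * n ^ 2 * √N) +
        64 * |γ| * P * l ^ 3 * (t * √N ^ 5) := by
      rw [quarticError, fieldBound]
      linear_combination 64 * |γ| * P * l ^ 3 * t * √N * hsqrt
    _ ≤ 2 * (36 * C ^ 3 * decayConst p * decayConst (2 * p) * l ^ 3 * n⁻¹ +
          3 * (1 + strichartzConst) * (4 * C ^ 2 * decayConst (2 * p)) ^ 3 * l ^ 3 * n⁻¹) +
        8 * Real.pi ^ 2 * |γ| * P * C ^ 2 * decayConst (2 * p) * l ^ 3 * n⁻¹ +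
        64 * |γ| * P * l ^ 3 * n⁻¹ := by
      rw [h.mul_sqrt_mul_eq_inv]
      gcongr
      exact h.pow_three_le_inv
    _ = errorConst γ C p P * n⁻¹ * l ^ 3 := by
      rw [errorConst]
      ring

theorem isPerturbative (h : IsInflationScale s N n l t) (hφ : IsDatum N l φ)
    (hdecay : HasDecay φ (C * l * n) p) (hC : 0 < C) (hp : 2 * p < 1)
    (hu : IsSolution γ T (φ.toLp 2) u) (hT : n⁻¹ < T) (hγ : |γ| * n⁻¹ ≤ 1)
    (hΛ : 8 * nonlinearityConst * n⁻¹ ≤ 1) :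
    IsPerturbative γ T t (C * l * n) p (2 * l * √N) φ u where
  isSolution := hu
  time_pos := h.time_pos
  time_lt := h.time_le.trans_lt hT
  abs_mul_time_le := (mul_le_mul_of_nonneg_left h.time_le (abs_nonneg γ)).trans hγ
  hasDecay := hdecay
  decay_pos := mul_pos (mul_pos hC h.amplitude_pos) h.pos
  two_mul_lt := hp
  mass_pos := mul_pos (mul_pos two_pos h.amplitude_pos) (Real.sqrt_pos.2 h.frequency_pos)
  norm_le := hφ.norm_toLp_le h.frequency_pos h.amplitude_pos.le
  time_mul_le := by
    have hpow : t * l ^ 2 * √N ^ 2 = n⁻¹ ^ 4 := by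
      rw [inv_pow]
      exact eq_inv_of_mul_eq_one_left (by linear_combination h.balance)
    have hinv : n⁻¹ ^ 4 ≤ n⁻¹ :=
      pow_le_of_le_one (inv_nonneg.2 h.pos.le) h.inv_le_one four_ne_zero
    have := nonlinearityConst_pos
    calc t * (nonlinearityConst * (2 * l * √N) ^ 2)
      _ = 4 * nonlinearityConst * (t * l ^ 2 * √N ^ 2) := by ring
      _ ≤ 4 * nonlinearityConst * n⁻¹ := by
        rw [hpow]
        gcongr
      _ ≤ 1 / 2 := by linarith

theorem le_norm_inner (h : IsInflationScale s N n l t) (hφ : IsDatum N l φ)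
    (hdecay : HasDecay φ (C * l * n) p) (hC : 0 < C) (hp : 2 * p < 1)
    (hu : IsSolution γ T (φ.toLp 2) u) (hT : n⁻¹ < T) (hγ : |γ| * n⁻¹ ≤ 1)
    (hΛ : 8 * nonlinearityConst * n⁻¹ ≤ 1) (hψ : IsTestFunction ψ)
    (herror : errorConst γ C p ‖ψ.toLp 2 volume‖ * n⁻¹ ≤ 1 / (2048 * Real.pi ^ 2)) :
    1 / (2048 * Real.pi ^ 2) * n ≤ ‖inner ℂ (ψ.toLp 2) (u t)‖ := by
  have hl := h.amplitude_pos
  have ht := h.time_pos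
  have hquartic := (h.quarticError_le (γ := γ) hC.le hp (norm_nonneg (ψ.toLp 2 volume))).trans
    (mul_le_mul_of_nonneg_right herror (pow_nonneg hl.le 3))
  refine le_trans ?_ ((h.isPerturbative hφ hdecay hC hp hu hT hγ hΛ).le_norm_inner hψ hφ
    h.four_le hl)
  calc 1 / (2048 * Real.pi ^ 2) * n
    _ ≤ 1 / (2048 * Real.pi ^ 2) * (t * l ^ 3) := by
      gcongr
      exact h.le_time_mul
    _ = t * (l ^ 3 / (1024 * Real.pi ^ 2) - 1 / (2048 * Real.pi ^ 2) * l ^ 3) := by ring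
    _ ≤ _ := by gcongr

end IsInflationScale

theorem eventually_mul_rpow_inv_le {k b : ℝ} (hk : 0 < k) (hb : 0 < b) (a : ℝ) :
    ∀ᶠ N : ℝ in atTop, a * (N ^ k)⁻¹ ≤ b := by
  have hlim := (tendsto_rpow_atTop hk).inv_tendsto_atTop.const_mul a
  rw [mul_zero] at hlim
  exact hlim.eventually_le_const hb

theorem ofReal_div_add_one_le_sobolevNorm {s c : ℝ} {f g : L2} (hf : sobolevNorm (-s) f ≠ ⊤)
    (h : c ≤ ‖inner ℂ f g‖) :
    ENNReal.ofReal (c / ((sobolevNorm (-s) f).toReal + 1)) ≤ sobolevNorm s g := by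
  have hB : 0 < (sobolevNorm (-s) f).toReal + 1 := by positivity
  rw [ENNReal.ofReal_div_of_pos hB]
  refine ENNReal.div_le_of_le_mul ?_
  calc ENNReal.ofReal c ≤ ‖inner ℂ f g‖ₑ := by
        rw [← ofReal_norm]
        exact ENNReal.ofReal_le_ofReal h
    _ ≤ sobolevNorm (-s) f * sobolevNorm s g := enorm_inner_le_sobolevNorm_mul s f g
    _ ≤ sobolevNorm s g * ENNReal.ofReal ((sobolevNorm (-s) f).toReal + 1) := by
      rw [mul_comm]
      gcongr
      exact (ENNReal.le_ofReal_iff_toReal_le hf hB.le).2 (by linarith)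

theorem eventually_exists_inflation (γ : ℝ) {s : ℝ} (hs : s < -3 / 2) :
    ∃ k c : ℝ, 0 < k ∧ 0 < c ∧ ∀ T : ℝ, 0 < T → ∀ᶠ N : ℝ in atTop,
      ∃ (φ : 𝓢(ℝ, ℂ)) (t : ℝ), 0 < t ∧ t ≤ (N ^ k)⁻¹ ∧
        sobolevNorm s (φ.toLp 2) ≤ ENNReal.ofReal (2 * (N ^ k)⁻¹) ∧
        ∀ u, IsSolution γ T (φ.toLp 2) u → ENNReal.ofReal (c * N ^ k) ≤ sobolevNorm s (u t) := by
  obtain ⟨k, hk₀, hk₁, hscale⟩ := exists_isInflationScale hs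
  obtain ⟨ψ, hψ⟩ := exists_isTestFunction
  obtain ⟨C, hC, hdecay⟩ := exists_hasDecay_datum
  refine ⟨k, 1 / (2048 * Real.pi ^ 2) / ((sobolevNorm (-s) (ψ.toLp 2)).toReal + 1), hk₀,
    by positivity, fun T hT => ?_⟩
  filter_upwards [eventually_ge_atTop 4, eventually_mul_rpow_inv_le hk₀ (half_pos hT) 1,
    eventually_mul_rpow_inv_le hk₀ one_pos |γ|,
    eventually_mul_rpow_inv_le hk₀ one_pos (8 * nonlinearityConst),
    eventually_mul_rpow_inv_le hk₀ (by positivity : 0 < 1 / (2048 * Real.pi ^ 2))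
      (errorConst γ C ((1 - k) / 2) ‖ψ.toLp 2 volume‖)] with N hN hNT hγ hΛ herror
  obtain ⟨l, t, h⟩ := hscale N hN
  have hl := h.amplitude_pos.le
  obtain ⟨φ, hφ⟩ := exists_isDatum h.frequency_pos hl
  refine ⟨φ, t, h.time_pos, h.time_le, ?_, fun u hu => ?_⟩
  · rw [← h.mul_rpow_eq, ← mul_assoc]
    exact hφ.sobolevNorm_le h.frequency_pos hl (by linarith)
  · have hinner := h.le_norm_inner hφ (hdecay h.frequency_pos hl hk₀.le hk₁ hφ) hC
      (by linarith) hu (by linarith) hγ hΛ hψ herror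
    rw [div_mul_eq_mul_div]
    exact ofReal_div_add_one_le_sobolevNorm (hψ.sobolevNorm_lt_top (by linarith)).ne hinner

theorem exists_inflation (γ : ℝ) {s T ε : ℝ} (hs : s < -3 / 2) (hT : 0 < T) (hε : 0 < ε) :
    ∃ (φ : 𝓢(ℝ, ℂ)) (t : ℝ), t ∈ Ioo (-T) T ∧ |t| < ε ∧
      sobolevNorm s (φ.toLp 2) < ENNReal.ofReal ε ∧
      ∀ u, IsSolution γ T (φ.toLp 2) u → ENNReal.ofReal ε⁻¹ < sobolevNorm s (u t) := by
  obtain ⟨k, c, hk, hc, hinflation⟩ := eventually_exists_inflation γ hs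
  have hinv := (tendsto_rpow_atTop hk).inv_tendsto_atTop
  obtain ⟨N, ⟨φ, t, ht₀, ht, hφ, hu⟩, hNT, hNε, hNc⟩ := ((hinflation T hT).and
    ((hinv.eventually_lt_const hT).and ((hinv.eventually_lt_const (half_pos hε)).and
      (((tendsto_rpow_atTop hk).const_mul_atTop hc).eventually_gt_atTop ε⁻¹)))).exists
  simp only [Pi.inv_apply] at hNT hNε
  refine ⟨φ, t, ⟨by linarith, by linarith⟩, ?_, hφ.trans_lt ?_, fun u hu' => ?_⟩
  · rw [abs_of_pos ht₀]
    linarith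
  · rw [ENNReal.ofReal_lt_ofReal_iff hε]
    linarith
  · exact ((ENNReal.ofReal_lt_ofReal_iff ((inv_pos.2 hε).trans hNc)).2 hNc).trans_le (hu u hu')

theorem normInflation (γ : ℝ) {s : ℝ} (hs : s < -3 / 2) : NormInflation γ s := by
  intro ε hε
  obtain ⟨φ, t, ht, htε, hφ, hinflation⟩ := exists_inflation γ hs one_pos hε
  obtain ⟨u, hu⟩ := exists_isSolution γ one_pos (φ.toLp 2)
  exact ⟨φ, 1, u, t, hu, ht, htε, hφ, hinflation u hu⟩

theorem not_continuousAtZero_of_isDataToSolutionMap {γ s T : ℝ} {S : L2 → ℝ → L2}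
    (hs : s < -3 / 2) (hT : 0 < T) (hS : IsDataToSolutionMap γ T S) :
    ¬ ContinuousAtZero s T S := by
  intro hcont
  obtain ⟨δ, hδ, hclose⟩ := hcont 1 one_pos
  have hε : 0 < min δ 1 := lt_min hδ one_pos
  obtain ⟨φ, t, ht, -, hφ, hinflation⟩ := exists_inflation γ hs hT hε
  have hzero : S 0 t = 0 := ((hS 0).2 0 (isSolution_zero γ T) ht).symm
  have hsmall : sobolevNorm s (S (φ.toLp 2) t) < ENNReal.ofReal 1 := by
    have hsup := hclose φ (hφ.trans_le (ENNReal.ofReal_le_ofReal (min_le_left _ _)))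
    have hle := le_iSup₂ (f := fun t (_ : t ∈ Ioo (-T) T) =>
      sobolevNorm s (S (φ.toLp 2) t - S 0 t)) t ht
    rw [hzero, sub_zero] at hle
    exact hle.trans_lt hsup
  have hlarge : ENNReal.ofReal 1 < sobolevNorm s (S (φ.toLp 2) t) :=
    (ENNReal.ofReal_le_ofReal ((one_le_inv₀ hε).2 (min_le_right _ _))).trans_lt
      (hinflation _ (hS (φ.toLp 2)).1)
  exact lt_asymm hsmall hlarge

end GabitovTuritsyn

end

theorem mainTheorem3_general (γ s : ℝ) (hs : s < -3 / 2) :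
    GT.NormInflation γ s ∧
      ∀ T : ℝ, 0 < T → ∃ S : GT.L2 → ℝ → GT.L2,
        GT.IsDataToSolutionMap γ T S ∧ ¬ GT.ContinuousAtZero s T S := by
  refine ⟨GabitovTuritsyn.normInflation γ hs, fun T hT => ?_⟩
  obtain ⟨S, hS⟩ := GabitovTuritsyn.exists_isDataToSolutionMap γ hT
  exact ⟨S, hS, GabitovTuritsyn.not_continuousAtZero_of_isDataToSolutionMap hs hT hS⟩

theorem mainTheorem3 (γ : ℝ) (hγ : γ ≠ 0) (s : ℝ) (hs : s < -3 / 2) :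
    GT.NormInflation γ s ∧
      ∀ T : ℝ, 0 < T → ∃ S : GT.L2 → ℝ → GT.L2,
        GT.IsDataToSolutionMap γ T S ∧ ¬ GT.ContinuousAtZero s T S :=
  mainTheorem3_general γ s hs
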